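/- Let $k$ be a commutative ring. A ($k$-linear) map-graded category $(\mathcal U,\mathfrak a)$ consists of a small category $\mathcal U$, a set $\mathfrak a_U$ of objects for every object $U$ of $\mathcal U$, a $k$-module $\mathfrak a_u(A,A')$ for every arrow $u:U\to U'$, $A\in\mathfrak a_U$, $A'\in\mathfrak a_{U'}$, and associative $k$-bilinear compositions $\mathfrak a_{u'}(A',A'')\times\mathfrak a_u(A,A')\to\mathfrak a_{u'u}(A,A'')$ with identity elements $1_A\in\mathfrak a_{1_U}(A,A)$. A graded functor $(\varphi,F):(\mathcal V,\mathfrak b)\to(\mathcal U,\mathfrak a)$ consists of a functor $\varphi:\mathcal V\to\mathcal U$, maps $F:\mathfrak b_V\to\mathfrak a_{\varphi(V)}$ and linear maps $F:\mathfrak b_v(B,B')\to\mathfrak a_{\varphi(v)}(F(B),F(B'))$ compatible with compositions and identities; it is subcartesian if all the maps $\mathfrak b_v(B,B')\to\mathfrak a_{\varphi(v)}(F(B),F(B'))$ are bijective. Let $\mathsf{Map}_{sc}$ be the category of map-graded categories and subcartesian graded functors; it has pullbacks. For $m\ge 0$ let $\mathcal N_m(\mathfrak a)$ be the set of pairs $(u,A)$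 of a string $u=(U_0\xrightarrow{u_0}U_1\to\cdots\xrightarrow{u_{m-1}}U_m)$ of composable arrows of $\mathcal U$ and a family $A=(A_i)_{0\le i\le m}$ with $A_i\in\mathfrak a_{U_i}$. For $N\in\mathbb N\cup\{\infty\}$, an $N$-cover of $(\mathcal U,\mathfrak a)$ is a family of morphisms $(\varphi_i,F_i):(\mathcal V_i,\mathfrak b_i)\to(\mathcal U,\mathfrak a)$ of $\mathsf{Map}_{sc}$ such that the induced maps $\mathcal N_m(\mathfrak b_i)\to\mathcal N_m(\mathfrak a)$ are jointly surjective for every $m\in\mathbb N$ with $m\le N$. The $N$-covers form a pretopology on $\mathsf{Map}_{sc}$. The Hochschild complex $\mathbf C_{\mathcal U}(\mathfrak a)$ has components $$\mathbf C^n_{\mathcal U}(\mathfrak a)=\prod_{(u,A)\in\mathcal N_n(\mathfrak a)}\mathrm{Hom}_k\bigl(\mathfrak a_{u_{n-1}}(A_{n-1},A_n)\otimes\cdots\otimes\mathfrak a_{u_0}(A_0,A_1),\ \mathfrak a_{u_{n-1}\cdots u_0}(A_0,A_n)\bigr)\qquad(n\ge0),$$ $\mathbf C^n_{\mathcal U}(\mathfrak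 a)=0$ for $n<0$, and carries the brace operations $\phi\{\psi_1,\dots,\psi_r\}$, the signed sums of all insertions of $\psi_1,\dots,\psi_r$, in this order, into $\phi$, where $\phi\in\mathbf C^n$ has degree $|\phi|=n-1$ in the signs. They are the components of an associative multiplication on the tensor coalgebra $T(\Sigma\mathbf C_{\mathcal U}(\mathfrak a))$, which is made into a differential graded bialgebra by the graded commutator with the cochain $\mu\in\mathbf C^2$ given by the composition of $\mathfrak a$ (on $\mathbf C$ this is the Hochschild differential up to the sign $(-1)^{|\phi|}$). A morphism $(\varphi,F):(\mathcal V,\mathfrak b)\to(\mathcal U,\mathfrak a)$ of $\mathsf{Map}_{sc}$ induces the restriction $F^*:\mathbf C_{\mathcal U}(\mathfrak a)\to\mathbf C_{\mathcal V}(\mathfrak b)$ with $$(F^*\phi)_{(v,B)}=F^{-1}\circ\phi_{(\varphi(v),F(B))}\circ F^{\otimes n}.$$ A $B_\infty$-algebra is a graded $k$-module $V$ with linear maps $T(\Sigma V)\to V$ and $T(\Sigma V)\otimes T(\Sigma V)\to V$ that are the components of a differential and a multiplication making the tensor coalgebra $T(\Sigma V)$ into a differential graded bialgebra with unit $1\in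 k=(\Sigma V)^{\otimes 0}$; a morphism of $B_\infty$-algebras is a map of graded modules that commutes with all these operations. Then: 1. For every $N\in\mathbb N\cup\{\infty\}$ and every $n\in\mathbb N$ with $n\le N$, the presheaf of $k$-modules $\mathbf C^n:(\mathcal U,\mathfrak a)\mapsto\mathbf C^n_{\mathcal U}(\mathfrak a)$ on $\mathsf{Map}_{sc}$ is a sheaf for the pretopology of $N$-covers. (For $N=n$: $\mathbf C^n$ is a sheaf for the pretopology of $n$-covers.) 2. The Hochschild complexes $\mathbf C_{\mathcal U}(\mathfrak a)$ are $B_\infty$-algebras, and the presheaf of $B_\infty$-algebras $\mathbf C:(\mathcal U,\mathfrak a)\mapsto\mathbf C_{\mathcal U}(\mathfrak a)$ on $\mathsf{Map}_{sc}$ is a sheaf for the pretopology of $\infty$-covers. -/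

import Mathlib

open CategoryTheory TensorProduct DirectSum

universe u

/-! ### B∞-algebras -/

/-- The graded module underlying a `B∞`-algebra, as a single module. -/
abbrev TotalModule {k : Type u} [CommRing k] (V : ℤ → ModuleCat.{u} k) : Type u := ⨁ n, V n

/-- The tensor coalgebra `T(sV) = ⨁ (sV)^{⊗ r}`; an element of `V n` has degree `n - 1` in `sV`. -/
abbrev TensorCoalgebra {k : Type u} [CommRing k] (V : ℤ → ModuleCat.{u} k) : Type u :=
  TensorAlgebra k (TotalModule V)

/-- The linear map between tensor coalgebras induced by a graded map. -/
noncomputable def tensorMap {k : Type u} [CommRing k] {V W : ℤ → ModuleCat.{u} k}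
    (f : ∀ n, V n →ₗ[k] W n) : TensorCoalgebra V →ₗ[k] TensorCoalgebra W :=
  (TensorAlgebra.lift k (TensorAlgebra.ι k ∘ₗ DirectSum.lmap f)).toLinearMap

/-- The data underlying a `B∞`-algebra structure on a graded module `V`: the components
`T(sV) → V` of a differential and `T(sV) ⊗ T(sV) → V` of a multiplication on `T(sV)`, where
`b t` and `m t` are the parts with values in `V t`. -/
structure BInfData (k : Type u) [CommRing k] where
  V : ℤ → ModuleCat.{u} k
  b : ∀ t, TensorCoalgebra V →ₗ[k] V t
  m : ∀ t, TensorCoalgebra V →ₗ[k] TensorCoalgebra V →ₗ[k] V t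

namespace BInfData

variable {k : Type u} [CommRing k]

/-- A morphism is a map of graded modules which commutes with all operations. -/
@[ext]
structure Hom (E E' : BInfData k) where
  f : ∀ n, E.V n →ₗ[k] E'.V n
  map_b : ∀ t x, f t (E.b t x) = E'.b t (tensorMap f x)
  map_m : ∀ t x y, f t (E.m t x y) = E'.m t (tensorMap f x) (tensorMap f y)

lemma tensorMap_id {V : ℤ → ModuleCat.{u} k} :
    tensorMap (fun n => (LinearMap.id : V n →ₗ[k] V n)) = LinearMap.id := by
  have : TensorAlgebra.lift k (TensorAlgebra.ι k ∘ₗ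
      DirectSum.lmap (fun n => (LinearMap.id : V n →ₗ[k] V n))) = AlgHom.id k _ := by
    rw [DirectSum.lmap_id]; ext x; simp
  simp only [tensorMap, this, AlgHom.toLinearMap_id]

lemma tensorMap_comp {V W Z : ℤ → ModuleCat.{u} k} (f : ∀ n, V n →ₗ[k] W n)
    (g : ∀ n, W n →ₗ[k] Z n) (x : TensorCoalgebra V) :
    tensorMap (fun n => g n ∘ₗ f n) x = tensorMap g (tensorMap f x) := by
  have : TensorAlgebra.lift k (TensorAlgebra.ι k ∘ₗ DirectSum.lmap (fun n => g n ∘ₗ f n)) =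
      (TensorAlgebra.lift k (TensorAlgebra.ι k ∘ₗ DirectSum.lmap g)).comp
        (TensorAlgebra.lift k (TensorAlgebra.ι k ∘ₗ DirectSum.lmap f)) := by
    apply TensorAlgebra.hom_ext
    ext x
    simp
  exact DFunLike.congr_fun this x

instance : Category (BInfData k) where
  Hom := Hom
  id E :=
    { f := fun _ => LinearMap.id
      map_b := by simp [tensorMap_id]
      map_m := by simp [tensorMap_id] }
  comp F G :=
    { f := fun n => G.f n ∘ₗ F.f n
      map_b := by simp [tensorMap_comp, F.map_b, G.map_b]
      map_m := by simp [tensorMap_comp, F.map_m, G.map_m] }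

variable (E : BInfData k)

/-- Words of homogeneous elements. -/
abbrev Word : Type u := List (Σ n : ℤ, E.V n)

variable {E}

/-- The degree of `x_1 ⊗ ⋯ ⊗ x_r` in `T(sV)`. -/
def deg (x : E.Word) : ℤ := (x.map fun v => v.1 - 1).sum

/-- The element of `sV ⊆ T(sV)` given by `v ∈ V n`. -/
noncomputable def single (n : ℤ) (v : E.V n) : TensorCoalgebra E.V :=
  TensorAlgebra.ι k (DirectSum.lof k ℤ (fun n => E.V n) n v)

/-- The element `x_1 ⊗ ⋯ ⊗ x_r` of `T(sV)`. -/
noncomputable def tens (x : E.Word) : TensorCoalgebra E.V :=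
  (x.map fun v => single v.1 v.2).prod

/-- The coderivation of `T(sV)` with component `b`, namely
`d x = ∑ (-1)^{|x₁|} x₁ ⊗ b (x₂) ⊗ x₃`, the sum over all factorizations `x = x₁ x₂ x₃`. -/
noncomputable def d (x : E.Word) : TensorCoalgebra E.V :=
  ∑ i ∈ Finset.range (x.length + 1), ∑ j ∈ Finset.range (x.length - i + 1),
    (deg (x.take i)).negOnePow •
      (tens (x.take i) *
        single (deg ((x.drop i).take j) + 2)
          (E.b (deg ((x.drop i).take j) + 2) (tens ((x.drop i).take j))) *
        tens ((x.drop i).drop j))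

/-- The component `T(sV) ⊗ T(sV) → (sV)^{⊗ r}` of the coalgebra map with component `m`:
`x ⊗ y ↦ ∑ ± m (x₁, y₁) ⊗ ⋯ ⊗ m (x_r, y_r)`, the sum over all factorizations `x = x₁ ⋯ x_r`
and `y = y₁ ⋯ y_r`, with the Koszul sign of the shuffle of the factors. -/
noncomputable def blocks : ℕ → E.Word → E.Word → TensorCoalgebra E.V
  | 0, x, y => if x.length + y.length = 0 then 1 else 0
  | r + 1, x, y =>
    ∑ i ∈ Finset.range (x.length + 1), ∑ j ∈ Finset.range (y.length + 1),
      (deg (x.drop i) * deg (y.take j)).negOnePow •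
        (single (deg (x.take i) + deg (y.take j) + 1)
            (E.m (deg (x.take i) + deg (y.take j) + 1) (tens (x.take i)) (tens (y.take j))) *
          blocks r (x.drop i) (y.drop j))

/-- The coalgebra map `T(sV) ⊗ T(sV) → T(sV)` with component `m`. -/
noncomputable def mul (x y : E.Word) : TensorCoalgebra E.V :=
  ∑ r ∈ Finset.range (x.length + y.length + 1), blocks r x y

/-- `B∞`-algebras: the coderivation `d` of degree one and the coalgebra map `mul` of degree zero
make `T(sV)` into a differential graded bialgebra with unit `1 ∈ k = (sV)^{⊗ 0}`. The identities
between coderivations and between coalgebra maps are imposed on their components in `V`, which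
determine them. -/
structure IsBInf (E : BInfData k) : Prop where
  b_deg : ∀ (x : E.Word) (t : ℤ), t ≠ deg x + 2 → E.b t (tens x) = 0
  m_deg : ∀ (x y : E.Word) (t : ℤ), t ≠ deg x + deg y + 1 → E.m t (tens x) (tens y) = 0
  b_one : ∀ t, E.b t 1 = 0
  one_m : ∀ t x, E.m t 1 x = DirectSum.component k ℤ (fun n => E.V n) t (TensorAlgebra.ιInv x)
  m_one : ∀ t x, E.m t x 1 = DirectSum.component k ℤ (fun n => E.V n) t (TensorAlgebra.ιInv x)
  assoc : ∀ (x y z : E.Word) (t : ℤ), E.m t (mul x y) (tens z) = E.m t (tens x) (mul y z)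
  b_d : ∀ (x : E.Word) (t : ℤ), E.b t (d x) = 0
  leibniz : ∀ (x y : E.Word) (t : ℤ), E.b t (mul x y) =
    E.m t (d x) (tens y) + (deg x).negOnePow • E.m t (tens x) (d y)

end BInfData

/-- The category of `B∞`-algebras. -/
abbrev BInf (k : Type u) [CommRing k] :=
  ObjectProperty.FullSubcategory fun E : BInfData k => E.IsBInf

/-! ### Map-graded categories -/

/-- A `k`-linear map-graded category `(U, 𝔞)`. Composition is indexed by a proof that the
resulting degree is the composite of the degrees. -/
structure MapGr (k : Type u) [CommRing k] where
  base : Type u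
  [cat : SmallCategory base]
  ob : base → Type u
  hom : ∀ {U V : base}, (U ⟶ V) → ob U → ob V → ModuleCat.{u} k
  comp : ∀ {U V W : base} {v : U ⟶ V} {u : V ⟶ W} {w : U ⟶ W}, v ≫ u = w →
    ∀ {A : ob U} {B : ob V} {C : ob W}, hom u B C →ₗ[k] hom v A B →ₗ[k] hom w A C
  one : ∀ {U : base} {e : U ⟶ U}, e = 𝟙 U → ∀ A : ob U, hom e A A
  comp_one : ∀ {U V : base} {u : U ⟶ V} {e : U ⟶ U} (he : e = 𝟙 U) (h : e ≫ u = u)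
    {A : ob U} {B : ob V} (x : hom u A B), comp h x (one he A) = x
  one_comp : ∀ {U V : base} {u : U ⟶ V} {e : V ⟶ V} (he : e = 𝟙 V) (h : u ≫ e = u)
    {A : ob U} {B : ob V} (x : hom u A B), comp h (one he B) x = x
  assoc : ∀ {U V W Z : base} {w : U ⟶ V} {v : V ⟶ W} {u : W ⟶ Z} {wv : U ⟶ W} {vu : V ⟶ Z}
    {wvu : U ⟶ Z} (h₁ : w ≫ v = wv) (h₂ : v ≫ u = vu) (h₃ : wv ≫ u = wvu) (h₄ : w ≫ vu = wvu)
    {A : ob U} {B : ob V} {C : ob W} {D : ob Z} (x : hom u C D) (y : hom v B C) (z : hom w A B),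
    comp h₃ x (comp h₁ y z) = comp h₄ (comp h₂ x y) z

attribute [instance] MapGr.cat

namespace MapGr

variable {k : Type u} [CommRing k]

/-- A graded functor `(φ, F) : (U, 𝔞) ⟶ (V, 𝔟)`. -/
@[ext]
structure Fun (X Y : MapGr k) where
  base : X.base ⥤ Y.base
  ob : ∀ {U : X.base}, X.ob U → Y.ob (base.obj U)
  map : ∀ {U V : X.base} (u : U ⟶ V) (A : X.ob U) (B : X.ob V),
    X.hom u A B →ₗ[k] Y.hom (base.map u) (ob A) (ob B)
  map_one : ∀ {U : X.base} {e : U ⟶ U} (he : e = 𝟙 U) (A : X.ob U),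
    map e A A (X.one he A) = Y.one (by rw [he, base.map_id]) (ob A)
  map_comp : ∀ {U V W : X.base} {v : U ⟶ V} {u : V ⟶ W} {w : U ⟶ W} (h : v ≫ u = w)
    {A : X.ob U} {B : X.ob V} {C : X.ob W} (x : X.hom u B C) (y : X.hom v A B),
    map w A C (X.comp h x y) = Y.comp (by rw [← h, base.map_comp]) (map u B C x) (map v A B y)

instance : Category (MapGr k) where
  Hom := Fun
  id X :=
    { base := 𝟭 _
      ob := id
      map := fun _ _ _ => LinearMap.id
      map_one := fun _ _ => rfl
      map_comp := by intros; rfl }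
  comp F G :=
    { base := F.base ⋙ G.base
      ob := fun A => G.ob (F.ob A)
      map := fun u A B => G.map _ _ _ ∘ₗ F.map u A B
      map_one := fun he A => by
        rw [LinearMap.comp_apply, F.map_one, G.map_one]
      map_comp := by
        intro U V W v u w h A B C x y
        simp only [LinearMap.comp_apply]
        rw [F.map_comp h, G.map_comp] }

/-- A graded functor is subcartesian if it is bijective on all modules of morphisms; equivalently, if
it is cartesian with respect to the functor to graded sets, see
`subcartesian_iff_isStronglyCartesian`. -/
def subcartesian (k : Type u) [CommRing k] : MorphismProperty (MapGr k) := fun _ _ F =>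
  ∀ {U V} (u : U ⟶ V) (A) (B), Function.Bijective (Fun.map F u A B)

instance : (subcartesian k).IsMultiplicative where
  id_mem _ _ _ _ _ _ := Function.bijective_id
  comp_mem _ _ hF hG _ _ _ _ _ := (hG _ _ _).comp (hF _ _ _)

/-- The objects `A_U` of the category `U♯` associated to a map-graded category `(U, 𝔞)`; the
arrows `A_U ⟶ A'_{U'}` of `U♯` are the arrows `U ⟶ U'` of `U`. -/
@[ext]
structure Pt (X : MapGr k) where
  base : X.base
  ob : X.ob base

variable {X Y Z : MapGr k}

/-- Strings of composable arrows of `U♯`. -/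
inductive Str (X : MapGr k) (A : X.Pt) : X.Pt → Type u
  | nil : Str X A A
  | cons {B C : X.Pt} (p : Str X A B) (u : B.base ⟶ C.base) : Str X A C

namespace Str

/-- The number of arrows. -/
def length {A : X.Pt} : {B : X.Pt} → X.Str A B → ℕ
  | _, nil => 0
  | _, cons p _ => p.length + 1

/-- The composite `|u| = u_{n-1} ⋯ u_0`. -/
def total {A : X.Pt} : {B : X.Pt} → X.Str A B → (A.base ⟶ B.base)
  | _, nil => 𝟙 A.base
  | _, cons p u => p.total ≫ u

/-- Concatenation (the second string comes after the first one). -/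
def append {A B : X.Pt} (p : X.Str A B) : {C : X.Pt} → X.Str B C → X.Str A C
  | _, nil => p
  | _, cons q u => (p.append q).cons u

/-- The module `𝔞_{u_{n-1}}(A_{n-1}, A_n) ⊗ ⋯ ⊗ 𝔞_{u_0}(A_0, A_1)` (with a factor `k` at the
right end, so that it is `k` for `n = 0`). -/
noncomputable def tens {A : X.Pt} : {B : X.Pt} → X.Str A B → ModuleCat.{u} k
  | _, nil => ModuleCat.of k k
  | _, @cons _ _ _ _ B C p u => ModuleCat.of k (X.hom u B.ob C.ob ⊗[k] tens p)

end Str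

/-- The image of an object of `U♯`. -/
abbrev Fun.pt (F : X ⟶ Y) (A : X.Pt) : Y.Pt := ⟨(Fun.base F).obj A.base, Fun.ob F A.ob⟩

/-- The image of a string. -/
def Fun.str (F : X ⟶ Y) {A : X.Pt} : {B : X.Pt} → X.Str A B → Y.Str (Fun.pt F A) (Fun.pt F B)
  | _, .nil => .nil
  | _, .cons p u => .cons (C := Fun.pt F _) (Fun.str F p) ((Fun.base F).map u)

/-- The linear map `F ⊗ ⋯ ⊗ F`. -/
noncomputable def Fun.tens (F : X ⟶ Y) {A : X.Pt} : {B : X.Pt} → (p : X.Str A B) →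
    (p.tens →ₗ[k] (Fun.str F p).tens)
  | _, .nil => (LinearMap.id : k →ₗ[k] k)
  | _, .cons p u => TensorProduct.map (Fun.map F u _ _) (Fun.tens F p)

lemma Fun.length_str (F : X ⟶ Y) {A B : X.Pt} (p : X.Str A B) :
    (Fun.str F p).length = p.length := by
  induction p with
  | nil => rfl
  | cons p u ih => simp [Fun.str, Str.length, ih]

lemma Fun.total_str (F : X ⟶ Y) {A B : X.Pt} (p : X.Str A B) :
    (Fun.str F p).total = (Fun.base F).map p.total := by
  induction p with
  | nil => exact ((Fun.base F).map_id _).symm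
  | cons p u ih => simp [Fun.str, Str.total, ih]

/-- The `n`-simplices of the nerve of `(U, 𝔞)`, that is, of `U♯` (none if `n < 0`). -/
structure Simplex (X : MapGr k) (n : ℤ) where
  src : X.Pt
  tgt : X.Pt
  str : X.Str src tgt
  length_eq : (str.length : ℤ) = n

/-- The map induced on nerves by a graded functor. -/
def Simplex.map (F : X ⟶ Y) {n : ℤ} (s : X.Simplex n) : Y.Simplex n where
  src := Fun.pt F s.src
  tgt := Fun.pt F s.tgt
  str := Fun.str F s.str
  length_eq := by rw [Fun.length_str, s.length_eq]

/-- The module `C^n` of Hochschild cochains. -/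
noncomputable def cochain (X : MapGr k) (n : ℤ) : ModuleCat.{u} k :=
  ModuleCat.of k (∀ s : X.Simplex n, s.str.tens →ₗ[k] X.hom s.str.total s.src.ob s.tgt.ob)

/-- Transport of morphisms along an equality of degrees. -/
def tr {A B : X.Pt} {u v : A.base ⟶ B.base} (h : u = v) :
    X.hom u A.ob B.ob ≃ₗ[k] X.hom v A.ob B.ob :=
  h ▸ LinearEquiv.refl k _

/-- The inverse of a subcartesian graded functor on modules of morphisms. -/
noncomputable def Fun.inv (F : X ⟶ Y) (hF : subcartesian k F) {A B : X.Pt}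
    (u : A.base ⟶ B.base) :
    Y.hom ((Fun.base F).map u) (Fun.pt F A).ob (Fun.pt F B).ob →ₗ[k] X.hom u A.ob B.ob :=
  (LinearEquiv.ofBijective (Fun.map F u A.ob B.ob) (hF u A.ob B.ob)).symm.toLinearMap

/-- The restriction `F^* φ = F⁻¹ ∘ φ ∘ F^{⊗ n}` along a subcartesian graded functor. -/
noncomputable def restr (F : X ⟶ Y) (hF : subcartesian k F) (n : ℤ) :
    Y.cochain n →ₗ[k] X.cochain n where
  toFun φ := fun s => Fun.inv F hF s.str.total ∘ₗ (tr (Fun.total_str F s.str)).toLinearMap ∘ₗ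
    φ (s.map F) ∘ₗ Fun.tens F s.str
  map_add' φ ψ := by
    funext s
    apply LinearMap.ext
    intro x
    exact ((Fun.inv F hF _).comp (tr (Fun.total_str F s.str)).toLinearMap).map_add _ _
  map_smul' c φ := by
    funext s
    apply LinearMap.ext
    intro x
    exact ((Fun.inv F hF _).comp (tr (Fun.total_str F s.str)).toLinearMap).map_smul _ _

/-! ### Brace operations -/

namespace Str

/-- A way to cut a string into an earlier and a later part, together with the induced map
`x_n ⊗ ⋯ ⊗ x_1 ↦ (x_n ⊗ ⋯ ⊗ x_{i+1}) ⊗ (x_i ⊗ ⋯ ⊗ x_1)`. -/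
structure Cut {A B : X.Pt} (p : X.Str A B) where
  mid : X.Pt
  early : X.Str A mid
  late : X.Str mid B
  total_eq : early.total ≫ late.total = p.total
  split : p.tens →ₗ[k] late.tens ⊗[k] early.tens

/-- The cut after the last arrow. -/
noncomputable def Cut.last {A B : X.Pt} (p : X.Str A B) : p.Cut where
  mid := B
  early := p
  late := nil
  total_eq := Category.comp_id _
  split := (TensorProduct.lid k p.tens).symm.toLinearMap

/-- Adding an arrow to the later part of a cut. -/
noncomputable def Cut.extend {A B C : X.Pt} {p : X.Str A B} (u : B.base ⟶ C.base) (c : p.Cut) :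
    (p.cons u).Cut where
  mid := c.mid
  early := c.early
  late := c.late.cons u
  total_eq := by simp only [total, ← c.total_eq, Category.assoc]
  split := (TensorProduct.assoc k _ _ _).symm.toLinearMap ∘ₗ c.split.lTensor (X.hom u B.ob C.ob)

/-- All the ways to cut a string in two. -/
noncomputable def cuts {A : X.Pt} : {B : X.Pt} → (p : X.Str A B) → List p.Cut
  | _, nil => [Cut.last nil]
  | _, cons p u => Cut.last (p.cons u) :: (cuts p).map (Cut.extend u)

/-- Concatenation of tensors. -/
noncomputable def tensAppend {A B : X.Pt} (p : X.Str A B) :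
    {C : X.Pt} → (q : X.Str B C) → q.tens ⊗[k] p.tens →ₗ[k] (p.append q).tens
  | _, nil => (TensorProduct.lid k p.tens).toLinearMap
  | _, @cons _ _ _ _ C D q u =>
    (tensAppend p q).lTensor (X.hom u C.ob D.ob) ∘ₗ (TensorProduct.assoc k _ _ _).toLinearMap

lemma total_append {A B C : X.Pt} (p : X.Str A B) (q : X.Str B C) :
    (p.append q).total = p.total ≫ q.total := by
  induction q with
  | nil => exact (Category.comp_id _).symm
  | cons q u ih => simp only [append, total, ih, Category.assoc]

end Str

/-- The direct sum of the modules `𝔞_{u_{n-1}}(A_{n-1}, A_n) ⊗ ⋯ ⊗ 𝔞_{u_0}(A_0, A_1)` over all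
strings from `A` to `B` with composite `w`. -/
abbrev Bar (A B : X.Pt) (w : A.base ⟶ B.base) : Type u :=
  ⨁ s : {p : X.Str A B // p.total = w}, s.1.tens

namespace Bar

open Classical in
/-- The inclusion of a summand. -/
noncomputable def of {A B : X.Pt} (p : X.Str A B) {w : A.base ⟶ B.base} (h : p.total = w) :
    p.tens →ₗ[k] Bar A B w :=
  DirectSum.lof k _ (fun s : {p : X.Str A B // p.total = w} => s.1.tens) ⟨p, h⟩

open Classical in
/-- The linear map with given restrictions to the summands. -/
noncomputable def lift {A B : X.Pt} {w : A.base ⟶ B.base} {M : Type u} [AddCommGroup M]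
    [Module k M] (f : ∀ p : X.Str A B, p.total = w → (p.tens →ₗ[k] M)) : Bar A B w →ₗ[k] M :=
  DirectSum.toModule k _ M fun s => f s.1 s.2

/-- Concatenation of tensors. -/
noncomputable def mul {A B C : X.Pt} {v : A.base ⟶ B.base} {u : B.base ⟶ C.base}
    {w : A.base ⟶ C.base} (h : v ≫ u = w) : Bar B C u →ₗ[k] Bar A B v →ₗ[k] Bar A C w :=
  lift fun q hq => LinearMap.flip <| lift fun p hp => LinearMap.flip <| TensorProduct.curry <|
    of (p.append q) (by rw [Str.total_append, hp, hq, h]) ∘ₗ Str.tensAppend p q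

end Bar

/-- Cochains of all degrees. -/
abbrev Cochains (X : MapGr k) : Type u := ⨁ n : ℤ, X.cochain n

/-- The value of a cochain on a string. -/
noncomputable def eval {A B : X.Pt} (p : X.Str A B) :
    X.Cochains →ₗ[k] p.tens →ₗ[k] X.hom p.total A.ob B.ob :=
  (LinearMap.proj (R := k) (φ := fun s : X.Simplex p.length =>
    s.str.tens →ₗ[k] X.hom s.str.total s.src.ob s.tgt.ob) ⟨A, B, p, rfl⟩) ∘ₗ
    DirectSum.component k ℤ (fun n => X.cochain n) p.length

open Classical in
lemma Bar.hom_ext {A B : X.Pt} {w : A.base ⟶ B.base} {M : Type u} [AddCommGroup M] [Module k M]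
    {f g : Bar A B w →ₗ[k] M}
    (h : ∀ (p : X.Str A B) (hp : p.total = w), f ∘ₗ Bar.of p hp = g ∘ₗ Bar.of p hp) : f = g :=
  DirectSum.linearMap_ext _ fun s => h s.1 s.2

lemma Bar.lift_comp_of {A B : X.Pt} {w : A.base ⟶ B.base} {M : Type u} [AddCommGroup M]
    [Module k M] (f : ∀ p : X.Str A B, p.total = w → (p.tens →ₗ[k] M)) (p : X.Str A B)
    (hp : p.total = w) : Bar.lift f ∘ₗ Bar.of p hp = f p hp := by
  ext x
  simp [Bar.lift, Bar.of]

/-- The value `x ↦ φ (x)` of a cochain `φ` on the bar construction. -/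
noncomputable def evalBar {A B : X.Pt} (w : A.base ⟶ B.base) :
    X.Cochains →ₗ[k] Bar A B w →ₗ[k] X.hom w A.ob B.ob where
  toFun φ := Bar.lift fun p h => (tr h).toLinearMap ∘ₗ eval p φ
  map_add' φ ψ := Bar.hom_ext fun p hp => by
    simp only [LinearMap.add_comp, Bar.lift_comp_of, map_add, LinearMap.comp_add]
  map_smul' c φ := Bar.hom_ext fun p hp => by
    simp only [LinearMap.smul_comp, Bar.lift_comp_of, map_smul, LinearMap.comp_smul,
      RingHom.id_apply]

/-- The inclusion of `𝔞_u (B, C) ⊗ (𝔞_{u_{n-1}}(A_{n-1}, B) ⊗ ⋯ ⊗ 𝔞_{u_0}(A, A_1))`. -/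
noncomputable def Bar.ofCons {A B C : X.Pt} (p : X.Str A B) (u : B.base ⟶ C.base)
    {w : A.base ⟶ C.base} (h : p.total ≫ u = w) : X.hom u B.ob C.ob ⊗[k] p.tens →ₗ[k] Bar A C w :=
  Bar.of (p.cons u) h

/-- Evaluation of a cochain on the leftmost factors,
`x_n ⊗ ⋯ ⊗ x_1 ↦ ∑ ± ψ (x_n, …, x_{i+1}) ⊗ x_i ⊗ ⋯ ⊗ x_1`, with the Koszul sign of moving `ψ`
past `N` further factors (of degree one) to the left. -/
noncomputable def insert (N : ℕ) {A B : X.Pt} (p : X.Str A B) {w : A.base ⟶ B.base}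
    (h : p.total = w) : X.Cochains →ₗ[k] p.tens →ₗ[k] Bar A B w where
  toFun ψ := (p.cuts.map fun c => (-1 : k) ^ (N * (c.late.length + 1)) •
    (Bar.ofCons c.early c.late.total (c.total_eq.trans h) ∘ₗ
      (eval c.late ψ).rTensor c.early.tens ∘ₗ c.split)).sum
  map_add' φ ψ := by
    simp only [map_add, LinearMap.rTensor_add, LinearMap.add_comp, LinearMap.comp_add, smul_add,
      List.sum_map_add]
  map_smul' c φ := by
    rw [RingHom.id_apply, List.smul_sum, List.map_map]
    refine congrArg List.sum (List.map_congr_left fun d _ => ?_)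
    simp only [map_smul, LinearMap.rTensor_smul, LinearMap.smul_comp, LinearMap.comp_smul,
      Function.comp_apply, smul_comm c]

variable (X) in
/-- Families of operators on the bar construction. -/
abbrev Op : Type u := ∀ (A B : X.Pt) (w : A.base ⟶ B.base), Bar A B w →ₗ[k] Bar A B w

/-- The operator `x ↦ ∑ ± g (x₁) ⊗ ψ (x₂) ⊗ x₃`, the sum over all factorizations
`x = x₁ ⊗ x₂ ⊗ x₃`. -/
noncomputable def stepOp (ψ : X.Cochains) (g : X.Op) : X.Op := fun _ B _ =>
  Bar.lift fun p h => (p.cuts.map fun c =>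
    TensorProduct.lift (Bar.mul (c.total_eq.trans h)) ∘ₗ
      TensorProduct.map (g c.mid B c.late.total ∘ₗ Bar.of c.late rfl)
        (insert c.late.length c.early rfl ψ) ∘ₗ c.split).sum

lemma stepOp_comp_of (ψ : X.Cochains) (g : X.Op) {A B : X.Pt} {w : A.base ⟶ B.base}
    (p : X.Str A B) (h : p.total = w) : stepOp ψ g A B w ∘ₗ Bar.of p h = (p.cuts.map fun c =>
      TensorProduct.lift (Bar.mul (c.total_eq.trans h)) ∘ₗ
        TensorProduct.map (g c.mid B c.late.total ∘ₗ Bar.of c.late rfl)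
          (insert c.late.length c.early rfl ψ) ∘ₗ c.split).sum := by
  rw [stepOp, Bar.lift_comp_of]

/-- `stepOp` as a bilinear map. -/
noncomputable def step : X.Cochains →ₗ[k] X.Op →ₗ[k] X.Op :=
  LinearMap.mk₂ k stepOp
    (fun φ ψ g => by
      funext A B w
      refine Bar.hom_ext fun p hp => ?_
      simp only [Pi.add_apply, LinearMap.add_comp, stepOp_comp_of, map_add,
        TensorProduct.map_add_right, LinearMap.comp_add, List.sum_map_add])
    (fun c φ g => by
      funext A B w
      refine Bar.hom_ext fun p hp => ?_
      rw [Pi.smul_apply, Pi.smul_apply, Pi.smul_apply, LinearMap.smul_comp, stepOp_comp_of,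
        stepOp_comp_of, List.smul_sum, List.map_map]
      refine congrArg List.sum (List.map_congr_left fun d _ => ?_)
      simp only [map_smul, TensorProduct.map_smul_right, LinearMap.smul_comp, LinearMap.comp_smul,
        Function.comp_apply])
    (fun φ g g' => by
      funext A B w
      refine Bar.hom_ext fun p hp => ?_
      simp only [Pi.add_apply, LinearMap.add_comp, stepOp_comp_of,
        TensorProduct.map_add_left, LinearMap.comp_add, List.sum_map_add])
    (fun c φ g => by
      funext A B w
      refine Bar.hom_ext fun p hp => ?_
      rw [Pi.smul_apply, Pi.smul_apply, Pi.smul_apply, LinearMap.smul_comp, stepOp_comp_of,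
        stepOp_comp_of, List.smul_sum, List.map_map]
      refine congrArg List.sum (List.map_congr_left fun d _ => ?_)
      simp only [Pi.smul_apply, TensorProduct.map_smul_left, LinearMap.smul_comp,
        LinearMap.comp_smul, Function.comp_apply])

/-- The action of `T(sC)` on the bar construction,
`ψ_1 ⊗ ⋯ ⊗ ψ_r ↦ (x ↦ ∑ ± x₀ ⊗ ψ_1 (y₁) ⊗ x₁ ⊗ ⋯ ⊗ ψ_r (y_r) ⊗ x_r)`, the sum over all
factorizations `x = x₀ ⊗ y₁ ⊗ x₁ ⊗ ⋯ ⊗ y_r ⊗ x_r`. It is obtained by applying successively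
`step ψ_1, …, step ψ_r` to the identity. -/
noncomputable def act : TensorCoalgebra X.cochain →ₗ[k] X.Op :=
  LinearMap.applyₗ (fun A B w => (LinearMap.id : Bar A B w →ₗ[k] Bar A B w)) ∘ₗ
    (MulOpposite.opLinearEquiv k).symm.toLinearMap ∘ₗ
    (TensorAlgebra.lift k ((MulOpposite.opLinearEquiv k).toLinearMap ∘ₗ
      (step : X.Cochains →ₗ[k] Module.End k X.Op))).toLinearMap

/-- The brace operations: for `φ ∈ C`, `brace n (φ) (ψ_1 ⊗ ⋯ ⊗ ψ_r)` is the part in `C^n` of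
`φ{ψ_1, …, ψ_r}`, the cochain
`x ↦ ∑ ± φ (x₀ ⊗ ψ_1 (y₁) ⊗ x₁ ⊗ ⋯ ⊗ ψ_r (y_r) ⊗ x_r)`. -/
noncomputable def brace (n : ℤ) :
    X.Cochains →ₗ[k] TensorCoalgebra X.cochain →ₗ[k] X.cochain n :=
  LinearMap.mk₂ k
    (fun φ t => fun s => evalBar s.str.total φ ∘ₗ act t s.src s.tgt s.str.total ∘ₗ
      Bar.of s.str rfl)
    (fun φ ψ t => by funext s; simp only [map_add, LinearMap.add_comp]; rfl)
    (fun c φ t => by funext s; simp only [map_smul, LinearMap.smul_comp]; rfl)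
    (fun φ t t' => by
      funext s; simp only [map_add, Pi.add_apply, LinearMap.add_comp, LinearMap.comp_add]; rfl)
    (fun c φ t => by
      funext s; simp only [map_smul, Pi.smul_apply, LinearMap.smul_comp, LinearMap.comp_smul]; rfl)

variable (X) in
/-- The cochain given by the composition of `𝔞`, on the `2`-simplices. -/
noncomputable def compCochain : X.cochain 2 := fun s =>
  match s with
  | ⟨_, _, .cons (.cons .nil u) v, _⟩ =>
    TensorProduct.lift ((TensorProduct.rid k _).toLinearMap.lcomp k _ ∘ₗ
      X.comp (by simp [Str.total]))
  | _ => 0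

/-- The components of the multiplication of `T(sC)`:
`φ ⊗ (ψ_1 ⊗ ⋯ ⊗ ψ_r) ↦ φ{ψ_1, …, ψ_r}` and `1 ⊗ ψ ↦ ψ`. -/
noncomputable def mulComponent (n : ℤ) :
    TensorCoalgebra X.cochain →ₗ[k] TensorCoalgebra X.cochain →ₗ[k] X.cochain n :=
  brace n ∘ₗ TensorAlgebra.ιInv +
    (TensorAlgebra.algebraMapInv (R := k) (M := X.Cochains)).toLinearMap.smulRight
      (DirectSum.component k ℤ (fun n => X.cochain n) n ∘ₗ TensorAlgebra.ιInv)

variable (X) in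
/-- The composition cochain as an element of `T(sC)`. -/
noncomputable def mu : TensorCoalgebra X.cochain :=
  TensorAlgebra.ι k (DirectSum.lof k ℤ (fun n => X.cochain n) 2 X.compCochain)

variable (X) in
/-- The map `φ ↦ (-1)^{|φ|} φ` on `sC`. -/
noncomputable def parity (n : ℤ) : X.cochain n →ₗ[k] X.cochain n :=
  (n - 1).negOnePow • LinearMap.id

/-- The Hochschild complex of `(U, 𝔞)` with the components of its multiplication and of its
differential on `T(sC)`. The differential is the graded commutator `x ↦ μ x - (-1)^{|x|} x μ` with
the cochain `μ` given by the composition of `𝔞`; its nonzero components are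
`φ ↦ μ{φ} - (-1)^{|φ|} φ{μ}`, which is the Hochschild differential up to the sign `(-1)^{|φ|}`, and
`φ ⊗ ψ ↦ μ{φ, ψ}`, which is the cup product up to sign. -/
noncomputable def hochschild (X : MapGr k) : BInfData k where
  V := X.cochain
  m n := mulComponent n
  b n := mulComponent n X.mu - (mulComponent n).flip X.mu ∘ₗ tensorMap X.parity

section functoriality

/-- Transport along an equality of strings. -/
noncomputable def castTens {A B : X.Pt} {p q : X.Str A B} (h : p = q) : p.tens →ₗ[k] q.tens :=
  h ▸ LinearMap.id

lemma Bar.of_comp_castTens {A B : X.Pt} {p q : X.Str A B} (h : p = q) {w : A.base ⟶ B.base}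
    (hq : q.total = w) : Bar.of q hq ∘ₗ castTens h = Bar.of p (h ▸ hq) := by
  subst h; rfl

lemma castTens_cons {A B C : X.Pt} {p q : X.Str A B} (h : p = q) (u : B.base ⟶ C.base) :
    castTens (congrArg (fun p => Str.cons p u) h) =
      LinearMap.lTensor (X.hom u B.ob C.ob) (castTens h) := by
  subst h
  exact (LinearMap.lTensor_id _ _).symm

lemma cochain_castTens {n : ℤ} (φ : X.cochain n) {A B : X.Pt} {p q : X.Str A B} (h : p = q)
    (hp : (p.length : ℤ) = n) (hq : (q.length : ℤ) = n) (x : p.tens) :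
    φ ⟨A, B, q, hq⟩ (castTens h x) = tr (congrArg Str.total h) (φ ⟨A, B, p, hp⟩ x) := by
  subst h; rfl

lemma tr_tr {A B : X.Pt} {u v w : A.base ⟶ B.base} (h : u = v) (h' : v = w)
    (x : X.hom u A.ob B.ob) : tr h' (tr h x) = tr (h.trans h') x := by
  subst h; subst h'; rfl

lemma map_tr (F : X ⟶ Y) {A B : X.Pt} {u v : A.base ⟶ B.base} (h : u = v)
    (x : X.hom u A.ob B.ob) : Fun.map F v A.ob B.ob (tr h x) =
      tr (A := Fun.pt F A) (B := Fun.pt F B) (congrArg (Fun.base F).map h)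
        (Fun.map F u A.ob B.ob x) := by
  subst h; rfl

lemma map_inv (F : X ⟶ Y) (hF : subcartesian k F) {A B : X.Pt} (u : A.base ⟶ B.base)
    (y : Y.hom ((Fun.base F).map u) (Fun.pt F A).ob (Fun.pt F B).ob) :
    Fun.map F u A.ob B.ob (Fun.inv F hF u y) = y :=
  (LinearEquiv.ofBijective (Fun.map F u A.ob B.ob) (hF u A.ob B.ob)).apply_symm_apply y

lemma map_restr (F : X ⟶ Y) (hF : subcartesian k F) {n : ℤ} (φ : Y.cochain n) (s : X.Simplex n)
    (x : s.str.tens) : Fun.map F _ _ _ (restr F hF n φ s x) =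
      tr (Fun.total_str F s.str) (φ (s.map F) (Fun.tens F s.str x)) :=
  map_inv F hF _ _

lemma str_id {A B : X.Pt} (p : X.Str A B) : p = Fun.str (𝟙 X) p := by
  induction p with
  | nil => rfl
  | cons p u ih => exact congrArg (fun p => Str.cons p u) ih

lemma tens_id {A B : X.Pt} (p : X.Str A B) : Fun.tens (𝟙 X) p = castTens (str_id p) := by
  induction p with
  | nil => rfl
  | cons p u ih =>
    refine Eq.trans ?_ (castTens_cons (str_id p) u).symm
    rw [← ih]; rfl

lemma str_comp (F : X ⟶ Y) (G : Y ⟶ Z) {A B : X.Pt} (p : X.Str A B) :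
    Fun.str (F ≫ G) p = Fun.str G (Fun.str F p) := by
  induction p with
  | nil => rfl
  | @cons B C p u ih =>
    exact congrArg (fun p : Z.Str (Fun.pt (F ≫ G) A) (Fun.pt (F ≫ G) B) =>
      Str.cons (C := Fun.pt (F ≫ G) C) p ((Fun.base (F ≫ G)).map u)) ih

lemma tens_comp (F : X ⟶ Y) (G : Y ⟶ Z) {A B : X.Pt} (p : X.Str A B) :
    castTens (str_comp F G p) ∘ₗ Fun.tens (F ≫ G) p = Fun.tens G (Fun.str F p) ∘ₗ Fun.tens F p := by
  induction p with
  | nil => rfl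
  | @cons B C p u ih =>
    have h := castTens_cons (X := Z) (C := Fun.pt (F ≫ G) C) (str_comp F G p)
      ((Fun.base (F ≫ G)).map u)
    refine Eq.trans (congrArg (fun f => f ∘ₗ Fun.tens (F ≫ G) (p.cons u)) h) ?_
    refine TensorProduct.ext' fun a x => ?_
    exact congrArg (fun y => (Fun.map G _ _ _ (Fun.map F u _ _ a)) ⊗ₜ[k] y)
      (DFunLike.congr_fun ih x)

lemma restr_id (n : ℤ) : restr (𝟙 X) ((subcartesian k).id_mem X) n = LinearMap.id := by
  refine LinearMap.ext fun φ => ?_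
  funext s
  refine LinearMap.ext fun x => ?_
  have := map_restr (𝟙 X) ((subcartesian k).id_mem X) φ s x
  refine Eq.trans this ?_
  rw [tens_id]
  have h := cochain_castTens φ (str_id s.str) s.length_eq
    (by rw [← str_id, s.length_eq]) x
  exact (congrArg _ h).trans (tr_tr _ _ _)

lemma restr_comp (F : X ⟶ Y) (G : Y ⟶ Z) (hF : subcartesian k F) (hG : subcartesian k G) (n : ℤ) :
    restr (F ≫ G) ((subcartesian k).comp_mem F G hF hG) n = restr F hF n ∘ₗ restr G hG n := by
  refine LinearMap.ext fun φ => ?_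
  funext s
  refine LinearMap.ext fun x => ?_
  apply ((subcartesian k).comp_mem F G hF hG s.str.total s.src.ob s.tgt.ob).1
  refine (map_restr (F ≫ G) _ φ s x).trans ?_
  have h₁ := congrArg (Fun.map G _ _ _) (map_restr F hF (restr G hG n φ) s x)
  refine Eq.trans ?_ h₁.symm
  refine Eq.trans ?_ (map_tr G (Fun.total_str F s.str) _).symm
  refine Eq.trans ?_ (congrArg _ (map_restr G hG φ (s.map F) _).symm)
  refine Eq.trans ?_ (tr_tr (Fun.total_str G (s.map F).str) _ _).symm
  have h := cochain_castTens φ (str_comp F G s.str) (s.map (F ≫ G)).length_eq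
    ((s.map F).map G).length_eq (Fun.tens (F ≫ G) s.str x)
  have h' := DFunLike.congr_fun (tens_comp F G s.str) x
  refine Eq.trans ?_ (congrArg _ (h.symm.trans (congrArg _ h')))
  exact (tr_tr _ _ _).symm

end functoriality

section naturality

/-- The map of bar constructions induced by a graded functor. -/
noncomputable def Bar.map (F : X ⟶ Y) {A B : X.Pt} (w : A.base ⟶ B.base) :
    Bar A B w →ₗ[k] Bar (Fun.pt F A) (Fun.pt F B) ((Fun.base F).map w) :=
  Bar.lift fun p h => Bar.of (Fun.str F p) ((Fun.total_str F p).trans (by rw [h])) ∘ₗ Fun.tens F p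

lemma Bar.map_of (F : X ⟶ Y) {A B : X.Pt} {w : A.base ⟶ B.base} (p : X.Str A B)
    (h : p.total = w) (x : p.tens) : Bar.map F w (Bar.of p h x) =
      Bar.of (Fun.str F p) ((Fun.total_str F p).trans (by rw [h])) (Fun.tens F p x) :=
  DFunLike.congr_fun (Bar.lift_comp_of (fun p h => Bar.of (Fun.str F p)
    ((Fun.total_str F p).trans (by rw [h])) ∘ₗ Fun.tens F p) p h) x

lemma Bar.mul_of {A B C : X.Pt} {v : A.base ⟶ B.base} {u : B.base ⟶ C.base}
    {w : A.base ⟶ C.base} (h : v ≫ u = w) (q : X.Str B C) (hq : q.total = u) (p : X.Str A B)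
    (hp : p.total = v) (x : q.tens) (y : p.tens) :
    Bar.mul h (Bar.of q hq x) (Bar.of p hp y) =
      Bar.of (p.append q) (by rw [Str.total_append, hp, hq, h]) (Str.tensAppend p q (x ⊗ₜ y)) := by
  have h₁ := DFunLike.congr_fun (Bar.lift_comp_of (fun q hq => LinearMap.flip <|
    Bar.lift fun p hp => LinearMap.flip <| TensorProduct.curry <|
    Bar.of (p.append q) (by rw [Str.total_append, hp, hq, h]) ∘ₗ Str.tensAppend p q) q hq) x
  have h₂ := DFunLike.congr_fun h₁ (Bar.of p hp y)
  refine h₂.trans ?_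
  have h₃ := DFunLike.congr_fun (Bar.lift_comp_of (fun p hp => LinearMap.flip <|
    TensorProduct.curry <|
    Bar.of (p.append q) (by rw [Str.total_append, hp, hq, h]) ∘ₗ Str.tensAppend p q) p hp) y
  exact DFunLike.congr_fun h₃ x

lemma str_append (F : X ⟶ Y) {A B C : X.Pt} (p : X.Str A B) (q : X.Str B C) :
    Fun.str F (p.append q) = (Fun.str F p).append (Fun.str F q) := by
  induction q with
  | nil => rfl
  | @cons C D q u ih =>
    exact congrArg (fun p : Y.Str (Fun.pt F A) (Fun.pt F C) =>
      Str.cons (C := Fun.pt F D) p ((Fun.base F).map u)) ih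

lemma tens_append (F : X ⟶ Y) {A B C : X.Pt} (p : X.Str A B) (q : X.Str B C) :
    castTens (str_append F p q) ∘ₗ Fun.tens F (p.append q) ∘ₗ Str.tensAppend p q =
      Str.tensAppend (Fun.str F p) (Fun.str F q) ∘ₗ
        TensorProduct.map (Fun.tens F q) (Fun.tens F p) := by
  induction q with
  | nil =>
    refine TensorProduct.ext' fun c x => ?_
    exact (Fun.tens F p).map_smul c x
  | @cons C D q u ih =>
    have h := castTens_cons (C := Fun.pt F D) (str_append F p q) ((Fun.base F).map u)
    refine Eq.trans (congrArg (fun f => f ∘ₗ Fun.tens F (p.append (q.cons u)) ∘ₗ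
      Str.tensAppend p (q.cons u)) h) ?_
    refine TensorProduct.ext (TensorProduct.ext' fun a x => LinearMap.ext fun y => ?_)
    exact congrArg (fun y => (Fun.map F u _ _ a) ⊗ₜ[k] y) (DFunLike.congr_fun ih (x ⊗ₜ y))

lemma Bar.map_mul (F : X ⟶ Y) {A B C : X.Pt} {v : A.base ⟶ B.base} {u : B.base ⟶ C.base}
    {w : A.base ⟶ C.base} (h : v ≫ u = w) (x : Bar B C u) (y : Bar A B v) :
    Bar.map F w (Bar.mul h x y) =
      Bar.mul (A := Fun.pt F A) (B := Fun.pt F B) (C := Fun.pt F C)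
        (by rw [← h]; exact ((Fun.base F).map_comp v u).symm) (Bar.map F u x) (Bar.map F v y) := by
  have h' : (Fun.base F).map v ≫ (Fun.base F).map u = (Fun.base F).map w := by
    rw [← h, Functor.map_comp]
  have key : (Bar.mul h).compr₂ (Bar.map F w) = (Bar.mul (A := Fun.pt F A) (B := Fun.pt F B)
      (C := Fun.pt F C) h').compl₁₂ (Bar.map F u) (Bar.map F v) := by
    refine Bar.hom_ext fun q hq => LinearMap.ext fun x => Bar.hom_ext fun p hp =>
      LinearMap.ext fun y => ?_
    change Bar.map F w (Bar.mul h (Bar.of q hq x) (Bar.of p hp y)) = Bar.mul (A := Fun.pt F A)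
      (B := Fun.pt F B) (C := Fun.pt F C) h' (Bar.map F u (Bar.of q hq x))
        (Bar.map F v (Bar.of p hp y))
    rw [Bar.mul_of, Bar.map_of, Bar.map_of, Bar.map_of]
    refine Eq.trans ?_ (Bar.mul_of h' _ _ _ _ _ _).symm
    have e := DFunLike.congr_fun (Bar.of_comp_castTens (str_append F p q) (w := (Fun.base F).map w)
      (by rw [← str_append, Fun.total_str, Str.total_append, hp, hq, h]))
      (Fun.tens F (p.append q) (Str.tensAppend p q (x ⊗ₜ y)))
    refine e.symm.trans ?_
    exact congrArg (Bar.of ((Fun.str F p).append (Fun.str F q)) _)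
      (DFunLike.congr_fun (tens_append F p q) (x ⊗ₜ y))
  exact DFunLike.congr_fun (DFunLike.congr_fun key x) y

lemma cuts_str (F : X ⟶ Y) {A B : X.Pt} (p : X.Str A B) :
    List.Forall₂ (fun (c : p.Cut) (c' : (Fun.str F p).Cut) =>
      ∃ (h : (Fun.str F c.early).total ≫ (Fun.str F c.late).total = (Fun.str F p).total)
        (t : (Fun.str F p).tens →ₗ[k] (Fun.str F c.late).tens ⊗[k] (Fun.str F c.early).tens),
      c' = ⟨Fun.pt F c.mid, Fun.str F c.early, Fun.str F c.late, h, t⟩ ∧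
      t ∘ₗ Fun.tens F p = TensorProduct.map (Fun.tens F c.late) (Fun.tens F c.early) ∘ₗ c.split)
      p.cuts (Fun.str F p).cuts := by
  induction p with
  | nil =>
    refine .cons ⟨_, _, rfl, ?_⟩ .nil
    rfl
  | @cons B C p u ih =>
    refine .cons ⟨_, _, rfl, ?_⟩ ?_
    · refine LinearMap.ext fun x => ?_
      rfl
    · refine List.forall₂_map_left_iff.2 ?_
      change List.Forall₂ _ _ (((Fun.str F p).cuts).map
        (Str.Cut.extend (C := Fun.pt F C) ((Fun.base F).map u)))
      refine List.forall₂_map_right_iff.2 ?_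
      refine ih.imp ?_
      rintro c c' ⟨h, t, rfl, ht⟩
      refine ⟨_, _, rfl, ?_⟩
      refine TensorProduct.ext' fun a x => ?_
      have e := DFunLike.congr_fun ht x
      change (TensorProduct.assoc k _ _ _).symm (Fun.map F u _ _ a ⊗ₜ t (Fun.tens F p x)) =
        TensorProduct.map (TensorProduct.map (Fun.map F u _ _) (Fun.tens F c.late))
          (Fun.tens F c.early) ((TensorProduct.assoc k _ _ _).symm (a ⊗ₜ c.split x))
      refine (congrArg (fun y => (TensorProduct.assoc k _ _ _).symm
        (Fun.map F u _ _ a ⊗ₜ[k] y)) e).trans ?_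
      change (TensorProduct.assoc k _ _ _).symm (Fun.map F u _ _ a ⊗ₜ TensorProduct.map _ _ _) = _
      induction c.split x using TensorProduct.induction_on with
      | zero => simp
      | tmul y z => simp
      | add y z hy hz => simp only [TensorProduct.tmul_add, map_add, hy, hz]

lemma sum_comp_of_forall₂ {α β : Type*} {R : α → β → Prop} {M M' N N' : Type u} [AddCommGroup M]
    [Module k M] [AddCommGroup M'] [Module k M'] [AddCommGroup N] [Module k N] [AddCommGroup N']
    [Module k N'] (S : M →ₗ[k] M') (T : N →ₗ[k] N') (f : α → (N →ₗ[k] M))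
    (g : β → (N' →ₗ[k] M')) (hfg : ∀ a b, R a b → g b ∘ₗ T = S ∘ₗ f a)
    {l : List α} {l' : List β} (hl : List.Forall₂ R l l') :
    (l'.map g).sum ∘ₗ T = S ∘ₗ (l.map f).sum := by
  induction hl with
  | nil => simp
  | cons h _ ih =>
    rw [List.map_cons, List.map_cons, List.sum_cons, List.sum_cons, LinearMap.add_comp,
      LinearMap.comp_add, ih, hfg _ _ h]

end naturality

section naturality

/-- The restriction of cochains of all degrees. -/
noncomputable abbrev restrTotal (F : X ⟶ Y) (hF : subcartesian k F) : Y.Cochains →ₗ[k] X.Cochains :=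
  DirectSum.lmap (restr F hF)

lemma eval_eq {A B : X.Pt} (p : X.Str A B) (φ : X.Cochains) {n : ℤ} (h : (p.length : ℤ) = n) :
    eval p φ = DirectSum.component k ℤ (fun n => X.cochain n) n φ ⟨A, B, p, h⟩ := by
  subst h; rfl

lemma map_eval (F : X ⟶ Y) (hF : subcartesian k F) {A B : X.Pt} (p : X.Str A B) (φ : Y.Cochains)
    (x : p.tens) : Fun.map F p.total A.ob B.ob (eval p (restrTotal F hF φ) x) =
      tr (Fun.total_str F p) (eval (Fun.str F p) φ (Fun.tens F p x)) := by
  rw [eval_eq (Fun.str F p) φ (congrArg Nat.cast (Fun.length_str F p))]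
  exact map_restr F hF (DirectSum.component k ℤ (fun n => Y.cochain n) p.length φ)
    ⟨A, B, p, rfl⟩ x

lemma Bar.ofCons_tr {A B C : X.Pt} (p : X.Str A B) {u v : B.base ⟶ C.base} (e : u = v)
    {w : A.base ⟶ C.base} (h : p.total ≫ v = w) (x : X.hom u B.ob C.ob) (y : p.tens) :
    Bar.ofCons p v h (tr e x ⊗ₜ y) = Bar.ofCons p u (e ▸ h) (x ⊗ₜ y) := by
  subst e; rfl

lemma insert_str (F : X ⟶ Y) (hF : subcartesian k F) (N : ℕ) {A B : X.Pt} (p : X.Str A B)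
    {w : A.base ⟶ B.base} (h : p.total = w) (φ : Y.Cochains) :
    insert N (Fun.str F p) ((Fun.total_str F p).trans (by rw [h])) φ ∘ₗ Fun.tens F p =
      Bar.map F w ∘ₗ insert N p h (restrTotal F hF φ) := by
  refine sum_comp_of_forall₂ _ _ _ _ ?_ (cuts_str F p)
  rintro c c' ⟨h', t, rfl, ht⟩
  refine LinearMap.ext fun x => ?_
  have ht' := DFunLike.congr_fun ht x
  change (-1 : k) ^ (N * ((Fun.str F c.late).length + 1)) •
    Bar.ofCons (Fun.str F c.early) (Fun.str F c.late).total _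
      ((eval (Fun.str F c.late) φ).rTensor _ (t (Fun.tens F p x))) =
    Bar.map F w ((-1 : k) ^ (N * (c.late.length + 1)) •
      Bar.ofCons c.early c.late.total _ ((eval c.late (restrTotal F hF φ)).rTensor _ (c.split x)))
  rw [map_smul, Fun.length_str]
  refine congrArg _ ?_
  have e : t (Fun.tens F p x) = TensorProduct.map (Fun.tens F c.late) (Fun.tens F c.early)
    (c.split x) := ht'
  rw [e]
  induction c.split x using TensorProduct.induction_on with
  | zero => simp
  | add y z hy hz => simp only [map_add, hy, hz]
  | tmul y z =>
    rw [TensorProduct.map_tmul, LinearMap.rTensor_tmul, LinearMap.rTensor_tmul]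
    have h₁ := Bar.map_of F (c.early.cons c.late.total) (c.total_eq.trans h)
      (eval c.late (restrTotal F hF φ) y ⊗ₜ z)
    refine Eq.trans ?_ h₁.symm
    have h₂ := Bar.ofCons_tr (C := Fun.pt F B) (Fun.str F c.early) (Fun.total_str F c.late)
      (w := (Fun.base F).map w)
      (by rw [Fun.total_str, ← Functor.map_comp, c.total_eq, h])
      (eval (Fun.str F c.late) φ (Fun.tens F c.late y)) (Fun.tens F c.early z)
    refine h₂.symm.trans ?_
    rw [← map_eval F hF]
    rfl

lemma mul_congr {A B C : X.Pt} {v v' : A.base ⟶ B.base} {u u' : B.base ⟶ C.base}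
    {w : A.base ⟶ C.base} (hv : v = v') (hu : u = u') (h : v ≫ u = w) (h' : v' ≫ u' = w)
    (g : X.Op) (q : X.Str B C) (hq : q.total = u) (hq' : q.total = u') (p : X.Str A B)
    (hp : p.total = v) (hp' : p.total = v') (N : ℕ) (φ : X.Cochains) :
    TensorProduct.lift (Bar.mul h) ∘ₗ TensorProduct.map (g B C u ∘ₗ Bar.of q hq) (insert N p hp φ) =
    TensorProduct.lift (Bar.mul h') ∘ₗ
      TensorProduct.map (g B C u' ∘ₗ Bar.of q hq') (insert N p hp' φ) := by
  subst hv; subst hu; rfl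

/-- Operators on bar constructions which are compatible with a graded functor. -/
def Compatible (F : X ⟶ Y) (g : X.Op) (g' : Y.Op) : Prop :=
  ∀ (A B : X.Pt) (w : A.base ⟶ B.base),
    g' (Fun.pt F A) (Fun.pt F B) ((Fun.base F).map w) ∘ₗ Bar.map F w = Bar.map F w ∘ₗ g A B w

lemma Compatible.step {F : X ⟶ Y} (hF : subcartesian k F) {g : X.Op} {g' : Y.Op}
    (hg : Compatible F g g') (φ : Y.Cochains) :
    Compatible F (step (restrTotal F hF φ) g) (step φ g') := by
  intro A B w
  change stepOp φ g' _ _ _ ∘ₗ _ = _ ∘ₗ stepOp (restrTotal F hF φ) g A B w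
  refine Bar.hom_ext fun p hp => ?_
  have hp' : (Fun.str F p).total = (Fun.base F).map w := by rw [Fun.total_str, hp]
  have e₃ : Bar.map F w ∘ₗ Bar.of p hp = Bar.of (Fun.str F p) hp' ∘ₗ Fun.tens F p :=
    LinearMap.ext fun x => Bar.map_of F p hp x
  rw [LinearMap.comp_assoc, LinearMap.comp_assoc, e₃, stepOp_comp_of,
    ← LinearMap.comp_assoc, stepOp_comp_of]
  refine sum_comp_of_forall₂ _ _ _ _ ?_ (cuts_str F p)
  rintro c c' ⟨h', t, rfl, ht⟩
  have m := mul_congr (C := Fun.pt F B) (Fun.total_str F c.early) (Fun.total_str F c.late)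
    (h'.trans hp') (by rw [← Functor.map_comp, c.total_eq, hp]) g' (Fun.str F c.late) rfl
    (Fun.total_str F c.late) (Fun.str F c.early) rfl (Fun.total_str F c.early)
    (Fun.str F c.late).length φ
  refine LinearMap.ext fun x => ?_
  have ht' : t (Fun.tens F p x) = TensorProduct.map (Fun.tens F c.late) (Fun.tens F c.early)
    (c.split x) := DFunLike.congr_fun ht x
  have m' := DFunLike.congr_fun m (t (Fun.tens F p x))
  refine Eq.trans m' ?_
  change _ = Bar.map F w (TensorProduct.lift (Bar.mul (c.total_eq.trans hp))
    (TensorProduct.map (g c.mid B c.late.total ∘ₗ Bar.of c.late rfl)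
      (insert c.late.length c.early rfl (restrTotal F hF φ)) (c.split x)))
  rw [ht', Fun.length_str]
  induction c.split x using TensorProduct.induction_on with
  | zero => simp only [map_zero]
  | add y z hy hz => simp only [map_add, hy, hz]
  | tmul y z =>
    rw [TensorProduct.map_tmul, LinearMap.comp_apply, TensorProduct.map_tmul,
      TensorProduct.map_tmul, TensorProduct.lift.tmul, TensorProduct.lift.tmul, Bar.map_mul]
    have i₁ := DFunLike.congr_fun (insert_str F hF c.late.length c.early rfl φ) z
    have i₂ := DFunLike.congr_fun (hg c.mid B c.late.total) (Bar.of c.late rfl y)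
    have i₃ := Bar.map_of F c.late rfl y
    have i₄ : g' (Fun.pt F c.mid) (Fun.pt F B) ((Fun.base F).map c.late.total)
      (Bar.of (Fun.str F c.late) (Fun.total_str F c.late) (Fun.tens F c.late y)) =
      Bar.map F c.late.total (g c.mid B c.late.total (Bar.of c.late rfl y)) :=
      (congrArg _ i₃.symm).trans i₂
    exact congrArg₂ (fun a b => Bar.mul (A := Fun.pt F A) (B := Fun.pt F c.mid)
      (C := Fun.pt F B) _ a b) i₄ i₁

/-- The operator on families of operators which defines `act`. -/
noncomputable def actLift (t : TensorCoalgebra X.cochain) : Module.End k X.Op :=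
  MulOpposite.unop (TensorAlgebra.lift k ((MulOpposite.opLinearEquiv k).toLinearMap ∘ₗ
      (step : X.Cochains →ₗ[k] Module.End k X.Op)) t)

lemma Compatible.actLift {F : X ⟶ Y} (hF : subcartesian k F) (t : TensorCoalgebra Y.cochain)
    {g : X.Op} {g' : Y.Op} (hg : Compatible F g g') :
    Compatible F (actLift (tensorMap (restr F hF) t) g) (actLift t g') := by
  induction t using TensorAlgebra.induction generalizing g g' with
  | algebraMap r =>
    intro A B w
    simp only [MapGr.actLift, tensorMap, AlgHom.toLinearMap_apply, AlgHom.commutes,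
      MulOpposite.algebraMap_apply, MulOpposite.unop_op, Module.algebraMap_end_apply,
      Pi.smul_apply, LinearMap.smul_comp, LinearMap.comp_smul, hg A B w]
  | ι φ =>
    have e : tensorMap (restr F hF) (TensorAlgebra.ι k φ) =
        TensorAlgebra.ι k (restrTotal F hF φ) := by simp [tensorMap]
    have := hg.step hF φ
    rw [e]
    simpa [MapGr.actLift] using this
  | mul s t hs ht =>
    have e : tensorMap (restr F hF) (s * t) =
        tensorMap (restr F hF) s * tensorMap (restr F hF) t := by simp [tensorMap]
    rw [e]
    simp only [MapGr.actLift, map_mul, MulOpposite.unop_mul]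
    exact ht (hs hg)
  | add s t hs ht =>
    intro A B w
    have h₁ := hs hg A B w
    have h₂ := ht hg A B w
    simp only [MapGr.actLift] at h₁ h₂
    simp only [MapGr.actLift, map_add, MulOpposite.unop_add, LinearMap.add_apply, Pi.add_apply,
      LinearMap.add_comp, LinearMap.comp_add, h₁, h₂]

lemma act_compatible (F : X ⟶ Y) (hF : subcartesian k F) (t : TensorCoalgebra Y.cochain) :
    Compatible F (act (tensorMap (restr F hF) t)) (act t) :=
  Compatible.actLift hF t (g := fun _ _ _ => LinearMap.id) (g' := fun _ _ _ => LinearMap.id)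
    fun _ _ _ => rfl

lemma map_evalBar (F : X ⟶ Y) (hF : subcartesian k F) {A B : X.Pt} (w : A.base ⟶ B.base)
    (φ : Y.Cochains) (x : Bar A B w) : Fun.map F w A.ob B.ob (evalBar w (restrTotal F hF φ) x) =
      evalBar (A := Fun.pt F A) (B := Fun.pt F B) ((Fun.base F).map w) φ (Bar.map F w x) := by
  suffices h : Fun.map F w A.ob B.ob ∘ₗ evalBar w (restrTotal F hF φ) =
      evalBar (A := Fun.pt F A) (B := Fun.pt F B) ((Fun.base F).map w) φ ∘ₗ Bar.map F w from
    DFunLike.congr_fun h x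
  refine Bar.hom_ext fun p hp => LinearMap.ext fun x => ?_
  have h₁ : evalBar w (restrTotal F hF φ) (Bar.of p hp x) =
      tr hp (eval p (restrTotal F hF φ) x) :=
    DFunLike.congr_fun (Bar.lift_comp_of (fun p h => (tr h).toLinearMap ∘ₗ eval p _) p hp) x
  have h₂ : evalBar (A := Fun.pt F A) (B := Fun.pt F B) ((Fun.base F).map w) φ
      (Bar.of (Fun.str F p) ((Fun.total_str F p).trans (by rw [hp])) (Fun.tens F p x)) =
      tr _ (eval (Fun.str F p) φ (Fun.tens F p x)) :=
    DFunLike.congr_fun (Bar.lift_comp_of (fun p h => (tr h).toLinearMap ∘ₗ eval p φ)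
      (Fun.str F p) ((Fun.total_str F p).trans (by rw [hp]))) (Fun.tens F p x)
  refine (congrArg _ h₁).trans ((map_tr F hp _).trans ?_)
  rw [map_eval]
  refine (tr_tr _ _ _).trans ?_
  refine Eq.trans ?_ (congrArg (evalBar (A := Fun.pt F A) (B := Fun.pt F B) ((Fun.base F).map w) φ)
    (Bar.map_of F p hp x).symm)
  exact h₂.symm

lemma restr_brace (F : X ⟶ Y) (hF : subcartesian k F) (n : ℤ) (φ : Y.Cochains)
    (t : TensorCoalgebra Y.cochain) : restr F hF n (brace n φ t) =
      brace n (restrTotal F hF φ) (tensorMap (restr F hF) t) := by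
  funext s
  refine LinearMap.ext fun x => ?_
  apply (hF s.str.total s.src.ob s.tgt.ob).1
  refine (map_restr F hF _ s x).trans ?_
  refine Eq.trans ?_ (map_evalBar F hF s.str.total φ _).symm
  have h := DFunLike.congr_fun (act_compatible F hF t s.src s.tgt s.str.total)
    (Bar.of s.str rfl x)
  refine Eq.trans ?_ (congrArg _ h)
  have h₂ := Bar.map_of F s.str rfl x
  refine Eq.trans ?_ (congrArg (fun y => evalBar (A := Fun.pt F s.src) (B := Fun.pt F s.tgt) _ φ
    (act t _ _ _ y)) h₂.symm)
  have key : ∀ {A B : Y.Pt} (p : Y.Str A B) {w : A.base ⟶ B.base} (h : p.total = w) (y : p.tens),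
      tr h (evalBar p.total φ (act t A B p.total (Bar.of p rfl y))) =
        evalBar w φ (act t A B w (Bar.of p h y)) := by
    intro A B p w h y
    subst h; rfl
  exact key (Fun.str F s.str) (Fun.total_str F s.str) (Fun.tens F s.str x)

end naturality

section hochschildMap

lemma ιInv_mul {M : Type u} [AddCommGroup M] [Module k M] (s t : TensorAlgebra k M) :
    TensorAlgebra.ιInv (s * t) = TensorAlgebra.algebraMapInv s • TensorAlgebra.ιInv t +
      TensorAlgebra.algebraMapInv t • TensorAlgebra.ιInv s := by
  let _ : Module kᵐᵒᵖ M := Module.compHom _ ((RingHom.id k).fromOpposite mul_comm)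
  have : IsCentralScalar k M := ⟨fun r m => rfl⟩
  have h : ∀ s : TensorAlgebra k M, (TensorAlgebra.toTrivSqZeroExt s).fst =
      TensorAlgebra.algebraMapInv s := by
    intro s
    induction s using TensorAlgebra.induction with
    | algebraMap r =>
      simp only [AlgHom.commutes, TensorAlgebra.algebraMapInv]
      exact TrivSqZeroExt.fst_inl M r
    | ι x => simp [TensorAlgebra.algebraMapInv]
    | mul a b ha hb => simp [ha, hb]
    | add a b ha hb => simp [ha, hb]
  change (TensorAlgebra.toTrivSqZeroExt (s * t)).snd = _ • (TensorAlgebra.toTrivSqZeroExt t).snd +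
    _ • (TensorAlgebra.toTrivSqZeroExt s).snd
  rw [map_mul, TrivSqZeroExt.snd_mul, h, h, op_smul_eq_smul]

lemma ιInv_algebraMap {M : Type u} [AddCommGroup M] [Module k M] (r : k) :
    TensorAlgebra.ιInv (algebraMap k (TensorAlgebra k M) r) = 0 := by
  let _ : Module kᵐᵒᵖ M := Module.compHom _ ((RingHom.id k).fromOpposite mul_comm)
  have : IsCentralScalar k M := ⟨fun r m => rfl⟩
  change (TensorAlgebra.toTrivSqZeroExt (algebraMap k _ r)).snd = 0
  rw [AlgHom.commutes]
  exact TrivSqZeroExt.snd_inl M r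

lemma algebraMapInv_tensorMap {V W : ℤ → ModuleCat.{u} k} (f : ∀ n, V n →ₗ[k] W n)
    (t : TensorCoalgebra V) : TensorAlgebra.algebraMapInv (R := k) (tensorMap f t) =
      TensorAlgebra.algebraMapInv (R := k) t := by
  have h : (TensorAlgebra.algebraMapInv (R := k)).comp
      (TensorAlgebra.lift k (TensorAlgebra.ι k ∘ₗ DirectSum.lmap f)) =
      TensorAlgebra.algebraMapInv := by
    apply TensorAlgebra.hom_ext
    apply LinearMap.ext
    intro x
    simp [TensorAlgebra.algebraMapInv]
  exact DFunLike.congr_fun h t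

lemma ιInv_tensorMap {V W : ℤ → ModuleCat.{u} k} (f : ∀ n, V n →ₗ[k] W n)
    (t : TensorCoalgebra V) : TensorAlgebra.ιInv (tensorMap f t) =
      DirectSum.lmap f (TensorAlgebra.ιInv t) := by
  induction t using TensorAlgebra.induction with
  | algebraMap r =>
    have : tensorMap f (algebraMap k _ r) = algebraMap k _ r := by simp [tensorMap]
    rw [this, ιInv_algebraMap, ιInv_algebraMap, map_zero]
  | ι x =>
    have : tensorMap f (TensorAlgebra.ι k x) = TensorAlgebra.ι k (DirectSum.lmap f x) := by
      simp [tensorMap]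
    rw [this, TensorAlgebra.ι_leftInverse, TensorAlgebra.ι_leftInverse]
  | mul a b ha hb =>
    have : tensorMap f (a * b) = tensorMap f a * tensorMap f b := by simp [tensorMap]
    rw [this, ιInv_mul, ιInv_mul, ha, hb, map_add, map_smul, map_smul, algebraMapInv_tensorMap,
      algebraMapInv_tensorMap]
  | add a b ha hb => rw [map_add, map_add, map_add, map_add, ha, hb]

lemma restr_compCochain (F : X ⟶ Y) (hF : subcartesian k F) :
    restr F hF 2 Y.compCochain = X.compCochain := by
  funext s
  refine LinearMap.ext fun x => ?_
  apply (hF s.str.total s.src.ob s.tgt.ob).1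
  refine (map_restr F hF _ s x).trans ?_
  obtain ⟨A, C, p, hp⟩ := s
  have tr_comp : ∀ {A B C : Y.Pt} {v : A.base ⟶ B.base} {u : B.base ⟶ C.base}
      {w w' : A.base ⟶ C.base} (e : w = w') (h : v ≫ u = w) (a : Y.hom u B.ob C.ob)
      (b : Y.hom v A.ob B.ob), tr e (Y.comp h a b) = Y.comp (h.trans e) a b := by
    intro A B C v u w w' e h a b
    subst e; rfl
  cases p with
  | nil => simp [Str.length] at hp
  | cons p v =>
    cases p with
    | nil => simp [Str.length] at hp
    | cons p u =>
      cases p with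
      | cons p t => simp [Str.length] at hp; omega
      | nil =>
        have h₁ : ((tr (Fun.total_str F ((Str.nil.cons u).cons v))).toLinearMap ∘ₗ
            Y.compCochain (Simplex.map F ⟨A, C, (Str.nil.cons u).cons v, hp⟩) ∘ₗ
            Fun.tens F ((Str.nil.cons u).cons v)) =
            Fun.map F _ A.ob C.ob ∘ₗ X.compCochain ⟨A, C, (Str.nil.cons u).cons v, hp⟩ := by
          refine TensorProduct.ext (LinearMap.ext fun a => TensorProduct.ext' fun b (c : k) => ?_)
          refine Eq.trans ?_ (congrArg (Fun.map F _ A.ob C.ob)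
            (show X.comp _ a (c • b) = _ from rfl))
          refine Eq.trans ?_ (Fun.map_comp F _ a (c • b)).symm
          refine (tr_comp (A := Fun.pt F A) (B := Fun.pt F _) (C := Fun.pt F C)
            (Fun.total_str F ((Str.nil.cons u).cons v)) (v := (Fun.base F).map u)
            (u := (Fun.base F).map v)
            (by simp [Fun.str, Str.total]) (Fun.map F _ _ _ a)
            (c • Fun.map F _ _ _ b)).trans ?_
          rw [map_smul, map_smul, map_smul]
        exact DFunLike.congr_fun h₁ x

lemma restr_parity (F : X ⟶ Y) (hF : subcartesian k F) (t : TensorCoalgebra Y.cochain) :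
    tensorMap (restr F hF) (tensorMap Y.parity t) =
      tensorMap X.parity (tensorMap (restr F hF) t) := by
  rw [← BInfData.tensorMap_comp, ← BInfData.tensorMap_comp]
  refine DFunLike.congr_fun (congrArg tensorMap ?_) t
  funext n
  refine LinearMap.ext fun φ => ?_
  change restr F hF n ((n - 1).negOnePow • φ) = (n - 1).negOnePow • restr F hF n φ
  exact (restr F hF n).map_smul_of_tower _ _

lemma restr_mu (F : X ⟶ Y) (hF : subcartesian k F) :
    tensorMap (restr F hF) Y.mu = X.mu := by
  rw [mu, mu, ← restr_compCochain F hF]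
  simp [tensorMap]

lemma restr_mulComponent (F : X ⟶ Y) (hF : subcartesian k F) (n : ℤ)
    (s t : TensorCoalgebra Y.cochain) : restr F hF n (mulComponent n s t) =
      mulComponent n (tensorMap (restr F hF) s) (tensorMap (restr F hF) t) := by
  change restr F hF n (brace n (TensorAlgebra.ιInv s) t + TensorAlgebra.algebraMapInv (R := k) s •
    DirectSum.component k ℤ (fun n => Y.cochain n) n (TensorAlgebra.ιInv t)) =
    brace n (TensorAlgebra.ιInv (tensorMap (restr F hF) s)) (tensorMap (restr F hF) t) +
      TensorAlgebra.algebraMapInv (R := k) (tensorMap (restr F hF) s) •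
        DirectSum.component k ℤ (fun n => X.cochain n) n
          (TensorAlgebra.ιInv (tensorMap (restr F hF) t))
  rw [map_add, map_smul, restr_brace, algebraMapInv_tensorMap, ιInv_tensorMap, ιInv_tensorMap]
  rfl

/-- The restriction along a subcartesian graded functor as a morphism of `B∞`-algebras. -/
noncomputable def hochschildMap (F : X ⟶ Y) (hF : subcartesian k F) :
    hochschild Y ⟶ hochschild X where
  f := restr F hF
  map_m n s t := restr_mulComponent F hF n s t
  map_b n t := by
    change restr F hF n (mulComponent n Y.mu t - mulComponent n (tensorMap Y.parity t) Y.mu) =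
      mulComponent n X.mu (tensorMap (restr F hF) t) -
        mulComponent n (tensorMap X.parity (tensorMap (restr F hF) t)) X.mu
    refine (map_sub _ _ _).trans (congrArg₂ _ ((restr_mulComponent F hF n _ _).trans ?_)
      ((restr_mulComponent F hF n _ _).trans ?_))
    · rw [restr_mu]
    · rw [restr_mu]
      exact congrArg (fun y => mulComponent n y X.mu) (restr_parity F hF t)

end hochschildMap

section pullbacks

/-- Transport of morphisms along an equality of degrees and of objects. -/
noncomputable def transport {A A' B B' : X.Pt} (hA : A = A') (hB : B = B')
    {u : A.base ⟶ B.base} {u' : A'.base ⟶ B'.base} (h : HEq u u') :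
    X.hom u A.ob B.ob →ₗ[k] X.hom u' A'.ob B'.ob :=
  match A', B', hA, hB, u', h with
  | _, _, rfl, rfl, _, h => (tr (eq_of_heq h)).toLinearMap

lemma transport_bijective {A A' B B' : X.Pt} (hA : A = A') (hB : B = B')
    {u : A.base ⟶ B.base} {u' : A'.base ⟶ B'.base} (h : HEq u u') :
    Function.Bijective (transport hA hB h) := by
  subst hA; subst hB; obtain rfl := eq_of_heq h
  exact Function.bijective_id

lemma transport_one {A A' : X.Pt} (hA : A = A') {e : A.base ⟶ A.base} {e' : A'.base ⟶ A'.base}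
    (he : e = 𝟙 _) (he' : e' = 𝟙 _) (h : HEq e e') :
    transport hA hA h (X.one he A.ob) = X.one he' A'.ob := by
  subst hA; obtain rfl := eq_of_heq h; rfl

lemma transport_comp {A A' B B' C C' : X.Pt} (hA : A = A') (hB : B = B') (hC : C = C')
    {u : B.base ⟶ C.base} {u' : B'.base ⟶ C'.base} {v : A.base ⟶ B.base} {v' : A'.base ⟶ B'.base}
    {w : A.base ⟶ C.base} {w' : A'.base ⟶ C'.base} (hu : HEq u u') (hv : HEq v v') (hw : HEq w w')
    (h : v ≫ u = w) (h' : v' ≫ u' = w') (x : X.hom u B.ob C.ob) (y : X.hom v A.ob B.ob) :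
    transport hA hC hw (X.comp h x y) = X.comp h' (transport hB hC hu x) (transport hA hB hv y) := by
  subst hA; subst hB; subst hC
  obtain rfl := eq_of_heq hu; obtain rfl := eq_of_heq hv; obtain rfl := eq_of_heq hw
  rfl

lemma comp_heq {C : Type u} [SmallCategory C] {A A' B B' D D' : C} (hA : A = A') (hB : B = B')
    (hD : D = D') {f : A ⟶ B} {f' : A' ⟶ B'} {g : B ⟶ D} {g' : B' ⟶ D'} (hf : HEq f f')
    (hg : HEq g g') : HEq (f ≫ g) (f' ≫ g') := by
  subst hA; subst hB; subst hD; obtain rfl := eq_of_heq hf; obtain rfl := eq_of_heq hg; rfl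

lemma id_heq {C : Type u} [SmallCategory C] {A A' : C} (hA : A = A') : HEq (𝟙 A) (𝟙 A') := by
  subst hA; rfl

lemma fun_congr {X Y : MapGr k} {F G : X ⟶ Y} (h : F = G) {A B : X.Pt} (u : A.base ⟶ B.base) :
    ∃ (hA : Fun.pt F A = Fun.pt G A) (hB : Fun.pt F B = Fun.pt G B)
      (hu : HEq ((Fun.base F).map u) ((Fun.base G).map u)),
      ∀ x, transport hA hB hu (Fun.map F u A.ob B.ob x) = Fun.map G u A.ob B.ob x := by
  subst h
  exact ⟨rfl, rfl, HEq.rfl, fun x => rfl⟩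

lemma fun_ext {X Y : MapGr k} {F G : X ⟶ Y} (h : Fun.base F = Fun.base G)
    (hA : ∀ A, Fun.pt F A = Fun.pt G A)
    (hm : ∀ (A B : X.Pt) (u : A.base ⟶ B.base)
      (hu : HEq ((Fun.base F).map u) ((Fun.base G).map u)) x,
      transport (hA A) (hA B) hu (Fun.map F u A.ob B.ob x) = Fun.map G u A.ob B.ob x) : F = G := by
  obtain ⟨b, o, m, h₁, h₂⟩ := F
  obtain ⟨b', o', m', h₁', h₂'⟩ := G
  obtain rfl : b = b' := h
  obtain rfl : @o = @o' := by
    funext U A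
    have := hA ⟨U, A⟩
    exact eq_of_heq (Pt.ext_iff.1 this).2
  obtain rfl : @m = @m' := by
    funext U V u A B
    exact LinearMap.ext fun x => hm ⟨U, A⟩ ⟨V, B⟩ u HEq.rfl x
  rfl

/-- The unique graded functor `L` with `L ≫ F = H` and with given underlying map of objects and of
arrows of the base categories, for a subcartesian graded functor `F`. -/
noncomputable def liftAlong {W : MapGr k} (F : X ⟶ Y) (hF : subcartesian k F) (H : W ⟶ Y)
    (base : W.base ⥤ X.base) (ob : ∀ {U : W.base}, W.ob U → X.ob (base.obj U))
    (hpt : ∀ {U : W.base} (A : W.ob U), Fun.pt H ⟨U, A⟩ = Fun.pt F ⟨base.obj U, ob A⟩)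
    (hmap : ∀ {U V : W.base} (f : U ⟶ V),
      HEq ((Fun.base H).map f) ((Fun.base F).map (base.map f))) : W ⟶ X where
  base := base
  ob := ob
  map {p q} f A B := Fun.inv F hF (A := ⟨base.obj p, ob A⟩) (B := ⟨base.obj q, ob B⟩) (base.map f) ∘ₗ
    transport (hpt A) (hpt B) (hmap f) ∘ₗ Fun.map H f A B
  map_one {p e} he A := by
    apply (hF _ _ _).1
    refine (map_inv F hF (A := ⟨_, ob A⟩) (B := ⟨_, ob A⟩) (base.map e) _).trans ?_
    refine Eq.trans ?_ (Fun.map_one F (by rw [he, base.map_id]) (ob A)).symm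
    refine (congrArg (transport (hpt A) (hpt A) (hmap e)) (Fun.map_one H he A)).trans ?_
    exact transport_one (hpt A) _ _ _
  map_comp {p q r} v u w h A B C x y := by
    have hb : base.map v ≫ base.map u = base.map w := by rw [← h, base.map_comp]
    apply (hF _ _ _).1
    refine (map_inv F hF (A := ⟨_, ob A⟩) (B := ⟨_, ob C⟩) (base.map w) _).trans ?_
    refine (congrArg (transport (hpt A) (hpt C) (hmap w)) (Fun.map_comp H h x y)).trans ?_
    refine Eq.trans ?_ (Fun.map_comp F hb _ _).symm
    refine (transport_comp (hpt A) (hpt B) (hpt C) (hmap u) (hmap v) (hmap w)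
      (by rw [← h]; exact ((Fun.base H).map_comp _ _).symm)
      (by rw [← hb]; exact ((Fun.base F).map_comp _ _).symm)
      (Fun.map H u B C x) (Fun.map H v A B y)).trans ?_
    refine congrArg₂ (fun a b => Y.comp _ a b) ?_ ?_
    · exact (map_inv F hF (A := ⟨_, ob B⟩) (B := ⟨_, ob C⟩) (base.map u) _).symm
    · exact (map_inv F hF (A := ⟨_, ob A⟩) (B := ⟨_, ob B⟩) (base.map v) _).symm

lemma liftAlong_comp {W : MapGr k} (F : X ⟶ Y) (hF : subcartesian k F) (H : W ⟶ Y)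
    (base : W.base ⥤ X.base) (ob : ∀ {U : W.base}, W.ob U → X.ob (base.obj U))
    (hpt : ∀ {U : W.base} (A : W.ob U), Fun.pt H ⟨U, A⟩ = Fun.pt F ⟨base.obj U, ob A⟩)
    (hmap : ∀ {U V : W.base} (f : U ⟶ V),
      HEq ((Fun.base H).map f) ((Fun.base F).map (base.map f)))
    (hobj : ∀ U, (Fun.base H).obj U = (Fun.base F).obj (base.obj U)) :
    H = liftAlong F hF H base ob hpt hmap ≫ F := by
  refine fun_ext (CategoryTheory.Functor.hext hobj fun _ _ f => hmap f) (fun A => hpt A.ob) ?_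
  intro A B u hu x
  exact (map_inv F hF (A := ⟨base.obj A.base, ob A.ob⟩) (B := ⟨base.obj B.base, ob B.ob⟩)
    (base.map u) _).symm

lemma liftAlong_subcartesian {W : MapGr k} (F : X ⟶ Y) (hF : subcartesian k F) (H : W ⟶ Y)
    (hH : subcartesian k H)
    (base : W.base ⥤ X.base) (ob : ∀ {U : W.base}, W.ob U → X.ob (base.obj U))
    (hpt : ∀ {U : W.base} (A : W.ob U), Fun.pt H ⟨U, A⟩ = Fun.pt F ⟨base.obj U, ob A⟩)
    (hmap : ∀ {U V : W.base} (f : U ⟶ V),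
      HEq ((Fun.base H).map f) ((Fun.base F).map (base.map f))) :
    subcartesian k (liftAlong F hF H base ob hpt hmap) := fun f A B =>
  ((LinearEquiv.ofBijective _ (hF (base.map f) (ob A) (ob B))).symm.bijective.comp
    (transport_bijective (hpt A) (hpt B) (hmap f))).comp (hH f A B)

/-- Two graded functors with the same underlying map of objects and of arrows of the base
categories are equal if their composites with a subcartesian graded functor are equal. -/
lemma subcartesian.hom_ext {W : MapGr k} {F : X ⟶ Y} (hF : subcartesian k F) {L M : W ⟶ X}
    (hbase : Fun.base L = Fun.base M)
    (hob : HEq (fun U => @Fun.ob _ _ _ _ L U) (fun U => @Fun.ob _ _ _ _ M U))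
    (h : L ≫ F = M ≫ F) : L = M := by
  obtain ⟨b, o, m, h₁, h₂⟩ := L
  obtain ⟨b', o', m', h₁', h₂'⟩ := M
  obtain rfl : b = b' := hbase
  obtain rfl : @o = @o' := eq_of_heq hob
  obtain rfl : @m = @m' := by
    funext U V u A B
    refine LinearMap.ext fun x => (hF _ _ _).1 ?_
    obtain ⟨_, _, _, h'⟩ := fun_congr (A := ⟨U, A⟩) (B := ⟨V, B⟩) h u
    exact h' x
  rfl

variable {Y₁ Y₂ : MapGr k} (F₁ : Y₁ ⟶ X) (F₂ : Y₂ ⟶ X)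

/-- Pairs of objects with the same image. -/
abbrev PbBase : Type u :=
  {p : Y₁.base × Y₂.base // (Fun.base F₁).obj p.1 = (Fun.base F₂).obj p.2}

variable {F₁ F₂} in
/-- Pairs of arrows with the same image. -/
@[ext]
structure PbHom (p q : PbBase F₁ F₂) where
  fst : p.1.1 ⟶ q.1.1
  snd : p.1.2 ⟶ q.1.2
  heq : HEq ((Fun.base F₁).map fst) ((Fun.base F₂).map snd)

instance : SmallCategory (PbBase F₁ F₂) where
  Hom := PbHom
  id p := ⟨𝟙 _, 𝟙 _, by simpa using id_heq p.2⟩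
  comp {p q r} f g := ⟨f.fst ≫ g.fst, f.snd ≫ g.snd, by
    simpa using comp_heq p.2 q.2 r.2 f.heq g.heq⟩
  id_comp _ := PbHom.ext (Category.id_comp _) (Category.id_comp _)
  comp_id _ := PbHom.ext (Category.comp_id _) (Category.comp_id _)
  assoc _ _ _ := PbHom.ext (Category.assoc _ _ _) (Category.assoc _ _ _)

/-- The pullback of `F₁` along the subcartesian graded functor `F₂`: pairs of objects, and pairs of
arrows of the base categories, with the same image; the modules of morphisms are those of the first
map-graded category. -/
@[reducible]
noncomputable def pb : MapGr k where
  base := PbBase F₁ F₂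
  ob p := {A : Y₁.ob p.1.1 × Y₂.ob p.1.2 // HEq (Fun.ob F₁ A.1) (Fun.ob F₂ A.2)}
  hom {p q} (f : PbHom p q) A B := Y₁.hom (PbHom.fst f) A.1.1 B.1.1
  comp h := Y₁.comp (congrArg PbHom.fst h)
  one h A := Y₁.one (congrArg PbHom.fst h) A.1.1
  comp_one _ _ _ _ _ := Y₁.comp_one _ _ _
  one_comp _ _ _ _ _ := Y₁.one_comp _ _ _
  assoc _ _ _ _ _ _ _ _ _ _ _ := Y₁.assoc _ _ _ _ _ _ _

/-- The first projection of the pullback. -/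
noncomputable def pbFst : pb F₁ F₂ ⟶ Y₁ where
  base :=
    { obj := fun p => p.1.1
      map := fun f => (PbHom.fst f)
      map_id := fun _ => rfl
      map_comp := fun _ _ => rfl }
  ob A := A.1.1
  map _ _ _ := LinearMap.id
  map_one _ _ := rfl
  map_comp _ _ _ _ _ _ := rfl

variable {F₁ F₂}

lemma pb_pt {p : PbBase F₁ F₂} (A : (pb F₁ F₂).ob p) :
    Fun.pt F₁ ⟨p.1.1, A.1.1⟩ = Fun.pt F₂ ⟨p.1.2, A.1.2⟩ :=
  Pt.ext p.2 A.2

variable (F₁ F₂)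

/-- The second projection of the pullback. -/
noncomputable def pbSnd (hF₂ : subcartesian k F₂) : pb F₁ F₂ ⟶ Y₂ :=
  liftAlong F₂ hF₂ (pbFst F₁ F₂ ≫ F₁)
    { obj := fun p => p.1.2
      map := fun f => (PbHom.snd f)
      map_id := fun _ => rfl
      map_comp := fun _ _ => rfl }
    (fun A => A.1.2) pb_pt PbHom.heq

lemma pbFst_subcartesian : subcartesian k (pbFst F₁ F₂) := fun _ _ _ => Function.bijective_id

lemma pbSnd_subcartesian (hF₁ : subcartesian k F₁) (hF₂ : subcartesian k F₂) :
    subcartesian k (pbSnd F₁ F₂ hF₂) :=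
  liftAlong_subcartesian F₂ hF₂ _
    ((subcartesian k).comp_mem _ _ (pbFst_subcartesian F₁ F₂) hF₁) _ _ _ _

lemma pb_w (hF₂ : subcartesian k F₂) : pbFst F₁ F₂ ≫ F₁ = pbSnd F₁ F₂ hF₂ ≫ F₂ :=
  liftAlong_comp F₂ hF₂ _ _ _ _ _ fun p => p.2

variable {F₁ F₂}

/-- The universal property of the pullback. -/
noncomputable def pbLift {W : MapGr k} (G₁ : W ⟶ Y₁) (G₂ : W ⟶ Y₂) (h : G₁ ≫ F₁ = G₂ ≫ F₂) :
    W ⟶ pb F₁ F₂ where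
  base :=
    { obj := fun p => ⟨((Fun.base G₁).obj p, (Fun.base G₂).obj p),
        congrArg (fun F => (Fun.base F).obj p) h⟩
      map := fun f => ⟨(Fun.base G₁).map f, (Fun.base G₂).map f,
        congr_arg_heq (fun F => (Fun.base F).map f) h⟩
      map_id := fun p => PbHom.ext ((Fun.base G₁).map_id p) ((Fun.base G₂).map_id p)
      map_comp := fun f g => PbHom.ext ((Fun.base G₁).map_comp f g) ((Fun.base G₂).map_comp f g) }
  ob A := ⟨(Fun.ob G₁ A, Fun.ob G₂ A), congr_arg_heq (fun F => Fun.ob F A) h⟩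
  map u A B := Fun.map G₁ u A B
  map_one he A := Fun.map_one G₁ he A
  map_comp h _ _ _ x y := Fun.map_comp G₁ h x y

lemma pbLift_fst {W : MapGr k} (G₁ : W ⟶ Y₁) (G₂ : W ⟶ Y₂) (h : G₁ ≫ F₁ = G₂ ≫ F₂) :
    pbLift G₁ G₂ h ≫ pbFst F₁ F₂ = G₁ := rfl

lemma pbLift_snd {W : MapGr k} (G₁ : W ⟶ Y₁) (G₂ : W ⟶ Y₂) (h : G₁ ≫ F₁ = G₂ ≫ F₂)
    (hF₂ : subcartesian k F₂) : pbLift G₁ G₂ h ≫ pbSnd F₁ F₂ hF₂ = G₂ := by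
  refine hF₂.hom_ext rfl HEq.rfl ?_
  rw [Category.assoc, ← pb_w, ← Category.assoc, pbLift_fst, h]

lemma pbLift_uniq {W : MapGr k} (G₁ : W ⟶ Y₁) (G₂ : W ⟶ Y₂) (h : G₁ ≫ F₁ = G₂ ≫ F₂)
    (hF₂ : subcartesian k F₂) (m : W ⟶ pb F₁ F₂) (h₁ : m ≫ pbFst F₁ F₂ = G₁)
    (h₂ : m ≫ pbSnd F₁ F₂ hF₂ = G₂) : m = pbLift G₁ G₂ h := by
  subst h₁; subst h₂; rfl

lemma pbLift_subcartesian {W : MapGr k} (G₁ : W ⟶ Y₁) (G₂ : W ⟶ Y₂) (h : G₁ ≫ F₁ = G₂ ≫ F₂)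
    (hG₁ : subcartesian k G₁) : subcartesian k (pbLift G₁ G₂ h) := fun u A B => hG₁ u A B

end pullbacks

/-- The category of map-graded categories and subcartesian graded functors. -/
abbrev MapSc (k : Type u) [CommRing k] := WideSubcategory (subcartesian k)

/-- The pullback cone in `MapSc k`. -/
noncomputable def pbCone {X Y₁ Y₂ : MapSc k} (F₁ : Y₁ ⟶ X) (F₂ : Y₂ ⟶ X) :
    Limits.PullbackCone F₁ F₂ :=
  Limits.PullbackCone.mk (W := ⟨pb F₁.hom F₂.hom⟩)
    ⟨pbFst F₁.hom F₂.hom, pbFst_subcartesian F₁.hom F₂.hom⟩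
    ⟨pbSnd F₁.hom F₂.hom F₂.property,
      pbSnd_subcartesian F₁.hom F₂.hom F₁.property F₂.property⟩
    (WideSubcategory.hom_ext _ (pb_w F₁.hom F₂.hom F₂.property))

lemma condition_hom {X Y₁ Y₂ : MapSc k} {F₁ : Y₁ ⟶ X} {F₂ : Y₂ ⟶ X}
    (s : Limits.PullbackCone F₁ F₂) : s.fst.hom ≫ F₁.hom = s.snd.hom ≫ F₂.hom :=
  congrArg (fun f => f.hom) s.condition

/-- The pullback cone is a limit cone. -/
noncomputable def pbConeIsLimit {X Y₁ Y₂ : MapSc k} (F₁ : Y₁ ⟶ X) (F₂ : Y₂ ⟶ X) :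
    Limits.IsLimit (pbCone F₁ F₂) :=
  Limits.PullbackCone.IsLimit.mk _
    (fun s => ⟨pbLift s.fst.hom s.snd.hom (condition_hom s),
      pbLift_subcartesian _ _ _ s.fst.property⟩)
    (fun s => WideSubcategory.hom_ext _ (pbLift_fst _ _ (condition_hom s)))
    (fun s => WideSubcategory.hom_ext _ (pbLift_snd _ _ (condition_hom s) F₂.property))
    (fun s m h₁ h₂ => WideSubcategory.hom_ext _ (pbLift_uniq _ _ (condition_hom s) F₂.property
      m.hom (congrArg (fun f => f.hom) h₁) (congrArg (fun f => f.hom) h₂)))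

instance : Limits.HasPullbacks (MapSc k) :=
  haveI : ∀ {X Y₁ Y₂ : MapSc k} {F₁ : Y₁ ⟶ X} {F₂ : Y₂ ⟶ X}, Limits.HasLimit (Limits.cospan F₁ F₂) :=
    fun {_ _ _ F₁ F₂} => ⟨⟨⟨pbCone F₁ F₂, pbConeIsLimit F₁ F₂⟩⟩⟩
  Limits.hasPullbacks_of_hasLimit_cospan _

/-! ### Subcartesian graded functors as cartesian morphisms -/

/-- Graded sets `(U, 𝔵)`. -/
structure GrSet : Type (u + 1) where
  base : Type u
  [cat : SmallCategory base]
  ob : base → Type u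

attribute [instance] GrSet.cat

/-- Morphisms of graded sets. -/
@[ext]
structure GrSet.Hom (x y : GrSet.{u}) where
  base : x.base ⥤ y.base
  ob : ∀ U : x.base, x.ob U → y.ob (base.obj U)

instance : Category GrSet.{u} where
  Hom := GrSet.Hom
  id _ := ⟨𝟭 _, fun _ => id⟩
  comp F G := ⟨F.base ⋙ G.base, fun U A => G.ob (F.base.obj U) (F.ob U A)⟩

variable (k) in
/-- The functor sending a map-graded category to its underlying graded set. -/
def toGrSet : MapGr k ⥤ GrSet.{u} where
  obj X := ⟨X.base, X.ob⟩
  map F := ⟨Fun.base F, fun _ => Fun.ob F⟩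

/-- The map-graded category obtained by restricting the modules of morphisms along a graded
functor. -/
@[reducible]
def restrictHom (F : X ⟶ Y) : MapGr k where
  base := X.base
  ob := X.ob
  hom u A B := Y.hom ((Fun.base F).map u) (Fun.ob F A) (Fun.ob F B)
  comp h := Y.comp (by rw [← h, Functor.map_comp])
  one h A := Y.one (by rw [h, CategoryTheory.Functor.map_id]) (Fun.ob F A)
  comp_one _ _ _ _ _ := Y.comp_one _ _ _
  one_comp _ _ _ _ _ := Y.one_comp _ _ _
  assoc _ _ _ _ _ _ _ _ _ _ _ := Y.assoc _ _ _ _ _ _ _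

/-- A graded functor is subcartesian if and only if it is cartesian with respect to the functor to
graded sets. -/
theorem subcartesian_iff_isStronglyCartesian (F : X ⟶ Y) :
    subcartesian k F ↔ (toGrSet k).IsStronglyCartesian ((toGrSet k).map F) F := by
  constructor
  · intro hF
    refine ⟨fun {W} g H hH => ?_⟩
    have e : g ≫ (toGrSet k).map F = (toGrSet k).map H :=
      IsHomLift.eq_of_isHomLift (toGrSet k) _ H
    have hpt : ∀ {U : W.base} (A : W.ob U),
        Fun.pt H ⟨U, A⟩ = Fun.pt F ⟨(GrSet.Hom.base g).obj U, GrSet.Hom.ob g U A⟩ := fun {U} A =>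
      Pt.ext (congrArg (fun f : GrSet.Hom ⟨W.base, W.ob⟩ ⟨Y.base, Y.ob⟩ => f.base.obj U) e.symm)
        (congr_arg_heq (fun f : GrSet.Hom ⟨W.base, W.ob⟩ ⟨Y.base, Y.ob⟩ => f.ob U A) e.symm)
    have hmap : ∀ {U V : W.base} (f : U ⟶ V),
        HEq ((Fun.base H).map f) ((Fun.base F).map ((GrSet.Hom.base g).map f)) := fun f =>
      congr_arg_heq (fun h : GrSet.Hom ⟨W.base, W.ob⟩ ⟨Y.base, Y.ob⟩ => h.base.map f) e.symm
    have hobj : ∀ U, (Fun.base H).obj U = (Fun.base F).obj ((GrSet.Hom.base g).obj U) := fun U =>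
      congrArg (fun f : GrSet.Hom ⟨W.base, W.ob⟩ ⟨Y.base, Y.ob⟩ => f.base.obj U) e.symm
    refine ⟨liftAlong F hF H (GrSet.Hom.base g) (fun {U} => GrSet.Hom.ob g U) hpt hmap,
      ⟨?_, (liftAlong_comp F hF H _ _ hpt hmap hobj).symm⟩, ?_⟩
    · exact IsHomLift.map (toGrSet k)
        (liftAlong F hF H (GrSet.Hom.base g) (fun {U} => GrSet.Hom.ob g U) hpt hmap)
    · rintro L ⟨hL, hLF⟩
      have e' : g = (toGrSet k).map L := IsHomLift.eq_of_isHomLift (toGrSet k) _ L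
      subst e'
      exact hF.hom_ext rfl HEq.rfl
        (hLF.trans (liftAlong_comp F hF H _ _ hpt hmap hobj))
  · intro hF
    let δ : restrictHom F ⟶ Y :=
      { base := @Fun.base _ _ X Y F
        ob := fun {U} A => @Fun.ob _ _ X Y F U A
        map := fun _ _ _ => LinearMap.id
        map_one := fun _ _ => rfl
        map_comp := by intros; rfl }
    let ε : X ⟶ restrictHom F :=
      { base := 𝟭 _
        ob := id
        map := fun u A B => Fun.map F u A B
        map_one := fun he A => Fun.map_one F he A
        map_comp := fun h _ _ _ x y => Fun.map_comp F h x y }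
    have hδ : (toGrSet k).IsHomLift ((toGrSet k).map δ) δ := IsHomLift.map (toGrSet k) δ
    obtain ⟨χ, ⟨h₁, h₂⟩, -⟩ := @Functor.IsStronglyCartesian.universal_property' _ _ _ _ _ _ _ _ _ _ _
      hF (restrictHom F) (𝟙 ((toGrSet k).obj X)) δ hδ
    have h₃ : 𝟙 ((toGrSet k).obj X) = (toGrSet k).map χ :=
      IsHomLift.eq_of_isHomLift (toGrSet k) (a := restrictHom F) (b := X) _ χ
    have hF' : (toGrSet k).IsHomLift (𝟙 ((toGrSet k).obj X) ≫ (toGrSet k).map F) F :=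
      IsHomLift.map (toGrSet k) F
    obtain ⟨ι, -, hι⟩ := hF.universal_property' (a' := X) (𝟙 _) F
    have h₄ : ε ≫ χ = 𝟙 X := by
      refine (hι (ε ≫ χ) ⟨?_, ?_⟩).trans (hι (𝟙 X) ⟨?_, Category.id_comp F⟩).symm
      · rw [h₃]
        exact IsHomLift.map (toGrSet k) (ε ≫ χ)
      · rw [Category.assoc, h₂]
        rfl
      · exact IsHomLift.map (toGrSet k) (𝟙 X)
    obtain ⟨b, o, m, q₁, q₂⟩ := χ
    obtain rfl : 𝟭 X.base = b := congrArg GrSet.Hom.base h₃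
    obtain rfl : (fun {U} => id : ∀ {U : X.base}, X.ob U → X.ob U) = @o := by
      funext U A
      exact eq_of_heq (congr_arg_heq (fun f : GrSet.Hom ⟨X.base, X.ob⟩ ⟨X.base, X.ob⟩ => f.ob U A) h₃)
    intro U V u A B
    constructor
    · refine Function.LeftInverse.injective (g := m u A B) fun x => ?_
      obtain ⟨_, _, _, h⟩ := fun_congr (A := ⟨U, A⟩) (B := ⟨V, B⟩) h₄ u
      exact h x
    · refine Function.RightInverse.surjective (g := m u A B) fun x => ?_
      obtain ⟨_, _, _, h⟩ := fun_congr (A := ⟨U, A⟩) (B := ⟨V, B⟩) h₂ u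
      exact h x

/-! ### Pretopologies of covers and Hochschild presheaves -/

lemma Simplex.mk_congr {n : ℤ} {A B : X.Pt} {p q : X.Str A B} (h : p = q)
    (hp : (p.length : ℤ) = n) (hq : (q.length : ℤ) = n) :
    (⟨A, B, p, hp⟩ : X.Simplex n) = ⟨A, B, q, hq⟩ := by
  subst h; rfl

lemma Simplex.map_comp (F : X ⟶ Y) (G : Y ⟶ Z) {n : ℤ} (s : X.Simplex n) :
    s.map (F ≫ G) = (s.map F).map G := by
  obtain ⟨A, B, p, h⟩ := s
  simp only [Simplex.map, str_comp]
  rfl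

lemma Simplex.map_id {n : ℤ} (s : X.Simplex n) : s.map (𝟙 X) = s := by
  obtain ⟨A, B, p, h⟩ := s
  simp only [Simplex.map, ← str_id]
  rfl

lemma Str.length_heq {A A' B B' : X.Pt} (hA : A = A') (hB : B = B') {p : X.Str A B}
    {q : X.Str A' B'} (h : HEq p q) : p.length = q.length := by
  subst hA; subst hB; obtain rfl := eq_of_heq h; rfl

lemma Str.cons_heq {A A' B B' C C' : X.Pt} (hA : A = A') (hC : C = C') {p : X.Str A B}
    {u : B.base ⟶ C.base} {p' : X.Str A' B'} {u' : B'.base ⟶ C'.base}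
    (h : HEq (Str.cons p u) (Str.cons p' u')) : B = B' ∧ HEq p p' ∧ HEq u u' := by
  subst hA; subst hC
  cases eq_of_heq h
  exact ⟨rfl, HEq.rfl, HEq.rfl⟩

section pretopology

variable {Y₁ Y₂ : MapGr k} {F₁ : Y₁ ⟶ X} {F₂ : Y₂ ⟶ X}

/-- Pairs of objects with the same image as objects of the pullback. -/
def pbPt (A : Y₁.Pt) (A' : Y₂.Pt) (h : Fun.pt F₁ A = Fun.pt F₂ A') : (pb F₁ F₂).Pt :=
  ⟨⟨(A.base, A'.base), (Pt.ext_iff.1 h).1⟩, ⟨(A.ob, A'.ob), (Pt.ext_iff.1 h).2⟩⟩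

lemma exists_str (hF₂ : subcartesian k F₂) {A B : Y₁.Pt} (p : Y₁.Str A B) :
    ∀ {A' B' : Y₂.Pt} (q : Y₂.Str A' B') (hA : Fun.pt F₁ A = Fun.pt F₂ A')
      (hB : Fun.pt F₁ B = Fun.pt F₂ B') (_ : HEq (Fun.str F₁ p) (Fun.str F₂ q)),
      ∃ r : (pb F₁ F₂).Str (pbPt A A' hA) (pbPt B B' hB),
        Fun.str (pbFst F₁ F₂) r = p ∧ Fun.str (pbSnd F₁ F₂ hF₂) r = q := by
  induction p with
  | nil =>
    intro A' B' q hA hB h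
    cases q with
    | nil => exact ⟨.nil, rfl, rfl⟩
    | cons q v =>
      have := Str.length_heq hA hB h
      simp [Fun.length_str, Str.length] at this
  | @cons B C p u ih =>
    intro A' C' q hA hC h
    cases q with
    | nil =>
      have := Str.length_heq hA hC h
      simp [Fun.length_str, Str.length] at this
    | @cons B' _ q v =>
      obtain ⟨hB, hp, hu⟩ := Str.cons_heq (C := Fun.pt F₁ C) (C' := Fun.pt F₂ C') hA hC h
      obtain ⟨r, h₁, h₂⟩ := ih q hA hB hp
      refine ⟨.cons r ⟨u, v, hu⟩, ?_, ?_⟩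
      · exact congrArg (fun p => Str.cons p u) h₁
      · exact congrArg (fun q => Str.cons q v) h₂

lemma exists_simplex (hF₂ : subcartesian k F₂) {n : ℤ} (s : Y₁.Simplex n) (t : Y₂.Simplex n)
    (h : s.map F₁ = t.map F₂) : ∃ r : (pb F₁ F₂).Simplex n,
      r.map (pbFst F₁ F₂) = s ∧ r.map (pbSnd F₁ F₂ hF₂) = t := by
  obtain ⟨A, B, p, hp⟩ := s
  obtain ⟨A', B', q, hq⟩ := t
  obtain ⟨hA, hB, h'⟩ := Simplex.mk.inj h
  obtain ⟨r, h₁, h₂⟩ := exists_str hF₂ p q hA hB h'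
  refine ⟨⟨_, _, r, ?_⟩, ?_, ?_⟩
  · rw [← hp]
    exact congrArg Nat.cast ((Fun.length_str _ r).symm.trans (congrArg Str.length h₁))
  · exact Simplex.mk_congr h₁ _ _
  · exact Simplex.mk_congr h₂ _ _

end pretopology

/-- A family of subcartesian graded functors with target `X` is an `N`-cover if it is jointly
surjective on the `m`-simplices of the nerves for all `m ≤ N`. -/
def IsCover (N : ℕ∞) (X : MapSc k) (S : Presieve X) : Prop :=
  ∀ m : ℕ, (m : ℕ∞) ≤ N → ∀ s : X.obj.Simplex m,
    ∃ (Y : MapSc k) (f : Y ⟶ X), S f ∧ ∃ t : Y.obj.Simplex m, t.map f.hom = s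

variable (k) in
/-- The pretopology of `N`-covers on the category of map-graded categories and subcartesian graded
functors. -/
def nCoverPretopology (N : ℕ∞) : Pretopology (MapSc k) where
  coverings X := {S | IsCover N X S}
  has_isos X Y f _ m _ s := by
    refine ⟨Y, f, ⟨⟩, s.map (inv f).hom, ?_⟩
    refine (Simplex.map_comp _ _ s).symm.trans (Eq.trans ?_ (Simplex.map_id s))
    exact congrArg (fun g : X ⟶ X => s.map g.hom) (IsIso.inv_hom_id f)
  pullbacks X Y f S hS m hm s := by
    obtain ⟨Z, h, hSh, t, ht⟩ := hS m hm (s.map f.hom)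
    obtain ⟨r, -, hr⟩ := exists_simplex f.property t s ht
    refine ⟨_, _, ⟨Z, h, hSh⟩,
      r.map (Limits.pullback.lift (pbCone h f).fst (pbCone h f).snd (pbCone h f).condition).hom, ?_⟩
    refine (Simplex.map_comp _ _ r).symm.trans (Eq.trans ?_ hr)
    exact congrArg (fun g : (pbCone h f).pt ⟶ Y => r.map g.hom) (Limits.pullback.lift_snd _ _ _)
  transitive X S T hS hT m hm s := by
    obtain ⟨Y, f, hf, t, rfl⟩ := hS m hm s
    obtain ⟨Z, g, hg, r, rfl⟩ := hT f hf m hm t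
    exact ⟨Z, g ≫ f, ⟨_, _, _, hf, hg, rfl⟩, r, Simplex.map_comp _ _ _⟩

variable (k) in
/-- The presheaf `(U, 𝔞) ↦ C^n` of Hochschild cochains. -/
noncomputable def cochainPresheaf (n : ℤ) : (MapSc k)ᵒᵖ ⥤ ModuleCat.{u} k where
  obj X := X.unop.obj.cochain n
  map F := ModuleCat.ofHom (restr F.unop.hom F.unop.property n)
  map_id _ := congrArg ModuleCat.ofHom (restr_id n)
  map_comp F G := congrArg ModuleCat.ofHom
    (restr_comp G.unop.hom F.unop.hom G.unop.property F.unop.property n)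

variable (k) in
/-- The presheaf `(U, 𝔞) ↦ C` of Hochschild complexes with their brace operations. -/
noncomputable def hochschildPresheaf : (MapSc k)ᵒᵖ ⥤ BInfData k where
  obj X := hochschild X.unop.obj
  map F := hochschildMap F.unop.hom F.unop.property
  map_id _ := BInfData.Hom.ext (funext fun n => restr_id n)
  map_comp F G := BInfData.Hom.ext (funext fun n =>
    restr_comp G.unop.hom F.unop.hom G.unop.property F.unop.property n)

end MapGr

/-! Gluing is easy and most of the work lies in the identities of a `B∞`-algebra.

Gluing: a cochain is an independent choice of a linear map for every simplex of the nerve. A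
subcartesian functor is bijective on modules of morphisms and on their tensor products, so the value
of `F^* φ` at a simplex and the value of `φ` at its image determine each other
(`restr_apply_eq_iff`). Hence `n`-cochains glue as soon as all `n`-simplices lift to members of the
cover: choose a lift of each simplex and transport the given value. The result does not depend on
the lift, because two lifts of one simplex come from a simplex of the pullback (`exists_simplex`),
where the family is compatible (`LiftsSimplices.exists_cochain`). Linearity of a glued map, and its
compatibility with the `B∞`-operations, can be checked after restriction, since restriction commutes
with all operations (`hochschildMap`). The whole complex involves all degrees at once, hence the
`∞`-covers.

`B∞`-identities: `T(sC)` acts on the bar construction by inserting the letters of a word, in order,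
into a tensor, and the braces are recovered from this action by `φ{z}(x) = φ(z · x)`
(`value_mulLetter`). The central fact is that the product acts as the composite, `y · (z · x) = (yz)
· x` (`wordOp_wordOp`). It follows by comparing leftmost factors. The product of `φ y` and `z`
starts either with the first letter of `z` or with a brace `φ{z₁}` for an initial segment `z₁` of
`z` (`cons_mul`). If `φ y` is applied after `z`, then `φ` either acts further to the right or
receives exactly what some `z₁` has produced, and then `y` receives what the rest of `z` has
produced; this uses that the action is compatible with deconcatenation (`sumCuts_wordOp`). Applying
`φ` to both sides of the central fact gives associativity of the multiplication (`m_assoc`).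

The coderivation is the graded commutator with `μ` (`d_eq`). Associativity of the composition of `𝔞`
means `μ{μ} = 0`, whence `μ μ = 0` in `T(sC)` (`mul_mu_mu`). Then `d² = 0` and the Leibniz rule are
formal consequences of associativity. -/

namespace MapGr

variable {k : Type u} [CommRing k] {X : MapGr k}

/-! ### Tensors over strings, without fixed composite, and their deconcatenation. -/

/-- The direct sum of the modules of morphisms `𝔞_w (A, B)` over all degrees `w`. -/
abbrev TotalHom (A B : X.Pt) : Type u := ⨁ w : A.base ⟶ B.base, X.hom w A.ob B.ob

/-- The direct sum of the tensor products `𝔞_{u_{n-1}}(A_{n-1}, A_n) ⊗ ⋯ ⊗ 𝔞_{u_0}(A_0, A_1)` over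
all strings from `A` to `B`. -/
abbrev PathTensor (A B : X.Pt) : Type u := ⨁ p : X.Str A B, p.tens

/-- Pure tensors over strings. -/
inductive Path (A : X.Pt) : X.Pt → Type u
  | nil : Path A A
  | cons {B C : X.Pt} (x : Path A B) (u : B.base ⟶ C.base) (a : X.hom u B.ob C.ob) : Path A C

namespace TotalHom

open Classical in
/-- The inclusion of a summand. -/
noncomputable def of {A B : X.Pt} (w : A.base ⟶ B.base) : X.hom w A.ob B.ob →ₗ[k] TotalHom A B :=
  DirectSum.lof k _ (fun w : A.base ⟶ B.base => X.hom w A.ob B.ob) w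

open Classical in
/-- The linear map with given restrictions to the summands. -/
noncomputable def lift {A B : X.Pt} {M : Type u} [AddCommGroup M] [Module k M]
    (f : ∀ w : A.base ⟶ B.base, X.hom w A.ob B.ob →ₗ[k] M) : TotalHom A B →ₗ[k] M :=
  DirectSum.toModule k _ M f

lemma lift_of {A B : X.Pt} {M : Type u} [AddCommGroup M] [Module k M]
    (f : ∀ w : A.base ⟶ B.base, X.hom w A.ob B.ob →ₗ[k] M) (w : A.base ⟶ B.base)
    (a : X.hom w A.ob B.ob) : lift f (of w a) = f w a := by
  simp [lift, of]

open Classical in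
lemma hom_ext {A B : X.Pt} {M : Type u} [AddCommGroup M] [Module k M]
    {f g : TotalHom A B →ₗ[k] M} (h : ∀ w a, f (of w a) = g (of w a)) : f = g :=
  DirectSum.linearMap_ext _ fun w => LinearMap.ext fun a => h w a

lemma of_injective {A B : X.Pt} (w : A.base ⟶ B.base) :
    Function.Injective (of w : X.hom w A.ob B.ob →ₗ[k] TotalHom A B) := by
  classical
  exact DirectSum.of_injective w

lemma of_tr {A B : X.Pt} {v w : A.base ⟶ B.base} (h : v = w) (a : X.hom v A.ob B.ob) :
    of w (tr h a) = of v a := by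
  subst h; rfl

/-- The composition on morphisms of all degrees. -/
noncomputable def comp {A B C : X.Pt} : TotalHom B C →ₗ[k] TotalHom A B →ₗ[k] TotalHom A C :=
  lift fun u => LinearMap.flip <| lift fun v => LinearMap.flip <|
    (X.comp (rfl : v ≫ u = v ≫ u)).compr₂ (of (v ≫ u))

lemma comp_of {A B C : X.Pt} {u : B.base ⟶ C.base} {v : A.base ⟶ B.base} {w : A.base ⟶ C.base}
    (h : v ≫ u = w) (a : X.hom u B.ob C.ob) (b : X.hom v A.ob B.ob) :
    comp (of u a) (of v b) = of w (X.comp h a b) := by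
  subst h
  simp [comp, lift_of]

lemma comp_assoc {A B C D : X.Pt} {u : C.base ⟶ D.base} {v : B.base ⟶ C.base}
    {w : A.base ⟶ B.base} (a : X.hom u C.ob D.ob) (b : X.hom v B.ob C.ob)
    (c : X.hom w A.ob B.ob) :
    comp (of u a) (comp (of v b) (of w c)) = comp (comp (of u a) (of v b)) (of w c) := by
  rw [comp_of rfl, comp_of rfl, comp_of rfl, comp_of rfl, X.assoc rfl rfl rfl (by simp)]
  -- The degrees of the two sides are equal only by associativity in the base; with both replaced by
  -- variables the equality can be substituted.
  have : ∀ {p q : A.base ⟶ D.base} (hp : w ≫ v ≫ u = p) (hq : w ≫ v ≫ u = q) (e : p = q),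
      of p (X.comp hp (X.comp rfl a b) c) = of q (X.comp hq (X.comp rfl a b) c) := by
    intro p q hp hq e; subst e; rfl
  exact this _ _ (by simp)

end TotalHom

namespace PathTensor

open Classical in
/-- The inclusion of a summand. -/
noncomputable def of {A B : X.Pt} (p : X.Str A B) : p.tens →ₗ[k] PathTensor A B :=
  DirectSum.lof k _ (fun p : X.Str A B => p.tens) p

open Classical in
/-- The linear map with given restrictions to the summands. -/
noncomputable def lift {A B : X.Pt} {M : Type u} [AddCommGroup M] [Module k M]
    (f : ∀ p : X.Str A B, p.tens →ₗ[k] M) : PathTensor A B →ₗ[k] M :=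
  DirectSum.toModule k _ M f

lemma lift_of {A B : X.Pt} {M : Type u} [AddCommGroup M] [Module k M]
    (f : ∀ p : X.Str A B, p.tens →ₗ[k] M) (p : X.Str A B) (x : p.tens) :
    lift f (of p x) = f p x := by
  simp [lift, of]

open Classical in
lemma hom_ext_of {A B : X.Pt} {M : Type u} [AddCommGroup M] [Module k M]
    {f g : PathTensor A B →ₗ[k] M} (h : ∀ p x, f (of p x) = g (of p x)) : f = g :=
  DirectSum.linearMap_ext _ fun p => LinearMap.ext fun x => h p x

/-- The empty tensor. -/
noncomputable def nil (A : X.Pt) : PathTensor A A := of Str.nil (1 : k)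

/-- The inclusion of `𝔞_u (B, C) ⊗ (𝔞_{u_{n-1}}(A_{n-1}, B) ⊗ ⋯ ⊗ 𝔞_{u_0}(A, A_1))`. -/
noncomputable def ofCons {A B C : X.Pt} (p : X.Str A B) (u : B.base ⟶ C.base) :
    X.hom u B.ob C.ob ⊗[k] p.tens →ₗ[k] PathTensor A C :=
  of (p.cons u)

/-- Adding a factor on the left. -/
noncomputable def cons {A B C : X.Pt} :
    TotalHom B C →ₗ[k] PathTensor A B →ₗ[k] PathTensor A C :=
  TotalHom.lift fun u => LinearMap.flip <| lift fun p => LinearMap.flip <|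
    TensorProduct.curry (ofCons p u)

lemma cons_of {A B C : X.Pt} (u : B.base ⟶ C.base) (a : X.hom u B.ob C.ob) (p : X.Str A B)
    (x : p.tens) : cons (TotalHom.of u a) (of p x) = ofCons p u (a ⊗ₜ x) := by
  simp [cons, TotalHom.lift_of, lift_of]

/-- Concatenation of tensors. -/
noncomputable def mul {A B C : X.Pt} :
    PathTensor B C →ₗ[k] PathTensor A B →ₗ[k] PathTensor A C :=
  lift fun q => LinearMap.flip <| lift fun p => LinearMap.flip <|
    TensorProduct.curry (of (p.append q) ∘ₗ Str.tensAppend p q)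

lemma mul_of {A B C : X.Pt} (q : X.Str B C) (p : X.Str A B) (x : q.tens) (y : p.tens) :
    mul (of q x) (of p y) = of (p.append q) (Str.tensAppend p q (x ⊗ₜ y)) := by
  simp [mul, lift_of]

end PathTensor

namespace Path

/-- The underlying string. -/
def str {A : X.Pt} : {B : X.Pt} → Path A B → X.Str A B
  | _, nil => .nil
  | _, cons x u _ => .cons x.str u

/-- The underlying tensor. -/
noncomputable def ten {A : X.Pt} : {B : X.Pt} → (x : Path A B) → x.str.tens
  | _, nil => (1 : k)
  | _, @cons _ _ _ _ B C x u a => (a ⊗ₜ[k] x.ten : X.hom u B.ob C.ob ⊗[k] x.str.tens)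

/-- The number of factors. -/
def length {A : X.Pt} : {B : X.Pt} → Path A B → ℕ
  | _, nil => 0
  | _, cons x _ _ => x.length + 1

/-- The class in the direct sum over all strings. -/
noncomputable def val {A B : X.Pt} (x : Path A B) : PathTensor A B := PathTensor.of x.str x.ten

lemma val_nil (A : X.Pt) : (nil : Path A A).val = PathTensor.nil A := rfl

lemma val_cons {A B C : X.Pt} (x : Path A B) (u : B.base ⟶ C.base) (a : X.hom u B.ob C.ob) :
    (x.cons u a).val = PathTensor.cons (TotalHom.of u a) x.val :=
  (PathTensor.cons_of u a x.str x.ten).symm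

lemma length_str {A B : X.Pt} (x : Path A B) : x.str.length = x.length := by
  induction x with
  | nil => rfl
  | cons x u a ih => exact congrArg (· + 1) ih

/-- The sum of the values of a function on all the ways to cut a path in two. -/
def sumCuts {A : X.Pt} {N : Type*} [AddCommMonoid N] : {C : X.Pt} →
    (∀ B, Path B C → Path A B → N) → Path A C → N
  | _, F, nil => F _ nil nil
  | _, F, cons x u a => F _ nil (cons x u a) + sumCuts (fun B l e => F B (l.cons u a) e) x

variable {N : Type*} [AddCommGroup N]

/-- The relation between the lengths is part of the hypothesis because it is needed when signs are
compared. -/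
lemma sumCuts_congr {A C : X.Pt} {F G : ∀ B, Path B C → Path A B → N} (x : Path A C)
    (h : ∀ B (l : Path B C) (e : Path A B), l.length + e.length = x.length →
      F B l e = G B l e) : sumCuts F x = sumCuts G x := by
  induction x with
  | nil => exact h _ _ _ rfl
  | cons x u a ih =>
    refine congrArg₂ (· + ·) (h _ _ _ (zero_add _)) (ih fun B l e hl => h _ _ _ ?_)
    simp only [length, ← hl]; omega

lemma sumCuts_add {A C : X.Pt} (F G : ∀ B, Path B C → Path A B → N) (x : Path A C) :
    sumCuts (fun B l e => F B l e + G B l e) x = sumCuts F x + sumCuts G x := by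
  induction x with
  | nil => rfl
  | cons x u a ih => simp only [sumCuts, ih]; abel

lemma map_sumCuts {N' : Type*} [AddCommGroup N'] {A C : X.Pt} {T : Type*} [FunLike T N N']
    [AddMonoidHomClass T N N'] (T : T)
    (F : ∀ B, Path B C → Path A B → N) (x : Path A C) :
    T (sumCuts F x) = sumCuts (fun B l e => T (F B l e)) x := by
  induction x with
  | nil => rfl
  | cons x u a ih => simp only [sumCuts, map_add, ih]

lemma smul_sumCuts [Module k N] {A C : X.Pt} (c : k) (F : ∀ B, Path B C → Path A B → N)
    (x : Path A C) : c • sumCuts F x = sumCuts (fun B l e => c • F B l e) x :=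
  map_sumCuts (DistribSMul.toAddMonoidHom N c) F x

/-- Coassociativity of deconcatenation: both sides run over the ways to cut a path in three. -/
lemma sumCuts_sumCuts {A D : X.Pt} (F : ∀ B C, Path C D → Path B C → Path A B → N)
    (x : Path A D) :
    sumCuts (fun _ l e => sumCuts (fun _ l' e' => F _ _ l' e' e) l) x =
      sumCuts (fun _ l e => sumCuts (fun _ l' e' => F _ _ l l' e') e) x := by
  induction x with
  | nil => rfl
  | cons x u a ih =>
    simp only [sumCuts, sumCuts_add]
    rw [add_assoc]
    exact congrArg _ (congrArg _ (ih fun B C l m e => F B C (l.cons u a) m e))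

/-- The sum over all cuts of the underlying string. -/
lemma sum_cuts_str {A C : X.Pt} (x : Path A C)
    (F : ∀ (B : X.Pt) (e : X.Str A B) (l : X.Str B C), l.tens ⊗[k] e.tens → N) :
    (x.str.cuts.map fun c => F c.mid c.early c.late (c.split x.ten)).sum =
      sumCuts (fun B l e => F B e.str l.str (l.ten ⊗ₜ e.ten)) x := by
  induction x with
  | nil => exact add_zero _
  | @cons B C x u a ih =>
    refine congrArg₂ (· + ·) rfl ((congrArg List.sum List.map_map).trans ?_)
    exact ih fun D e l t => F D e (l.cons u)
      ((TensorProduct.assoc k _ _ _).symm (a ⊗ₜ[k] t))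

end Path

namespace PathTensor

/-- Pure tensors generate. The induction on the string replaces `f` by `f ∘ₗ cons a`, so the claim
is reduced to the vanishing of a single map that may vary. -/
lemma hom_ext {A B : X.Pt} {M : Type u} [AddCommGroup M] [Module k M]
    {f g : PathTensor A B →ₗ[k] M} (h : ∀ x : Path A B, f x.val = g x.val) : f = g := by
  suffices H : ∀ {B : X.Pt} (p : X.Str A B) (f : PathTensor A B →ₗ[k] M),
      (∀ x : Path A B, f x.val = 0) → ∀ t, f (of p t) = 0 from
    sub_eq_zero.1 (hom_ext_of fun p t => H p (f - g) (fun x => by simp [h]) t)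
  intro B p
  induction p with
  | nil =>
    intro f hf (t : k)
    have e : (of Str.nil t : PathTensor A A) = t • nil A := by
      refine (congrArg (of (Str.nil : X.Str A A)) ?_).trans
        ((of (Str.nil : X.Str A A)).map_smul t (1 : k))
      exact (mul_one t).symm
    rw [e, map_smul, ← Path.val_nil, hf, smul_zero]
  | @cons B C p u ih =>
    intro f hf t
    have e : f ∘ₗ ofCons p u = 0 := by
      refine TensorProduct.ext' fun a x => ?_
      rw [LinearMap.comp_apply, ← cons_of]
      exact ih (f ∘ₗ cons (TotalHom.of u a)) (fun x => by
        rw [LinearMap.comp_apply, ← Path.val_cons, hf]) x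
    exact DFunLike.congr_fun e t

lemma nil_mul {A B : X.Pt} (y : PathTensor A B) : mul (nil B) y = y := by
  suffices mul (nil B) = LinearMap.id from DFunLike.congr_fun (this : mul (nil B) = _) y
  refine hom_ext_of fun p x => ?_
  refine (mul_of _ _ _ _).trans (congrArg (of p) ?_)
  exact one_smul k x

lemma cons_mul {A B C D : X.Pt} (a : TotalHom C D) (x : PathTensor B C) (y : PathTensor A B) :
    mul (cons a x) y = cons a (mul x y) := by
  have h₁ : (cons : TotalHom C D →ₗ[k] PathTensor B C →ₗ[k] _).compr₂ (mul.flip y) =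
      (cons : TotalHom C D →ₗ[k] PathTensor A C →ₗ[k] _).compl₂ (mul.flip y) := by
    refine TotalHom.hom_ext fun u a => hom_ext_of fun q x => ?_
    simp only [LinearMap.compr₂_apply, LinearMap.compl₂_apply, LinearMap.flip_apply]
    suffices mul (cons (TotalHom.of u a) (of q x)) =
        (cons (TotalHom.of u a)) ∘ₗ mul (A := A) (of q x) from DFunLike.congr_fun this y
    refine hom_ext_of fun p y => ?_
    rw [LinearMap.comp_apply, mul_of, cons_of, cons_of]
    exact mul_of (q.cons u) p _ y
  exact DFunLike.congr_fun (DFunLike.congr_fun h₁ a) x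

/-- The linear map `x ↦ ∑ f (x₁) (x₂)`, the sum over all factorizations `x = x₁ ⊗ x₂`. -/
noncomputable def sumCuts {A C : X.Pt} {M : Type u} [AddCommGroup M] [Module k M]
    (f : ∀ B, PathTensor B C →ₗ[k] PathTensor A B →ₗ[k] M) : PathTensor A C →ₗ[k] M :=
  lift fun p => (p.cuts.map fun c =>
    TensorProduct.lift ((f c.mid).compl₁₂ (of c.late) (of c.early)) ∘ₗ c.split).sum

variable {A : X.Pt} {M : Type u} [AddCommGroup M] [Module k M]

lemma sumCuts_val {C : X.Pt} (f : ∀ B, PathTensor B C →ₗ[k] PathTensor A B →ₗ[k] M)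
    (x : Path A C) : sumCuts f x.val = x.sumCuts fun B l e => f B l.val e.val := by
  rw [sumCuts, Path.val, lift_of]
  have h := x.sum_cuts_str fun B e l t =>
    TensorProduct.lift ((f B).compl₁₂ (of l) (of e)) t
  refine Eq.trans ?_ h
  induction x.str.cuts with
  | nil => rfl
  | cons c l ih => simp only [List.map_cons, List.sum_cons, LinearMap.add_apply, ih]; rfl

lemma sumCuts_nil (f : ∀ B, PathTensor B A →ₗ[k] PathTensor A B →ₗ[k] M) :
    sumCuts f (nil A) = f A (nil A) (nil A) :=
  sumCuts_val f .nil

/-- A cut lies either to the left of `a` or to its right. Both arguments are arbitrary, so that this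
applies to values of operators, which need not be pure tensors. -/
lemma sumCuts_cons {B C : X.Pt} (f : ∀ B, PathTensor B C →ₗ[k] PathTensor A B →ₗ[k] M)
    (a : TotalHom B C) (x : PathTensor A B) : sumCuts f (cons a x) =
      f C (nil C) (cons a x) + sumCuts (fun D => (f D) ∘ₗ cons a) x := by
  -- To reduce to homogeneous `a`, both sides have to be written as linear maps in `a`; for the last
  -- summand this linearity is proved on the spot.
  have H : ∀ x : Path A B, (sumCuts f) ∘ₗ cons.flip x.val = ((f C (nil C)) ∘ₗ cons.flip x.val +
      (LinearMap.applyₗ x.val) ∘ₗ (⟨⟨fun a => sumCuts (fun D => (f D) ∘ₗ cons a), fun a b =>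
        hom_ext fun y => by simp [sumCuts_val, Path.sumCuts_add]⟩, fun c a =>
        hom_ext fun y => by simp [sumCuts_val, Path.smul_sumCuts]⟩ :
          TotalHom B C →ₗ[k] PathTensor A B →ₗ[k] M)) := by
    intro x
    refine TotalHom.hom_ext fun u a => ?_
    change sumCuts f (cons (TotalHom.of u a) x.val) = f C (nil C) (cons (TotalHom.of u a) x.val) +
      sumCuts (fun D => (f D) ∘ₗ cons (TotalHom.of u a)) x.val
    rw [← Path.val_cons, sumCuts_val, sumCuts_val]
    simp only [Path.sumCuts, Path.val_cons]
    rfl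
  have H' : sumCuts f ∘ₗ cons a = (f C (nil C)) ∘ₗ cons a +
      sumCuts (fun D => (f D) ∘ₗ cons a) :=
    hom_ext fun x => DFunLike.congr_fun (H x) a
  exact DFunLike.congr_fun H' x

end PathTensor

end MapGr

/-! ### Koszul signs. -/

/-- The sign `(-1)^d` as a scalar. -/
def koszulSign (k : Type u) [CommRing k] (d : ℤ) : k := ((d.negOnePow : ℤˣ) : ℤ)

namespace koszulSign

variable {k : Type u} [CommRing k]

lemma smul_eq {M : Type*} [AddCommGroup M] [Module k M] (d : ℤ) (x : M) :
    d.negOnePow • x = koszulSign k d • x := by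
  rw [koszulSign, Int.cast_smul_eq_zsmul]; rfl

lemma add (a b : ℤ) : koszulSign k (a + b) = koszulSign k a * koszulSign k b := by
  simp [koszulSign, Int.negOnePow_add]

@[simp] lemma zero : koszulSign k 0 = 1 := by simp [koszulSign]

lemma congr {a b : ℤ} (c : ℤ) (h : a = b + 2 * c) : koszulSign k a = koszulSign k b := by
  rw [h, koszulSign, koszulSign, Int.negOnePow_add, Int.negOnePow_two_mul, mul_one]

lemma mul_congr {a b c : ℤ} (d : ℤ) (h : a + b = c + 2 * d) :
    koszulSign k a * koszulSign k b = koszulSign k c := by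
  rw [← add, congr d h]

lemma neg_one_pow (n : ℕ) : (-1 : k) ^ n = koszulSign k n := by
  induction n with
  | zero => simp
  | succ n ih => rw [pow_succ, ih, Nat.cast_succ, add]; simp [koszulSign]

end koszulSign

namespace BInfData

variable {k : Type u} [CommRing k] {E : BInfData k}

@[simp] lemma deg_nil : deg ([] : E.Word) = 0 := rfl

lemma deg_cons (v : Σ n : ℤ, E.V n) (x : E.Word) : deg (v :: x) = v.1 - 1 + deg x := by
  simp [deg]

lemma deg_append (x y : E.Word) : deg (x ++ y) = deg x + deg y := by
  simp [deg]

end BInfData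

namespace MapGr

variable {k : Type u} [CommRing k] {X : MapGr k}

/-! ### The action of words of cochains, by recursion on the first letter. -/

/-- A homogeneous cochain as a cochain. -/
noncomputable def homogeneous (ψ : Σ n : ℤ, (hochschild X).V n) : X.Cochains :=
  DirectSum.lof k ℤ (fun n => X.cochain n) ψ.1 ψ.2

lemma eval_homogeneous_of_ne {A B : X.Pt} (p : X.Str A B) (ψ : Σ n : ℤ, (hochschild X).V n)
    (h : (p.length : ℤ) ≠ ψ.1) : eval p (homogeneous ψ) = 0 := by
  have h' : DirectSum.component k ℤ (fun n => X.cochain n) p.length (homogeneous ψ) = 0 :=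
    DirectSum.of_eq_of_ne (β := fun n => X.cochain n) _ _ _ h
  exact congrFun h' (⟨A, B, p, rfl⟩ : X.Simplex p.length)

/-- The value of a cochain on tensors over strings of all degrees. -/
noncomputable def value (φ : X.Cochains) {A B : X.Pt} : PathTensor A B →ₗ[k] TotalHom A B :=
  PathTensor.lift fun p => TotalHom.of p.total ∘ₗ eval p φ

lemma value_of (φ : X.Cochains) {A B : X.Pt} (p : X.Str A B) (x : p.tens) :
    value φ (PathTensor.of p x) = TotalHom.of p.total (eval p φ x) :=
  PathTensor.lift_of _ _ _

lemma value_homogeneous_of_ne (ψ : Σ n : ℤ, (hochschild X).V n) {A B : X.Pt} (x : Path A B)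
    (h : (x.length : ℤ) ≠ ψ.1) : value (homogeneous ψ) x.val = 0 := by
  rw [Path.val, value_of, eval_homogeneous_of_ne _ _ (by rwa [Path.length_str])]
  simp

/-- Multiplication with `(-1)^{d n}` on tensors over strings of length `n`. -/
noncomputable def PathTensor.twist (d : ℤ) {A B : X.Pt} : PathTensor A B →ₗ[k] PathTensor A B :=
  PathTensor.lift fun p => koszulSign k (d * p.length) • PathTensor.of p

lemma PathTensor.twist_val (d : ℤ) {A B : X.Pt} (x : Path A B) :
    PathTensor.twist d x.val = koszulSign k (d * x.length) • x.val := by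
  rw [PathTensor.twist, Path.val, PathTensor.lift_of, Path.length_str]; rfl

lemma PathTensor.twist_nil (d : ℤ) (A : X.Pt) :
    PathTensor.twist d (PathTensor.nil A) = PathTensor.nil A := by
  rw [← Path.val_nil, PathTensor.twist_val]
  simp [Path.length]

lemma PathTensor.twist_cons (d : ℤ) {A B C : X.Pt} (a : TotalHom B C) (x : PathTensor A B) :
    PathTensor.twist d (PathTensor.cons a x) =
      koszulSign k d • PathTensor.cons a (PathTensor.twist d x) := by
  suffices H : (PathTensor.cons : TotalHom B C →ₗ[k] PathTensor A B →ₗ[k] _).compr₂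
      (PathTensor.twist d) = koszulSign k d • PathTensor.cons.compl₂ (PathTensor.twist d) from
    DFunLike.congr_fun (DFunLike.congr_fun H a) x
  refine TotalHom.hom_ext fun u a => PathTensor.hom_ext fun x => ?_
  simp only [LinearMap.compr₂_apply, LinearMap.smul_apply, LinearMap.compl₂_apply,
    PathTensor.twist_val, ← Path.val_cons, map_smul, smul_smul, Path.length]
  rw [koszulSign.mul_congr 0]
  push_cast; ring

variable (X) in
/-- Families of operators on tensors over strings. -/
abbrev PathOp : Type u := ∀ A B : X.Pt, PathTensor A B →ₗ[k] PathTensor A B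

open PathTensor

variable (ψ : Σ n : ℤ, (hochschild X).V n) (d : ℤ) (g : X.PathOp)

/-- The operator `x ↦ ∑ ± ψ (x₁) ⊗ g (x₂)`, the sum over all factorizations `x = x₁ ⊗ x₂`, for an
operator `g` of degree `d`. -/
noncomputable def consOp : X.PathOp := fun A _ => sumCuts fun B =>
  koszulSign k (d * ψ.1) • cons.compl₁₂ (value (homogeneous ψ)) (g A B)

/-- The operator `x ↦ ∑ ± x₀ ⊗ ψ (x₁) ⊗ g (x₂)`, the sum over all factorizations
`x = x₀ ⊗ x₁ ⊗ x₂`, for an operator `g` of degree `d`. -/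
noncomputable def leftStep : X.PathOp := fun A _ => sumCuts fun B =>
  mul.compl₁₂ (twist (ψ.1 - 1 + d)) (consOp ψ d g A B)

/-- The sign is that of moving `g` past the factors of `l`. It agrees with the constant sign of the
definition because `ψ` vanishes unless `l` has `ψ.1` factors. -/
lemma consOp_val {A C : X.Pt} (x : Path A C) : consOp ψ d g A C x.val = x.sumCuts fun B l e =>
    koszulSign k (d * l.length) • cons (value (homogeneous ψ) l.val) (g A B e.val) := by
  rw [consOp, sumCuts_val]
  refine Path.sumCuts_congr _ fun B l e _ => ?_
  change koszulSign k (d * ψ.1) • cons (value (homogeneous ψ) l.val) (g A B e.val) = _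
  by_cases h : (l.length : ℤ) = ψ.1
  · rw [h]
  · simp [value_homogeneous_of_ne ψ l h]

lemma leftStep_val {A C : X.Pt} (x : Path A C) : leftStep ψ d g A C x.val = x.sumCuts fun B l e =>
    koszulSign k ((ψ.1 - 1 + d) * l.length) • mul l.val (consOp ψ d g A B e.val) := by
  rw [leftStep, sumCuts_val]
  refine Path.sumCuts_congr _ fun B l e _ => ?_
  simp [LinearMap.compl₁₂_apply, twist_val]

lemma leftStep_nil (A : X.Pt) : leftStep ψ d g A A (nil A) = consOp ψ d g A A (nil A) := by
  rw [leftStep, sumCuts_nil, LinearMap.compl₁₂_apply, twist_nil, nil_mul]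

/-- Either `a` stays in place and the whole operator moves past it, or the block of `ψ` begins at
the left end. Together with `leftStep_nil` this is the form in which the operator enters the
inductions below. -/
lemma leftStep_cons {A B C : X.Pt} (a : TotalHom B C) (x : PathTensor A B) :
    leftStep ψ d g A C (cons a x) =
      koszulSign k (ψ.1 - 1 + d) • cons a (leftStep ψ d g A B x) + consOp ψ d g A C (cons a x) := by
  rw [leftStep, sumCuts_cons, LinearMap.compl₁₂_apply, twist_nil, nil_mul, add_comm]
  refine congrArg (· + _) ?_
  suffices H : sumCuts (fun D => mul.compl₁₂ (twist (ψ.1 - 1 + d)) (consOp ψ d g A D) ∘ₗ cons a) =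
      koszulSign k (ψ.1 - 1 + d) • cons a ∘ₗ sumCuts
        (fun D => mul.compl₁₂ (twist (ψ.1 - 1 + d)) (consOp ψ d g A D)) from
    DFunLike.congr_fun H x
  refine hom_ext fun x => ?_
  rw [LinearMap.smul_apply, LinearMap.comp_apply, sumCuts_val, sumCuts_val, Path.map_sumCuts,
    Path.smul_sumCuts]
  refine Path.sumCuts_congr _ fun D l e _ => ?_
  simp only [LinearMap.comp_apply, LinearMap.compl₁₂_apply, twist_cons, map_smul,
    LinearMap.smul_apply, cons_mul]

/-- The operator `x ↦ ∑ ± x₀ ⊗ ψ_1 (y₁) ⊗ x₁ ⊗ ⋯ ⊗ ψ_r (y_r) ⊗ x_r` given by a word of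
homogeneous cochains. -/
noncomputable def wordOp : (hochschild X).Word → X.PathOp
  | [] => fun _ _ => LinearMap.id
  | ψ :: y => leftStep ψ (BInfData.deg y) (wordOp y)

/-- `act` is built by adding letters at the right end of a word and `wordOp` by adding them at the
left end; this is the recursion of the first kind for the second operator. -/
lemma wordOp_append_singleton (y : (hochschild X).Word) {A C : X.Pt} (x : Path A C) :
    wordOp (y ++ [ψ]) A C x.val = x.sumCuts fun B l e => koszulSign k ((ψ.1 - 1) * l.length) •
      mul (wordOp y B C l.val) (consOp ψ 0 (fun _ _ => LinearMap.id) A B e.val) := by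
  induction y generalizing A C with
  | nil =>
    have : BInfData.deg ([] : (hochschild X).Word) = 0 := rfl
    simp only [List.nil_append, wordOp, this]
    rw [leftStep_val]
    simp only [add_zero, LinearMap.id_apply]
  | cons φ y ih =>
    generalize consOp ψ 0 (fun _ _ => LinearMap.id) = r at ih ⊢
    -- The part in which the block of `φ` begins at the left end. Here `ih` and coassociativity
    -- suffice, with no recursion on the tensor.
    have hC : ∀ {A C : X.Pt} (x : Path A C),
        consOp φ (BInfData.deg (y ++ [ψ])) (wordOp (y ++ [ψ])) A C x.val =
          x.sumCuts fun B l e => koszulSign k ((ψ.1 - 1) * l.length) •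
            mul (consOp φ (BInfData.deg y) (wordOp y) B C l.val) (r A B e.val) := by
      intro A C x
      rw [consOp_val]
      simp only [ih]
      have h := Path.sumCuts_sumCuts (fun B C (l : Path C _) (m : Path B C) (e : Path A B) =>
        koszulSign k ((ψ.1 - 1) * (l.length + m.length) + BInfData.deg y * l.length) •
          cons (value (homogeneous φ) l.val) (mul (wordOp y _ _ m.val) (r A B e.val))) x
      refine Eq.trans ?_ (h.symm.trans ?_)
      · refine Path.sumCuts_congr _ fun B l e _ => ?_
        rw [Path.map_sumCuts, Path.smul_sumCuts]
        refine Path.sumCuts_congr _ fun B l' e' _ => ?_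
        rw [map_smul, smul_smul, koszulSign.mul_congr 0]
        simp [BInfData.deg]; ring
      · refine Path.sumCuts_congr _ fun B l e _ => ?_
        rw [consOp_val]
        change _ = _ • mul.flip _ _
        rw [Path.map_sumCuts, Path.smul_sumCuts]
        refine Path.sumCuts_congr _ fun B l' e' hl => ?_
        rw [LinearMap.flip_apply, map_smul, LinearMap.smul_apply, smul_smul, cons_mul,
          koszulSign.mul_congr 0]
        rw [← hl]; push_cast; ring
    change leftStep φ (BInfData.deg (y ++ [ψ])) (wordOp (y ++ [ψ])) A C x.val =
      x.sumCuts fun B l e => koszulSign k ((ψ.1 - 1) * l.length) •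
        mul (leftStep φ (BInfData.deg y) (wordOp y) B C l.val) (r A B e.val)
    induction x with
    | nil =>
      have h := hC (Path.nil : Path A A)
      simp only [Path.sumCuts, Path.val_nil, leftStep_nil] at h ⊢
      exact h
    | cons x u a ihx =>
      have h := hC (x.cons u a)
      simp only [Path.sumCuts, Path.val_nil, leftStep_nil] at h ⊢
      rw [Path.val_cons] at h ⊢
      rw [leftStep_cons, h, ihx, add_left_comm, Path.map_sumCuts, Path.smul_sumCuts]
      refine congrArg _ ?_
      rw [← Path.sumCuts_add]
      refine Path.sumCuts_congr _ fun B l e _ => ?_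
      rw [Path.val_cons, leftStep_cons, map_add, LinearMap.add_apply, smul_add, map_smul, map_smul,
        LinearMap.smul_apply, cons_mul, smul_smul, smul_smul]
      refine congrArg (fun c => c • _ + _) ?_
      rw [← koszulSign.add, ← koszulSign.add]
      refine koszulSign.congr 0 ?_
      rw [BInfData.deg_append, BInfData.deg_cons]
      simp [BInfData.deg, Path.length]; ring

/-- The value of a homogeneous cochain on tensors over strings of a given length. -/
lemma homogeneous_injective {n : ℤ} {ψ ψ' : X.cochain n}
    (h : ∀ (A B : X.Pt) (x : Path A B), (x.length : ℤ) = n →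
      value (homogeneous ⟨n, ψ⟩) x.val = value (homogeneous ⟨n, ψ'⟩) x.val) : ψ = ψ' := by
  have h' : ∀ (A B : X.Pt), (value (homogeneous ⟨n, ψ⟩) : PathTensor A B →ₗ[k] _) =
      value (homogeneous ⟨n, ψ'⟩) := fun A B => hom_ext fun x => by
    by_cases hx : (x.length : ℤ) = n
    · exact h A B x hx
    · rw [value_homogeneous_of_ne _ _ hx, value_homogeneous_of_ne _ _ hx]
  funext s
  obtain ⟨A, B, p, rfl⟩ := s
  refine LinearMap.ext fun x => TotalHom.of_injective p.total ?_
  have e : ∀ ψ : X.cochain p.length, eval p (homogeneous ⟨_, ψ⟩) = ψ ⟨A, B, p, rfl⟩ := by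
    intro ψ
    rw [eval_eq p _ rfl]
    exact congrFun (DirectSum.of_eq_same (β := fun n => X.cochain n) _ ψ) _
  have h'' := DFunLike.congr_fun (h' A B) (of p x)
  rw [value_of, value_of, e, e] at h''
  exact h''

/-! ### The effect of the action on the number of factors. -/

/-- Tensors over strings of a given length. -/
noncomputable def lengthPart (m : ℤ) (A B : X.Pt) : Submodule k (PathTensor A B) :=
  Submodule.span k {y | ∃ x : Path A B, (x.length : ℤ) = m ∧ x.val = y}

lemma cons_mem_lengthPart {m m' : ℤ} (hm : m + 1 = m') {A B C : X.Pt} (a : TotalHom B C)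
    {x : PathTensor A B} (hx : x ∈ lengthPart m A B) : cons a x ∈ lengthPart m' A C := by
  induction hx using Submodule.span_induction with
  | zero => simp
  | add x y _ _ hx hy => rw [map_add]; exact add_mem hx hy
  | smul c x _ hx => rw [map_smul]; exact Submodule.smul_mem _ _ hx
  | mem x hx =>
    obtain ⟨x, rfl, rfl⟩ := hx
    suffices H : LinearMap.range (cons.flip x.val : TotalHom B C →ₗ[k] _) ≤ lengthPart m' A C from
      H ⟨a, rfl⟩
    classical
    rintro _ ⟨a, rfl⟩
    induction a using DirectSum.induction_on with
    | zero => simp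
    | of u a =>
      refine Submodule.subset_span ⟨x.cons u a, ?_, Path.val_cons x u a⟩
      rw [← hm]; simp [Path.length]
    | add a b ha hb => rw [map_add]; exact add_mem ha hb

lemma sumCuts_mem {A C : X.Pt} {M : Type u} [AddCommGroup M] [Module k M] (S : Submodule k M)
    {F : ∀ B, Path B C → Path A B → M} (x : Path A C)
    (h : ∀ B (l : Path B C) (e : Path A B), l.length + e.length = x.length → F B l e ∈ S) :
    x.sumCuts F ∈ S := by
  induction x with
  | nil => exact h _ _ _ rfl
  | cons x u a ih =>
    refine add_mem (h _ _ _ (zero_add _)) (ih fun B l e hl => h _ _ _ ?_)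
    simp only [Path.length, ← hl]; omega

/-- A letter in `C^n` replaces `n` factors by one, so it lowers the length by its degree `n - 1`. -/
lemma wordOp_mem_lengthPart (y : (hochschild X).Word) {A C : X.Pt} (x : Path A C) :
    wordOp y A C x.val ∈ lengthPart (x.length - BInfData.deg y) A C := by
  induction y generalizing A C with
  | nil => exact Submodule.subset_span ⟨x, by simp [BInfData.deg], rfl⟩
  | cons ψ y ih =>
    have hC : ∀ {A C : X.Pt} (x : Path A C), consOp ψ (BInfData.deg y) (wordOp y) A C x.val ∈
        lengthPart (x.length - BInfData.deg (ψ :: y)) A C := by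
      intro A C x
      rw [consOp_val]
      refine sumCuts_mem _ x fun B l e hl => Submodule.smul_mem _ _ ?_
      by_cases h : (l.length : ℤ) = ψ.1
      · refine cons_mem_lengthPart ?_ _ (ih e)
        rw [← hl, BInfData.deg_cons, ← h]; push_cast; ring
      · rw [value_homogeneous_of_ne _ _ h]; simp
    induction x with
    | nil => rw [Path.val_nil, wordOp, leftStep_nil]; exact hC .nil
    | cons x u a ihx =>
      have h := hC (x.cons u a)
      rw [Path.val_cons] at h ⊢
      rw [wordOp, leftStep_cons]
      refine add_mem (Submodule.smul_mem _ _ (cons_mem_lengthPart ?_ _ ihx)) h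
      simp only [Path.length]; push_cast; ring

lemma value_eq_zero_of_mem_lengthPart {m : ℤ} (h : m ≠ ψ.1) {A B : X.Pt} {x : PathTensor A B}
    (hx : x ∈ lengthPart m A B) : value (homogeneous ψ) x = 0 := by
  suffices H : lengthPart m A B ≤ LinearMap.ker (value (homogeneous ψ)) from H hx
  refine Submodule.span_le.2 ?_
  rintro _ ⟨x, rfl, rfl⟩
  exact value_homogeneous_of_ne ψ x h

end MapGr

/-! ### Deconcatenation of words. -/

/-- The sum of the values of a function on all the ways to cut a list in two. -/
def List.sumSplits {α N : Type*} [AddCommMonoid N] : (List α → List α → N) → List α → N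
  | F, [] => F [] []
  | F, a :: l => F [] (a :: l) + List.sumSplits (fun p q => F (a :: p) q) l

namespace List

variable {α N : Type*} [AddCommMonoid N]

lemma sum_range_take_drop (F : List α → List α → N) (l : List α) :
    ∑ i ∈ Finset.range (l.length + 1), F (l.take i) (l.drop i) = l.sumSplits F := by
  induction l generalizing F with
  | nil => simp [sumSplits]
  | cons a l ih =>
    rw [length_cons, Finset.sum_range_succ', add_comm, sumSplits, ← ih]
    rfl

lemma sumSplits_congr {F G : List α → List α → N} (l : List α)
    (h : ∀ p q, p ++ q = l → F p q = G p q) : l.sumSplits F = l.sumSplits G := by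
  induction l generalizing F G with
  | nil => exact h _ _ rfl
  | cons a l ih =>
    exact congrArg₂ (· + ·) (h _ _ rfl) (ih fun p q hl => h _ _ (by simp [hl]))

lemma sumSplits_add (F G : List α → List α → N) (l : List α) :
    l.sumSplits (fun p q => F p q + G p q) = l.sumSplits F + l.sumSplits G := by
  induction l generalizing F G with
  | nil => rfl
  | cons a l ih => simp only [sumSplits, ih]; abel

lemma sumSplits_zero (l : List α) : l.sumSplits (fun _ _ => (0 : N)) = 0 := by
  induction l with
  | nil => rfl
  | cons a l ih => simp only [sumSplits, ih, add_zero]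

lemma map_sumSplits {N' : Type*} [AddCommMonoid N'] {T : Type*} [FunLike T N N']
    [AddMonoidHomClass T N N'] (T : T) (F : List α → List α → N) (l : List α) :
    T (l.sumSplits F) = l.sumSplits fun p q => T (F p q) := by
  induction l generalizing F with
  | nil => rfl
  | cons a l ih => simp only [sumSplits, map_add, ih]

lemma smul_sumSplits {R : Type*} [Monoid R] [DistribMulAction R N] (c : R)
    (F : List α → List α → N) (l : List α) :
    c • l.sumSplits F = l.sumSplits fun p q => c • F p q :=
  map_sumSplits (DistribSMul.toAddMonoidHom N c) F l

lemma sumSplits_eq_last (F : List α → List α → N) (l : List α)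
    (h : ∀ p q, p ++ q = l → q ≠ [] → F p q = 0) : l.sumSplits F = F l [] := by
  induction l generalizing F with
  | nil => rfl
  | cons a l ih =>
    rw [sumSplits, h _ _ rfl (by simp), zero_add,
      ih _ fun p q hp hq => h (a :: p) q (by simp [hp]) hq]

end List

namespace MapGr

variable {k : Type u} [CommRing k] {X : MapGr k}

lemma Path.sumSplits_sumCuts {α : Type*} {N : Type*} [AddCommGroup N] {A C : X.Pt}
    (F : List α → List α → ∀ B, Path B C → Path A B → N) (l : List α) (x : Path A C) :
    l.sumSplits (fun p q => x.sumCuts (F p q)) =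
      x.sumCuts fun B y z => l.sumSplits fun p q => F p q B y z := by
  induction l generalizing F with
  | nil => rfl
  | cons a l ih => simp only [List.sumSplits, ih, Path.sumCuts_add]

open PathTensor

/-! ### Comparison with `act`, and compatibility of the action with comultiplications. -/

/-- The map of bar constructions which forgets the composite. -/
noncomputable def Bar.toPathTensor {A B : X.Pt} {w : A.base ⟶ B.base} :
    Bar A B w →ₗ[k] PathTensor A B :=
  Bar.lift fun p _ => PathTensor.of p

lemma Bar.toPathTensor_of {A B : X.Pt} {w : A.base ⟶ B.base} (p : X.Str A B) (h : p.total = w)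
    (x : p.tens) : Bar.toPathTensor (Bar.of p h x) = PathTensor.of p x :=
  DFunLike.congr_fun (Bar.lift_comp_of (fun p _ => PathTensor.of p) p h) x

lemma Bar.toPathTensor_mul {A B C : X.Pt} {v : A.base ⟶ B.base} {u : B.base ⟶ C.base}
    {w : A.base ⟶ C.base} (h : v ≫ u = w) (x : Bar B C u) (y : Bar A B v) :
    Bar.toPathTensor (Bar.mul h x y) =
      PathTensor.mul (Bar.toPathTensor x) (Bar.toPathTensor y) := by
  suffices H : (Bar.mul h).compr₂ Bar.toPathTensor =
      PathTensor.mul.compl₁₂ Bar.toPathTensor Bar.toPathTensor from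
    DFunLike.congr_fun (DFunLike.congr_fun H x) y
  refine Bar.hom_ext fun q hq => LinearMap.ext fun x => Bar.hom_ext fun p hp =>
    LinearMap.ext fun y => ?_
  simp only [LinearMap.comp_apply, LinearMap.compr₂_apply, LinearMap.compl₁₂_apply,
    Bar.toPathTensor_of, PathTensor.mul_of, Bar.mul_of]

lemma value_toPathTensor (φ : X.Cochains) {A B : X.Pt} {w : A.base ⟶ B.base} (x : Bar A B w) :
    value φ (Bar.toPathTensor x) = TotalHom.of w (evalBar w φ x) := by
  suffices H : value φ ∘ₗ Bar.toPathTensor = TotalHom.of w ∘ₗ evalBar w φ from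
    DFunLike.congr_fun H x
  refine Bar.hom_ext fun p hp => LinearMap.ext fun x => ?_
  simp only [LinearMap.comp_apply, Bar.toPathTensor_of, value_of]
  have h : evalBar w φ (Bar.of p hp x) = tr hp (eval p φ x) :=
    DFunLike.congr_fun (Bar.lift_comp_of (fun p h => (tr h).toLinearMap ∘ₗ eval p φ) p hp) x
  rw [h, TotalHom.of_tr]

lemma toPathTensor_insert (N : ℕ) (ψ : Σ n : ℤ, (hochschild X).V n) {A C : X.Pt} (x : Path A C) :
    Bar.toPathTensor (insert N x.str rfl (homogeneous ψ) x.ten) =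
      koszulSign k ((ψ.1 - 1) * N) • consOp ψ 0 (fun _ _ => LinearMap.id) A C x.val := by
  rw [consOp_val, Path.smul_sumCuts]
  have h := x.sum_cuts_str fun B e l t => (-1 : k) ^ (N * (l.length + 1)) •
    ofCons e l.total ((eval l (homogeneous ψ)).rTensor e.tens t)
  refine Eq.trans ?_ (h.trans ?_)
  · change (Bar.toPathTensor ∘ₗ (List.map _ _).sum) x.ten = _
    induction x.str.cuts with
    | nil => simp
    | cons c l ih =>
      rw [List.map_cons, List.sum_cons, LinearMap.comp_add, LinearMap.add_apply, ih, List.map_cons,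
        List.sum_cons]
      refine congrArg (· + _) ?_
      simp only [LinearMap.comp_apply, LinearMap.smul_apply, map_smul]
      exact congrArg _ (Bar.toPathTensor_of _ _ _)
  · refine Path.sumCuts_congr _ fun B l e _ => ?_
    rw [LinearMap.rTensor_tmul, zero_mul, koszulSign.zero, one_smul, LinearMap.id_apply, Path.val,
      value_of, Path.val, cons_of]
    by_cases hl : (l.str.length : ℤ) = ψ.1
    -- If `l` has `ψ.1` factors, the exponents `N * (ψ.1 + 1)` and `(ψ.1 - 1) * N` differ by `2 *
    -- N`; for other lengths the value of `ψ` is zero.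
    · rw [koszulSign.neg_one_pow, koszulSign.congr (k := k) (N : ℤ)]
      rw [← hl]; push_cast; ring
    · rw [eval_homogeneous_of_ne _ _ hl]
      simp

/-- The action of `T(sC)` on tensors over strings. -/
noncomputable def actOp : TensorCoalgebra X.cochain →ₗ[k] X.PathOp where
  toFun t := fun A B => PathTensor.lift fun p =>
    Bar.toPathTensor ∘ₗ act t A B p.total ∘ₗ Bar.of p rfl
  map_add' s t := by
    funext A B
    refine PathTensor.hom_ext_of fun p x => ?_
    simp [PathTensor.lift_of]
  map_smul' c t := by
    funext A B
    refine PathTensor.hom_ext_of fun p x => ?_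
    simp [PathTensor.lift_of]

lemma actOp_of (t : TensorCoalgebra X.cochain) {A B : X.Pt} (p : X.Str A B) (x : p.tens) :
    actOp t A B (PathTensor.of p x) = Bar.toPathTensor (act t A B p.total (Bar.of p rfl x)) :=
  PathTensor.lift_of _ _ _

lemma actOp_one : actOp (1 : TensorCoalgebra X.cochain) = fun _ _ => LinearMap.id := by
  funext A B
  refine PathTensor.hom_ext_of fun p x => ?_
  rw [actOp_of]
  simp [act, Bar.toPathTensor_of]

lemma actOp_mul_homogeneous (t : TensorCoalgebra X.cochain) (ψ : Σ n : ℤ, (hochschild X).V n)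
    {A C : X.Pt} (x : Path A C) : actOp (t * TensorAlgebra.ι k (homogeneous ψ)) A C x.val =
      x.sumCuts fun B l e => koszulSign k ((ψ.1 - 1) * l.length) •
        mul (actOp t B C l.val) (consOp ψ 0 (fun _ _ => LinearMap.id) A B e.val) := by
  -- Because of the opposite algebra in the definition of `act`, the last letter of a word gives the
  -- step that is applied last.
  have hs : act (t * TensorAlgebra.ι k (homogeneous ψ)) = stepOp (homogeneous ψ) (act t) := by
    simp [act, step]
  rw [Path.val, actOp_of, hs]
  have h := x.sum_cuts_str fun B e l t' =>
    TensorProduct.lift (mul.compl₁₂ (actOp t B C ∘ₗ PathTensor.of l)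
      (Bar.toPathTensor ∘ₗ insert l.length e rfl (homogeneous ψ))) t'
  refine Eq.trans ?_ (h.trans ?_)
  · have h' := DFunLike.congr_fun (stepOp_comp_of (homogeneous ψ) (act t) x.str rfl) x.ten
    refine (congrArg Bar.toPathTensor h').trans ?_
    rw [← LinearMap.comp_apply]
    induction x.str.cuts with
    | nil => simp
    | cons c l ih =>
      rw [List.map_cons, List.sum_cons, LinearMap.comp_add, LinearMap.add_apply, ih, List.map_cons,
        List.sum_cons]
      refine congrArg (· + _) ?_
      simp only [LinearMap.comp_apply]
      induction c.split x.ten using TensorProduct.induction_on with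
      | zero => simp
      | add y z hy hz => simp only [map_add, hy, hz]
      | tmul y z =>
        simp only [TensorProduct.map_tmul, TensorProduct.lift.tmul, Bar.toPathTensor_mul,
          LinearMap.compl₁₂_apply, LinearMap.comp_apply, actOp_of]
  · refine Path.sumCuts_congr _ fun B l e _ => ?_
    rw [TensorProduct.lift.tmul, LinearMap.compl₁₂_apply, LinearMap.comp_apply,
      LinearMap.comp_apply, toPathTensor_insert, map_smul, Path.length_str]
    rfl

/-- Both sides satisfy the same recursion with respect to the last letter. -/
lemma actOp_tens (y : (hochschild X).Word) : actOp (BInfData.tens y) = wordOp y := by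
  induction y using List.reverseRecOn with
  | nil => exact actOp_one
  | append_singleton y ψ ih =>
    funext A C
    refine PathTensor.hom_ext fun x => ?_
    have : BInfData.tens (y ++ [ψ]) = BInfData.tens y * BInfData.single ψ.1 ψ.2 := by
      simp [BInfData.tens]
    rw [this, wordOp_append_singleton]
    refine (actOp_mul_homogeneous (BInfData.tens y) ψ x).trans ?_
    rw [ih]

/-- The compatibility of `wordOp` with the comultiplications. -/
lemma sumCuts_wordOp (z : (hochschild X).Word) {A C : X.Pt} {M : Type u} [AddCommGroup M]
    [Module k M] (f : ∀ B, PathTensor B C →ₗ[k] PathTensor A B →ₗ[k] M) (x : Path A C) :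
    PathTensor.sumCuts f (wordOp z A C x.val) = z.sumSplits fun z₁ z₂ => x.sumCuts fun B l e =>
      koszulSign k (BInfData.deg z₂ * l.length) •
        f B (wordOp z₁ B C l.val) (wordOp z₂ A B e.val) := by
  induction z generalizing A C with
  | nil => simp [wordOp, List.sumSplits, sumCuts_val, BInfData.deg]
  | cons ζ z ih =>
    -- The leftmost factor of these tensors is a value of `ζ`, so a cut lies to the left of it or
    -- else cuts what `z` has produced; in the second case `ih` applies.
    have hC : ∀ {A C : X.Pt} (f : ∀ B, PathTensor B C →ₗ[k] PathTensor A B →ₗ[k] M)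
        (x : Path A C), PathTensor.sumCuts f (consOp ζ (BInfData.deg z) (wordOp z) A C x.val) =
          f C (nil C) (consOp ζ (BInfData.deg z) (wordOp z) A C x.val) +
          z.sumSplits fun z₁ z₂ => x.sumCuts fun B l e =>
            koszulSign k (BInfData.deg z₂ * l.length) •
            f B (consOp ζ (BInfData.deg z₁) (wordOp z₁) B C l.val) (wordOp z₂ A B e.val) := by
      intro A C f x
      rw [consOp_val, Path.map_sumCuts, Path.map_sumCuts]
      simp only [map_smul, sumCuts_cons, smul_add, ih]
      rw [Path.sumCuts_add]
      refine congrArg _ ?_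
      simp only [List.smul_sumSplits]
      rw [← Path.sumSplits_sumCuts]
      refine List.sumSplits_congr _ fun z₁ z₂ hz => ?_
      have h := Path.sumCuts_sumCuts (fun B D (l : Path D C) (m : Path B D) (e : Path A B) =>
        koszulSign k (BInfData.deg z₂ * (l.length + m.length) + BInfData.deg z₁ * l.length) •
          f B (cons (value (homogeneous ζ) l.val) (wordOp z₁ B D m.val)) (wordOp z₂ A B e.val)) x
      refine Eq.trans ?_ (h.symm.trans ?_)
      · refine Path.sumCuts_congr _ fun B l e _ => ?_
        rw [Path.smul_sumCuts]
        refine Path.sumCuts_congr _ fun B l' e' _ => ?_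
        rw [smul_smul, koszulSign.mul_congr 0]
        · rfl
        · rw [← hz, BInfData.deg_append]; ring
      · refine Path.sumCuts_congr _ fun B l e _ => ?_
        rw [consOp_val]
        change _ = _ • (f B).flip _ _
        rw [Path.map_sumCuts, Path.smul_sumCuts]
        refine Path.sumCuts_congr _ fun B l' e' hl => ?_
        rw [LinearMap.flip_apply, map_smul, LinearMap.smul_apply, smul_smul,
          koszulSign.mul_congr 0]
        rw [← hl]; push_cast; ring
    -- The two summands are the split in which `ζ` belongs to the second part, so that the first
    -- part is empty, and those in which it belongs to the first part.
    change PathTensor.sumCuts f (leftStep ζ (BInfData.deg z) (wordOp z) A C x.val) =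
      (x.sumCuts fun B l e => koszulSign k (BInfData.deg (ζ :: z) * l.length) •
        f B l.val (leftStep ζ (BInfData.deg z) (wordOp z) A B e.val)) +
      z.sumSplits fun z₁ z₂ => x.sumCuts fun B l e => koszulSign k (BInfData.deg z₂ * l.length) •
        f B (leftStep ζ (BInfData.deg z₁) (wordOp z₁) B C l.val) (wordOp z₂ A B e.val)
    induction x with
    | nil =>
      have h := hC f (Path.nil : Path A A)
      simp only [Path.sumCuts, Path.val_nil, leftStep_nil, Path.length, Nat.cast_zero, mul_zero,
        koszulSign.zero, one_smul] at h ⊢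
      exact h
    | @cons B C x u a ihx =>
      have h := hC f (x.cons u a)
      have hx := ihx fun D => f D ∘ₗ cons (TotalHom.of u a)
      simp only [Path.sumCuts, Path.val_nil, leftStep_nil, Path.length, Nat.cast_zero, mul_zero,
        koszulSign.zero, one_smul, Path.val_cons, leftStep_cons, List.sumSplits_add, map_add,
        map_smul, sumCuts_cons, LinearMap.add_apply, LinearMap.smul_apply, smul_add,
        Path.sumCuts_add, smul_smul, LinearMap.comp_apply] at h hx ⊢
      rw [h, hx]
      simp only [smul_add, List.smul_sumSplits, Path.smul_sumCuts, smul_smul]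
      have e₁ : ∀ n : ℕ, koszulSign k (ζ.1 - 1 + BInfData.deg z) *
          koszulSign k (BInfData.deg (ζ :: z) * n) =
          koszulSign k (BInfData.deg (ζ :: z) * ((n + 1 : ℕ) : ℤ)) := fun n =>
        koszulSign.mul_congr 0 (by rw [BInfData.deg_cons]; push_cast; ring)
      have e₂ : (z.sumSplits fun z₁ z₂ => x.sumCuts fun D l e =>
          (koszulSign k (ζ.1 - 1 + BInfData.deg z) * koszulSign k (BInfData.deg z₂ * l.length)) •
            f D (cons (TotalHom.of u a) (leftStep ζ (BInfData.deg z₁) (wordOp z₁) D B l.val))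
              (wordOp z₂ A D e.val)) = z.sumSplits fun z₁ z₂ => x.sumCuts fun D l e =>
          (koszulSign k (BInfData.deg z₂ * ((l.length + 1 : ℕ) : ℤ)) *
              koszulSign k (ζ.1 - 1 + BInfData.deg z₁)) •
            f D (cons (TotalHom.of u a) (leftStep ζ (BInfData.deg z₁) (wordOp z₁) D B l.val))
              (wordOp z₂ A D e.val) := by
        refine List.sumSplits_congr _ fun z₁ z₂ hz => Path.sumCuts_congr _ fun D l e _ => ?_
        rw [← koszulSign.add, ← koszulSign.add, koszulSign.congr 0]
        rw [← hz, BInfData.deg_append]; push_cast; ring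
      simp only [e₁, e₂, one_mul]
      ac_rfl

end MapGr

/-! ### The coalgebra map `mul` by recursion on its first block. -/

namespace BInfData

variable {k : Type u} [CommRing k] {E : BInfData k}

lemma tens_nil : tens ([] : E.Word) = 1 := rfl

lemma tens_cons (v : Σ n : ℤ, E.V n) (x : E.Word) : tens (v :: x) = tens [v] * tens x := by
  simp [tens]

lemma tens_singleton (v : Σ n : ℤ, E.V n) : tens [v] = single v.1 v.2 := by
  simp [tens]

lemma tens_singleton_eq_zero (v : Σ n : ℤ, E.V n) (h : v.2 = 0) : tens [v] = 0 := by
  rw [tens_singleton, h]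
  simp [single]

/-- The part of `T(sV)` of a given degree. -/
noncomputable def degreePart (E : BInfData k) (d : ℤ) : Submodule k (TensorCoalgebra E.V) :=
  Submodule.span k {t | ∃ x : E.Word, deg x = d ∧ tens x = t}

lemma tens_mem_degreePart (x : E.Word) : tens x ∈ degreePart E (deg x) :=
  Submodule.subset_span ⟨x, rfl, rfl⟩

lemma tens_mul_mem_degreePart (v : Σ n : ℤ, E.V n) {d d' : ℤ} (h : v.1 - 1 + d = d')
    {t : TensorCoalgebra E.V} (ht : t ∈ degreePart E d) : tens [v] * t ∈ degreePart E d' := by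
  induction ht using Submodule.span_induction with
  | zero => simp
  | add x y _ _ hx hy => rw [mul_add]; exact add_mem hx hy
  | smul c x _ hx => rw [mul_smul_comm]; exact Submodule.smul_mem _ _ hx
  | mem x hx =>
    obtain ⟨x, rfl, rfl⟩ := hx
    exact Submodule.subset_span ⟨v :: x, by rw [deg_cons, ← h], tens_cons _ _⟩

lemma sumSplits_mem {α M : Type*} [AddCommGroup M] [Module k M] (S : Submodule k M)
    {F : List α → List α → M} (l : List α) (h : ∀ p q, p ++ q = l → F p q ∈ S) :
    l.sumSplits F ∈ S := by
  induction l generalizing F with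
  | nil => exact h _ _ rfl
  | cons a l ih => exact add_mem (h _ _ rfl) (ih fun p q hl => h _ _ (by simp [hl]))

/-- The component of the multiplication applied to two words, as a letter. -/
noncomputable def mulLetter (x y : E.Word) : Σ n : ℤ, E.V n :=
  ⟨deg x + deg y + 1, E.m (deg x + deg y + 1) (tens x) (tens y)⟩

lemma blocks_succ (r : ℕ) (x y : E.Word) : blocks (r + 1) x y =
    x.sumSplits fun x₁ x₂ => y.sumSplits fun y₁ y₂ => koszulSign k (deg x₂ * deg y₁) •
      (tens [mulLetter x₁ y₁] * blocks r x₂ y₂) := by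
  simp only [← koszulSign.smul_eq, ← List.sum_range_take_drop, tens_singleton]
  rfl

lemma blocks_mem_degreePart (r : ℕ) (x y : E.Word) :
    blocks r x y ∈ degreePart E (deg x + deg y) := by
  induction r generalizing x y with
  | zero =>
    rw [blocks]
    split_ifs with h
    · obtain rfl : x = [] := List.length_eq_zero_iff.1 (by omega)
      obtain rfl : y = [] := List.length_eq_zero_iff.1 (by omega)
      exact tens_mem_degreePart []
    · exact zero_mem _
  | succ r ih =>
    rw [blocks_succ]
    refine sumSplits_mem _ _ fun x₁ x₂ hx => sumSplits_mem _ _ fun y₁ y₂ hy =>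
      Submodule.smul_mem _ _ (tens_mul_mem_degreePart _ ?_ (ih x₂ y₂))
    rw [← hx, ← hy, deg_append, deg_append]
    simp only [mulLetter]; ring

lemma mul_mem_degreePart (x y : E.Word) : mul x y ∈ degreePart E (deg x + deg y) :=
  Submodule.sum_mem _ fun r _ => blocks_mem_degreePart r x y

section unital

variable (h₁ : ∀ t, E.m t 1 1 = 0)
include h₁

/-- As `m (1, 1) = 0`, every block uses at least one letter, so there are at most as many blocks as
letters. -/
lemma blocks_eq_zero (r : ℕ) (x y : E.Word) (hr : x.length + y.length < r) :
    blocks r x y = 0 := by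
  induction r generalizing x y with
  | zero => omega
  | succ r ih =>
    rw [blocks_succ, List.sumSplits_congr (G := fun _ _ => 0) _ fun x₁ x₂ hx => ?_,
      List.sumSplits_zero]
    rw [List.sumSplits_congr (G := fun _ _ => 0) _ fun y₁ y₂ hy => ?_, List.sumSplits_zero]
    subst hx hy
    by_cases h : x₁.length + y₁.length = 0
    · obtain rfl : x₁ = [] := List.length_eq_zero_iff.1 (by omega)
      obtain rfl : y₁ = [] := List.length_eq_zero_iff.1 (by omega)
      simp [tens_singleton_eq_zero (mulLetter ([] : E.Word) []) (h₁ _)]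
    · rw [ih _ _ (by simp only [List.length_append] at hr; omega), mul_zero, smul_zero]

lemma sum_blocks (N : ℕ) (x y : E.Word) (hN : x.length + y.length < N) :
    ∑ r ∈ Finset.range N, blocks r x y = mul x y := by
  refine (Finset.sum_subset (Finset.range_subset_range.2 hN) fun r _ hr => ?_).symm
  exact blocks_eq_zero h₁ r x y (by simpa using hr)

/-- The factorizations are sorted by their first pair `(x₁, y₁)`; the conditional term accounts for
the factorization without any blocks. -/
lemma mul_eq_sumSplits (x y : E.Word) : mul x y = (if x.length + y.length = 0 then 1 else 0) +
    x.sumSplits fun x₁ x₂ => y.sumSplits fun y₁ y₂ => koszulSign k (deg x₂ * deg y₁) •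
      (tens [mulLetter x₁ y₁] * mul x₂ y₂) := by
  rw [mul, Finset.sum_range_succ', add_comm, blocks]
  refine congrArg _ ?_
  simp only [blocks_succ]
  have hs : ∀ {α : Type u} (l : List α) (s : Finset ℕ) (F : ℕ → List α → List α →
      TensorCoalgebra E.V), ∑ r ∈ s, l.sumSplits (F r) =
      l.sumSplits fun p q => ∑ r ∈ s, F r p q := by
    intro α l s F
    induction s using Finset.induction_on with
    | empty => simp [List.sumSplits_zero]
    | insert a s ha ih => simp only [Finset.sum_insert ha, ih, List.sumSplits_add]
  rw [hs]
  refine List.sumSplits_congr _ fun x₁ x₂ hx => ?_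
  rw [hs]
  refine List.sumSplits_congr _ fun y₁ y₂ hy => ?_
  rw [← Finset.smul_sum, ← Finset.mul_sum]
  subst hx hy
  -- An empty first pair contributes zero. Otherwise the remaining words are shorter in total, and
  -- the range of the sum is long enough to give their full product.
  by_cases h : x₁.length + y₁.length = 0
  · obtain rfl : x₁ = [] := List.length_eq_zero_iff.1 (by omega)
    obtain rfl : y₁ = [] := List.length_eq_zero_iff.1 (by omega)
    simp [tens_singleton_eq_zero (mulLetter ([] : E.Word) []) (h₁ _)]
  · rw [sum_blocks h₁]
    simp only [List.length_append]; omega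

end unital

end BInfData

namespace MapGr

variable {k : Type u} [CommRing k] {X : MapGr k}

open PathTensor BInfData

/-! ### The product on the tensor coalgebra of the Hochschild complex, and its action. -/

lemma ιInv_tens_singleton (φ : Σ n : ℤ, (hochschild X).V n) :
    TensorAlgebra.ιInv (tens [φ]) = homogeneous φ := by
  rw [tens_singleton]; exact TensorAlgebra.ι_leftInverse _

lemma ιInv_one : TensorAlgebra.ιInv (1 : TensorCoalgebra (hochschild X).V) = 0 := by
  rw [← map_one (algebraMap k _), ιInv_algebraMap]

lemma algebraMapInv_tens_singleton (φ : Σ n : ℤ, (hochschild X).V n) :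
    TensorAlgebra.algebraMapInv (R := k) (tens [φ]) = 0 := by
  simp [tens, single, TensorAlgebra.algebraMapInv]

lemma algebraMapInv_tens_mul (φ : Σ n : ℤ, (hochschild X).V n)
    (t : TensorCoalgebra (hochschild X).V) :
    TensorAlgebra.algebraMapInv (R := k) (tens [φ] * t) = 0 := by
  rw [map_mul, algebraMapInv_tens_singleton, zero_mul]

lemma ιInv_tens_mul (φ : Σ n : ℤ, (hochschild X).V n)
    (t : TensorCoalgebra (hochschild X).V) : TensorAlgebra.ιInv (tens [φ] * t) =
      TensorAlgebra.algebraMapInv (R := k) t • TensorAlgebra.ιInv (tens [φ]) := by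
  rw [ιInv_mul, algebraMapInv_tens_singleton, zero_smul, zero_add]

/-- The brace operations on the graded module underlying the `B∞`-algebra. -/
noncomputable def braceLinear (t : ℤ) : TotalModule (hochschild X).V →ₗ[k]
    TensorCoalgebra (hochschild X).V →ₗ[k] (hochschild X).V t :=
  brace (X := X) t

lemma m_apply (t : ℤ) (x y : TensorCoalgebra (hochschild X).V) : (hochschild X).m t x y =
    braceLinear t (TensorAlgebra.ιInv x) y + TensorAlgebra.algebraMapInv (R := k) x •
      DirectSum.component k ℤ (fun n => (hochschild X).V n) t (TensorAlgebra.ιInv y) := rfl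

lemma m_one_left (t : ℤ) (x : TensorCoalgebra (hochschild X).V) : (hochschild X).m t 1 x =
    DirectSum.component k ℤ (fun n => (hochschild X).V n) t (TensorAlgebra.ιInv x) := by
  rw [m_apply, ιInv_one, map_one, one_smul, map_zero, LinearMap.zero_apply, zero_add]

lemma m_one_one (t : ℤ) : (hochschild X).m t 1 1 = 0 := by
  rw [m_one_left, ιInv_one, map_zero]

lemma m_singleton (t : ℤ) (φ : Σ n : ℤ, (hochschild X).V n)
    (y : TensorCoalgebra (hochschild X).V) :
    (hochschild X).m t (tens [φ]) y = brace t (homogeneous φ) y := by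
  rw [m_apply, ιInv_tens_singleton, algebraMapInv_tens_singleton, zero_smul, add_zero]
  rfl

lemma m_eq_zero (t : ℤ) {x : TensorCoalgebra (hochschild X).V} (h₁ : TensorAlgebra.ιInv x = 0)
    (h₂ : TensorAlgebra.algebraMapInv (R := k) x = 0) (y : TensorCoalgebra (hochschild X).V) :
    (hochschild X).m t x y = 0 := by
  rw [m_apply, h₁, h₂, zero_smul, map_zero, LinearMap.zero_apply, zero_add]

/-- The component `m` depends only on the parts of its first argument in tensor degrees zero and
one. -/
lemma m_cons_cons (t : ℤ) (φ φ' : Σ n : ℤ, (hochschild X).V n) (x : (hochschild X).Word)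
    (y : TensorCoalgebra (hochschild X).V) : (hochschild X).m t (tens (φ :: φ' :: x)) y = 0 := by
  refine m_eq_zero t ?_ ?_ y
  · rw [tens_cons, ιInv_tens_mul, tens_cons, algebraMapInv_tens_mul]
    exact zero_smul k _
  · rw [tens_cons, algebraMapInv_tens_mul]

lemma component_homogeneous_self (φ : Σ n : ℤ, (hochschild X).V n) :
    DirectSum.component k ℤ (fun n => (hochschild X).V n) φ.1 (homogeneous φ) = φ.2 :=
  DirectSum.of_eq_same (β := fun n => X.cochain n) _ _

lemma component_homogeneous_of_ne (φ : Σ n : ℤ, (hochschild X).V n) {t : ℤ} (h : t ≠ φ.1) :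
    DirectSum.component k ℤ (fun n => (hochschild X).V n) t (homogeneous φ) = 0 :=
  DirectSum.of_eq_of_ne (β := fun n => X.cochain n) _ _ _ h

lemma mulLetter_nil_singleton (φ : Σ n : ℤ, (hochschild X).V n) : mulLetter [] [φ] = φ := by
  have h : deg ([] : (hochschild X).Word) + deg [φ] + 1 = φ.1 := by
    rw [deg_cons]; simp
  -- The degree of the letter is an expression which is only provably `φ.1`; as a variable it can be
  -- substituted in the dependent pair.
  have h' : ∀ t, t = φ.1 → (⟨t, (hochschild X).m t (tens []) (tens [φ])⟩ :
      Σ n : ℤ, (hochschild X).V n) = φ := by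
    rintro t rfl
    refine Sigma.ext rfl (heq_of_eq ?_)
    refine (m_one_left _ _).trans ?_
    rw [ιInv_tens_singleton]
    exact component_homogeneous_self φ
  exact h' _ h

lemma mulLetter_nil_cons_cons (φ φ' : Σ n : ℤ, (hochschild X).V n) (x : (hochschild X).Word) :
    tens [mulLetter [] (φ :: φ' :: x)] = 0 := by
  refine tens_singleton_eq_zero _ ((m_one_left _ _).trans ?_)
  rw [tens_cons, ιInv_tens_mul, tens_cons, algebraMapInv_tens_mul]
  exact (congrArg _ (zero_smul k _)).trans (map_zero _)

lemma mulLetter_nil_nil : tens [mulLetter ([] : (hochschild X).Word) []] = 0 :=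
  tens_singleton_eq_zero _ (m_one_one _)

lemma mulLetter_cons_cons (φ φ' : Σ n : ℤ, (hochschild X).V n) (x y : (hochschild X).Word) :
    tens [mulLetter (φ :: φ' :: x) y] = 0 :=
  tens_singleton_eq_zero _ (m_cons_cons _ _ _ _ _)

/-- The part of the product of two words which starts with a letter of the second one. -/
noncomputable def mulHead (x : (hochschild X).Word) :
    (hochschild X).Word → TensorCoalgebra (hochschild X).V
  | [] => 0
  | ζ :: z => koszulSign k ((ζ.1 - 1) * deg x) • (tens [ζ] * mul x z)

/-- Since `m (1, -)` is the projection to `sC`, only the split whose first part is a single letter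
survives. -/
lemma sumSplits_mulLetter_nil (x z : (hochschild X).Word) :
    (z.sumSplits fun z₁ z₂ => koszulSign k (deg x * deg z₁) •
      (tens [mulLetter [] z₁] * mul x z₂)) = mulHead x z := by
  match z with
  | [] => simp [List.sumSplits, mulLetter_nil_nil, mulHead]
  | [ζ] =>
    simp [List.sumSplits, mulLetter_nil_nil, mulHead, mulLetter_nil_singleton,
      deg_cons, mul_comm]
  | ζ :: ζ' :: z =>
    simp [List.sumSplits, mulLetter_nil_nil, mulHead, mulLetter_nil_singleton,
      mulLetter_nil_cons_cons, deg_cons, mul_comm, List.sumSplits_zero]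

lemma nil_mul (z : (hochschild X).Word) : mul [] z = tens z := by
  rw [mul_eq_sumSplits m_one_one, List.sumSplits, sumSplits_mulLetter_nil]
  induction z with
  | nil => simp [mulHead, tens_nil]
  | cons ζ z ih =>
    rw [mulHead, mul_eq_sumSplits m_one_one, List.sumSplits, sumSplits_mulLetter_nil, ih,
      tens_cons ζ z]
    simp

/-- A first block without letters of the first word is a letter of `z`, a first block with the
letter `φ` alone is a brace of `φ`, and blocks with more letters of the first word vanish. -/
lemma cons_mul (φ : Σ n : ℤ, (hochschild X).V n) (y z : (hochschild X).Word) :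
    mul (φ :: y) z = mulHead (φ :: y) z + z.sumSplits fun z₁ z₂ => koszulSign k (deg y * deg z₁) •
      (tens [mulLetter [φ] z₁] * mul y z₂) := by
  rw [mul_eq_sumSplits m_one_one, List.sumSplits, sumSplits_mulLetter_nil, if_neg (by simp),
    zero_add]
  refine congrArg _ ?_
  cases y with
  | nil => rfl
  | cons φ' y =>
    rw [List.sumSplits]
    simp [mulLetter_cons_cons, List.sumSplits_zero]


open PathTensor BInfData

/-- The action of `T(sC)` on tensors over strings, as a linear map on the tensor coalgebra of the
`B∞`-algebra. -/
noncomputable def actLinear : TensorCoalgebra (hochschild X).V →ₗ[k] X.PathOp := actOp (X := X)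

lemma actLinear_tens (y : (hochschild X).Word) : actLinear (tens y) = wordOp y := actOp_tens y

/-- This is the definition of `brace`, transferred from bar constructions with a fixed composite to
the sum over all strings. -/
lemma value_brace (t : ℤ) (φ : X.Cochains) (y : TensorCoalgebra (hochschild X).V) {A B : X.Pt}
    (x : Path A B) (hx : (x.length : ℤ) = t) :
    value (homogeneous ⟨t, brace t φ y⟩) x.val = value φ (actLinear y A B x.val) := by
  subst hx
  have h : actLinear y A B x.val =
      Bar.toPathTensor (act y A B x.str.total (Bar.of x.str rfl x.ten)) := actOp_of _ _ _
  rw [h, value_toPathTensor, Path.val, value_of]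
  refine congrArg _ ?_
  rw [eval_eq x.str _ (congrArg Nat.cast (Path.length_str x))]
  exact DFunLike.congr_fun (congrFun
    (component_homogeneous_self ⟨(x.length : ℤ), brace _ φ y⟩)
    (⟨A, B, x.str, congrArg Nat.cast (Path.length_str x)⟩ : X.Simplex x.length)) x.ten

/-- No condition on the length is needed: outside the degree of the brace both sides vanish, the
right one because `z` lowers lengths by `deg z`. -/
lemma value_mulLetter (φ : Σ n : ℤ, (hochschild X).V n) (z : (hochschild X).Word) {A B : X.Pt}
    (x : Path A B) : value (homogeneous (mulLetter [φ] z)) x.val =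
      value (homogeneous φ) (wordOp z A B x.val) := by
  have hd : (mulLetter [φ] z).1 = φ.1 + deg z := by
    simp only [mulLetter, deg_cons, deg_nil]; ring
  by_cases h : (x.length : ℤ) = (mulLetter [φ] z).1
  · have e : mulLetter [φ] z = ⟨(mulLetter [φ] z).1,
        brace (mulLetter [φ] z).1 (homogeneous φ) (tens z)⟩ :=
      Sigma.ext rfl (heq_of_eq (m_singleton _ _ _))
    rw [e]
    rw [value_brace _ _ _ x h, actLinear_tens]
  · rw [value_homogeneous_of_ne _ _ h, value_eq_zero_of_mem_lengthPart _ _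
      (wordOp_mem_lengthPart z x)]
    intro h'
    exact h (by rw [hd, ← h']; ring)

lemma consOp_add (ψ : Σ n : ℤ, (hochschild X).V n) (d : ℤ) (g g' : X.PathOp) :
    consOp ψ d (g + g') = consOp ψ d g + consOp ψ d g' := by
  funext A C
  refine PathTensor.hom_ext fun x => ?_
  simp only [Pi.add_apply, LinearMap.add_apply, consOp_val, map_add, smul_add, Path.sumCuts_add]

lemma consOp_smul (ψ : Σ n : ℤ, (hochschild X).V n) (d : ℤ) (c : k) (g : X.PathOp) :
    consOp ψ d (c • g) = c • consOp ψ d g := by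
  funext A C
  refine PathTensor.hom_ext fun x => ?_
  simp only [Pi.smul_apply, LinearMap.smul_apply, consOp_val, map_smul, Path.smul_sumCuts,
    smul_comm c]

lemma leftStep_add (ψ : Σ n : ℤ, (hochschild X).V n) (d : ℤ) (g g' : X.PathOp) :
    leftStep ψ d (g + g') = leftStep ψ d g + leftStep ψ d g' := by
  funext A C
  refine PathTensor.hom_ext fun x => ?_
  simp only [leftStep_val, consOp_add, Pi.add_apply, LinearMap.add_apply, map_add, smul_add,
    Path.sumCuts_add]

lemma leftStep_smul (ψ : Σ n : ℤ, (hochschild X).V n) (d : ℤ) (c : k) (g : X.PathOp) :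
    leftStep ψ d (c • g) = c • leftStep ψ d g := by
  funext A C
  refine PathTensor.hom_ext fun x => ?_
  simp only [leftStep_val, consOp_smul, Pi.smul_apply, LinearMap.smul_apply, map_smul,
    Path.smul_sumCuts, smul_comm c]

/-- The sign in `leftStep` depends on the degree of the operator, so the formula extends from words
only to homogeneous elements. -/
lemma actLinear_tens_mul (ψ : Σ n : ℤ, (hochschild X).V n) {d : ℤ}
    {t : TensorCoalgebra (hochschild X).V} (ht : t ∈ degreePart (hochschild X) d) :
    actLinear (tens [ψ] * t) = leftStep ψ d (actLinear t) := by
  induction ht using Submodule.span_induction with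
  | zero =>
    have h := leftStep_smul ψ d 0 (actLinear (0 : TensorCoalgebra (hochschild X).V))
    rw [zero_smul, zero_smul] at h
    rw [mul_zero, map_zero, h]
  | add x y _ _ hx hy => rw [mul_add, map_add, map_add, leftStep_add, hx, hy]
  | smul c x _ hx => rw [mul_smul_comm, map_smul, map_smul, leftStep_smul, hx]
  | mem x hx =>
    obtain ⟨x, rfl, rfl⟩ := hx
    rw [← tens_cons, actLinear_tens, actLinear_tens]
    rfl

lemma actLinear_mulHead_cons (x : (hochschild X).Word) (ζ : Σ n : ℤ, (hochschild X).V n)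
    (z : (hochschild X).Word) : actLinear (mulHead x (ζ :: z)) =
      koszulSign k ((ζ.1 - 1) * deg x) • leftStep ζ (deg x + deg z) (actLinear (mul x z)) := by
  rw [mulHead, map_smul, actLinear_tens_mul ζ (mul_mem_degreePart x z)]

section

variable (φ : Σ n : ℤ, (hochschild X).V n) (y : (hochschild X).Word)

/-- The part of the product of two words which starts with a brace of the first letter. -/
noncomputable def mulTail (z : (hochschild X).Word) : TensorCoalgebra (hochschild X).V :=
  z.sumSplits fun z₁ z₂ => koszulSign k (deg y * deg z₁) • (tens [mulLetter [φ] z₁] * mul y z₂)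

lemma actLinear_mulTail (z : (hochschild X).Word) : actLinear (mulTail φ y z) =
    z.sumSplits fun z₁ z₂ => koszulSign k (deg y * deg z₁) •
      leftStep (mulLetter [φ] z₁) (deg y + deg z₂) (actLinear (mul y z₂)) := by
  rw [mulTail, List.map_sumSplits]
  simp only [map_smul, actLinear_tens_mul _ (mul_mem_degreePart _ _)]

variable {φ y}

lemma sumSplits_apply (F : (hochschild X).Word → (hochschild X).Word → X.PathOp)
    (z : (hochschild X).Word) {A B : X.Pt} (x : PathTensor A B) :
    z.sumSplits F A B x = z.sumSplits fun z₁ z₂ => F z₁ z₂ A B x :=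
  List.map_sumSplits (LinearMap.applyₗ x ∘ₗ LinearMap.proj B ∘ₗ
    LinearMap.proj (φ := fun A => ∀ B, PathTensor A B →ₗ[k] PathTensor A B) A) F z

variable (hy : ∀ (z : (hochschild X).Word) {A C : X.Pt} (x : Path A C),
  wordOp y A C (wordOp z A C x.val) = actLinear (mul y z) A C x.val)
include hy

/-- Cutting the output of `z` into the arguments of `φ` and those of `y` splits `z` as `z₁ z₂` by
`sumCuts_wordOp`. Then `φ` after `z₁` is the letter `φ{z₁}`, and `y` after `z₂` is the action of
their product by `hy`. -/
lemma consOp_wordOp (z : (hochschild X).Word) {A C : X.Pt} (x : Path A C) :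
    consOp φ (deg y) (wordOp y) A C (wordOp z A C x.val) =
      z.sumSplits fun z₁ z₂ => koszulSign k (deg y * deg z₁) •
        consOp (mulLetter [φ] z₁) (deg y + deg z₂) (actLinear (mul y z₂)) A C x.val := by
  rw [consOp, sumCuts_wordOp]
  refine List.sumSplits_congr _ fun z₁ z₂ hz => ?_
  rw [consOp_val, Path.smul_sumCuts]
  refine Path.sumCuts_congr _ fun B l e _ => ?_
  simp only [LinearMap.smul_apply, LinearMap.compl₁₂_apply, hy, value_mulLetter, smul_smul]
  by_cases h : (l.length : ℤ) = (mulLetter [φ] z₁).1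
  · refine congrArg (· • _) ?_
    rw [← koszulSign.add, ← koszulSign.add]
    refine koszulSign.congr (-deg y * deg z₁) ?_
    rw [h]
    simp only [mulLetter, deg_cons, deg_nil]; ring
  · rw [← value_mulLetter, value_homogeneous_of_ne _ _ h]
    simp

lemma actLinear_mulTail_nil (z : (hochschild X).Word) (A : X.Pt) :
    actLinear (mulTail φ y z) A A (PathTensor.nil A) =
      consOp φ (deg y) (wordOp y) A A (wordOp z A A (PathTensor.nil A)) := by
  have h := consOp_wordOp (φ := φ) hy z (Path.nil : Path A A)
  rw [Path.val_nil] at h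
  rw [h, actLinear_mulTail, sumSplits_apply]
  simp only [Pi.smul_apply, LinearMap.smul_apply, leftStep_nil]

/-- All summands of `mulTail` have degree `deg (φ :: y) + deg z` and so pass the factor `a` with the
same sign; the terms beginning at the left end are collected by `consOp_wordOp`. -/
lemma actLinear_mulTail_cons (z : (hochschild X).Word) {A B C : X.Pt} (x : Path A B)
    (u : B.base ⟶ C.base) (a : X.hom u B.ob C.ob) :
    actLinear (mulTail φ y z) A C (x.cons u a).val =
      koszulSign k (deg (φ :: y) + deg z) •
        cons (TotalHom.of u a) (actLinear (mulTail φ y z) A B x.val) +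
      consOp φ (deg y) (wordOp y) A C (wordOp z A C (x.cons u a).val) := by
  rw [consOp_wordOp hy, actLinear_mulTail, sumSplits_apply, sumSplits_apply, List.map_sumSplits,
    List.smul_sumSplits, ← List.sumSplits_add]
  refine List.sumSplits_congr _ fun z₁ z₂ hz => ?_
  simp only [Pi.smul_apply, LinearMap.smul_apply, Path.val_cons, leftStep_cons, smul_add, map_smul]
  rw [smul_comm]
  refine congrArg (fun c => c • _ + _) (koszulSign.congr 0 ?_)
  rw [← hz, deg_append]
  simp only [mulLetter, deg_cons, deg_nil]; ring

omit hy

/-- The leftmost factor is a value of `ζ`. If `φ` acts further to the right, this value is left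
alone, which matches `mulHead`; otherwise the block of `φ` begins at the left end. -/
lemma leftStep_consOp (ζ : Σ n : ℤ, (hochschild X).V n) (z : (hochschild X).Word)
    (hz : ∀ {A C : X.Pt} (x : Path A C), wordOp (φ :: y) A C (wordOp z A C x.val) =
      actLinear (mul (φ :: y) z) A C x.val) {A C : X.Pt} (x : Path A C) :
    leftStep φ (deg y) (wordOp y) A C (consOp ζ (deg z) (wordOp z) A C x.val) =
      koszulSign k ((ζ.1 - 1) * deg (φ :: y)) • consOp ζ (deg (φ :: y) + deg z)
        (actLinear (mul (φ :: y) z)) A C x.val +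
      consOp φ (deg y) (wordOp y) A C (consOp ζ (deg z) (wordOp z) A C x.val) := by
  rw [consOp_val, consOp_val, Path.map_sumCuts, Path.map_sumCuts, Path.smul_sumCuts,
    ← Path.sumCuts_add]
  refine Path.sumCuts_congr _ fun B l e _ => ?_
  rw [map_smul, map_smul, leftStep_cons, smul_add, smul_smul, smul_smul]
  have h := hz e
  rw [wordOp] at h
  rw [h]
  refine congrArg (· + _) ?_
  by_cases hl : (l.length : ℤ) = ζ.1
  · refine congrArg (· • _) ?_
    rw [← koszulSign.add, ← koszulSign.add]
    refine koszulSign.congr (deg (φ :: y) * (1 - ζ.1)) ?_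
    rw [hl, deg_cons]; ring
  · rw [value_homogeneous_of_ne _ _ hl]
    simp

end

/-- The action of the product of two words is the composite of their actions. -/
lemma wordOp_wordOp (y z : (hochschild X).Word) {A C : X.Pt} (x : Path A C) :
    wordOp y A C (wordOp z A C x.val) = actLinear (mul y z) A C x.val := by
  induction y generalizing z A C with
  | nil => rw [nil_mul, actLinear_tens]; rfl
  | cons φ y hy =>
    induction z generalizing A C with
    | nil =>
      have hT : mul (φ :: y) [] = mulTail φ y [] := by rw [cons_mul, mulHead, zero_add]; rfl
      rw [hT]
      change leftStep φ (deg y) (wordOp y) A C x.val = _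
      induction x with
      | nil => rw [Path.val_nil, actLinear_mulTail_nil hy, leftStep_nil]; rfl
      | cons x u a ih =>
        rw [actLinear_mulTail_cons hy, ← ih, Path.val_cons, leftStep_cons, deg_cons, deg_nil,
          add_zero]
        rfl
    | cons ζ z hz =>
      have hT : mul (φ :: y) (ζ :: z) = mulHead (φ :: y) (ζ :: z) + mulTail φ y (ζ :: z) :=
        cons_mul _ _ _
      -- The two kinds of first letter of the product; the first kind corresponds to the first term
      -- of `leftStep_consOp`.
      have hH : actLinear (mul (φ :: y) (ζ :: z)) =
          koszulSign k ((ζ.1 - 1) * deg (φ :: y)) • leftStep ζ (deg (φ :: y) + deg z)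
            (actLinear (mul (φ :: y) z)) + actLinear (mulTail φ y (ζ :: z)) := by
        rw [hT, map_add, actLinear_mulHead_cons]
      have hS := fun {A C : X.Pt} (x : Path A C) => leftStep_consOp ζ z hz x
      induction x with
      | @nil =>
        have h := hS (Path.nil : Path A A)
        rw [hH, Pi.add_apply, Pi.add_apply, LinearMap.add_apply, Path.val_nil,
          actLinear_mulTail_nil hy]
        simp only [Pi.smul_apply, LinearMap.smul_apply, wordOp, leftStep_nil, Path.val_nil] at h ⊢
        exact h
      | cons x u a ih =>
        -- If `a` is kept by both operators, the induction hypothesis for `x` applies. The other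
        -- terms are those where `ζ` begins at the left end, given by `h`, and those where `a` is
        -- kept by `ζ z` and the block of `φ` begins at the left end, contained in `hC`.
        have h := hS (x.cons u a)
        have hC := actLinear_mulTail_cons (φ := φ) hy (ζ :: z) x u a
        rw [hH] at ih ⊢
        simp only [Pi.add_apply, LinearMap.add_apply, Pi.smul_apply, LinearMap.smul_apply] at ih ⊢
        rw [hC]
        simp only [wordOp, Path.val_cons, leftStep_cons, map_add, map_smul, smul_add] at ih h ⊢
        rw [ih, h]
        have e₁ : koszulSign k (ζ.1 - 1 + (deg (φ :: y) + deg z)) =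
            koszulSign k (ζ.1 - 1 + deg z) * koszulSign k (φ.1 - 1 + deg y) := by
          rw [← koszulSign.add, deg_cons]
          exact koszulSign.congr 0 (by ring)
        have e₂ : koszulSign k (deg (φ :: y) + deg (ζ :: z)) =
            koszulSign k (ζ.1 - 1 + deg z) * koszulSign k (φ.1 - 1 + deg y) := by
          rw [← koszulSign.add, deg_cons, deg_cons]
          exact koszulSign.congr 0 (by ring)
        rw [e₁, e₂]
        simp only [map_add, map_smul]
        module

end MapGr

/-! ### The differential as a graded commutator, and the axioms of a `B∞`-algebra. -/

namespace BInfData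

variable {k : Type u} [CommRing k] {E : BInfData k}

/-- The component of the differential applied to a word, as a letter. -/
noncomputable def bLetter (x : E.Word) : Σ n : ℤ, E.V n :=
  ⟨deg x + 2, E.b (deg x + 2) (tens x)⟩

lemma d_eq_sumSplits (x : E.Word) : d x = x.sumSplits fun x₁ y => y.sumSplits fun x₂ x₃ =>
    koszulSign k (deg x₁) • (tens x₁ * tens [bLetter x₂] * tens x₃) := by
  simp only [← koszulSign.smul_eq, ← List.sum_range_take_drop, tens_singleton, List.length_drop]
  rfl

/-- Either nothing stands to the left of the factor with `b`, or `v` does. -/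
lemma d_cons (v : Σ n : ℤ, E.V n) (x : E.Word) : d (v :: x) =
    ((v :: x).sumSplits fun x₁ x₂ => tens [bLetter x₁] * tens x₂) +
      koszulSign k (v.1 - 1) • (tens [v] * d x) := by
  rw [d_eq_sumSplits, d_eq_sumSplits]
  conv_lhs => rw [List.sumSplits]
  refine congrArg₂ (· + ·) ?_ ?_
  · simp [tens_nil]
  · have h : ∀ t : TensorCoalgebra E.V, koszulSign k (v.1 - 1) • (tens [v] * t) =
      (koszulSign k (v.1 - 1) • LinearMap.mulLeft k (tens [v])) t := fun _ => rfl
    rw [h, List.map_sumSplits]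
    refine List.sumSplits_congr _ fun p q _ => ?_
    rw [List.map_sumSplits]
    refine List.sumSplits_congr _ fun p' q' _ => ?_
    rw [← h, deg_cons, tens_cons, koszulSign.add, mul_smul, mul_smul_comm]
    simp only [mul_assoc]

lemma tensorMap_tens {f : ∀ n, E.V n →ₗ[k] E.V n}
    (hf : ∀ n v, f n v = koszulSign k (n - 1) • v) (x : E.Word) :
    tensorMap f (tens x) = koszulSign k (deg x) • tens x := by
  induction x with
  | nil => simp [tens_nil, tensorMap]
  | cons v x ih =>
    have h₁ : tensorMap f (tens [v] * tens x) = tensorMap f (tens [v]) * tensorMap f (tens x) := by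
      simp [tensorMap]
    have h₂ : tensorMap f (tens [v]) = koszulSign k (v.1 - 1) • tens [v] := by
      rw [tens_singleton]
      simp [tensorMap, single, hf]
    rw [tens_cons, h₁, h₂, ih, deg_cons, koszulSign.add, smul_mul_smul_comm]

lemma tensorMap_of_mem_degreePart {f : ∀ n, E.V n →ₗ[k] E.V n}
    (hf : ∀ n v, f n v = koszulSign k (n - 1) • v) {d : ℤ} {x : TensorCoalgebra E.V}
    (hx : x ∈ degreePart E d) : tensorMap f x = koszulSign k d • x := by
  induction hx using Submodule.span_induction with
  | zero => rw [map_zero, smul_zero]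
  | add x y _ _ hx hy => rw [map_add, smul_add, hx, hy]
  | smul c x _ hx => rw [map_smul, hx, smul_comm]
  | mem x hx =>
    obtain ⟨x, rfl, rfl⟩ := hx
    exact tensorMap_tens hf x

end BInfData

namespace MapGr

variable {k : Type u} [CommRing k] {X : MapGr k}

open PathTensor BInfData

lemma value_zero (t : ℤ) {A B : X.Pt} (x : Path A B) :
    value (homogeneous ⟨t, (0 : X.cochain t)⟩) x.val = 0 := by
  have h : homogeneous ⟨t, (0 : X.cochain t)⟩ = 0 := map_zero _
  rw [h, Path.val, value_of, map_zero, LinearMap.zero_apply, map_zero]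

lemma m_deg (x y : (hochschild X).Word) (t : ℤ) (h : t ≠ deg x + deg y + 1) :
    (hochschild X).m t (tens x) (tens y) = 0 := by
  match x with
  | [] =>
    refine (m_one_left _ _).trans ?_
    match y with
    | [] => exact (congrArg _ ιInv_one).trans (map_zero _)
    | [ζ] =>
      rw [ιInv_tens_singleton]
      refine component_homogeneous_of_ne ζ fun h' => h ?_
      rw [h', deg_cons]; simp
    | ζ :: ζ' :: z =>
      rw [tens_cons, ιInv_tens_mul, tens_cons, algebraMapInv_tens_mul]
      exact (congrArg _ (zero_smul k _)).trans (map_zero _)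
  | [φ] =>
    refine (m_singleton _ _ _).trans (homogeneous_injective fun A B x hx => ?_)
    refine (value_brace _ _ _ x hx).trans (Eq.trans ?_ (value_zero t x).symm)
    rw [actLinear_tens]
    refine value_eq_zero_of_mem_lengthPart _ (fun h' => h ?_) (wordOp_mem_lengthPart y x)
    rw [deg_cons, ← h', hx, deg_nil]; ring
  | φ :: φ' :: x => exact m_cons_cons _ _ _ _ _

lemma brace_one (t : ℤ) (φ : X.Cochains) :
    brace t φ 1 = DirectSum.component k ℤ (fun n => X.cochain n) t φ := by
  refine homogeneous_injective (n := t) fun A B x hx => ?_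
  refine (value_brace _ _ (tens []) x hx).trans ?_
  rw [actLinear_tens, wordOp, LinearMap.id_apply, Path.val, value_of, value_of]
  have e : (x.str.length : ℤ) = t := by rw [Path.length_str, hx]
  rw [eval_eq _ _ e, eval_eq _ _ e]
  have h := component_homogeneous_self ⟨t, DirectSum.component k ℤ (fun n => X.cochain n) t φ⟩
  exact congrArg _ (DFunLike.congr_fun (congrFun h.symm (⟨A, B, x.str, e⟩ : X.Simplex t)) x.ten)

lemma m_one_right (t : ℤ) (x : TensorCoalgebra (hochschild X).V) : (hochschild X).m t x 1 =
    DirectSum.component k ℤ (fun n => (hochschild X).V n) t (TensorAlgebra.ιInv x) := by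
  rw [m_apply, ιInv_one, map_zero, smul_zero, add_zero]
  exact brace_one t _

lemma mulLetter_singleton_nil (φ : Σ n : ℤ, (hochschild X).V n) : mulLetter [φ] [] = φ := by
  have h : deg [φ] + deg ([] : (hochschild X).Word) + 1 = φ.1 := by
    rw [deg_cons]; simp
  have h' : ∀ t, t = φ.1 → (⟨t, (hochschild X).m t (tens [φ]) (tens [])⟩ :
      Σ n : ℤ, (hochschild X).V n) = φ := by
    rintro t rfl
    refine Sigma.ext rfl (heq_of_eq ?_)
    refine (m_one_right _ _).trans ?_
    rw [ιInv_tens_singleton]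
    exact component_homogeneous_self φ
  exact h' _ h

lemma mul_nil (x : (hochschild X).Word) : mul x [] = tens x := by
  induction x with
  | nil => exact nil_mul []
  | cons φ x ih =>
    rw [cons_mul, mulHead, List.sumSplits, mulLetter_singleton_nil, ih, tens_cons φ x]
    simp

lemma algebraMapInv_mulHead (x z : (hochschild X).Word) :
    TensorAlgebra.algebraMapInv (R := k) (mulHead x z) = 0 := by
  cases z with
  | nil => exact map_zero _
  | cons ζ z => rw [mulHead, map_smul, algebraMapInv_tens_mul, smul_zero]

lemma algebraMapInv_cons_mul (φ : Σ n : ℤ, (hochschild X).V n) (y z : (hochschild X).Word) :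
    TensorAlgebra.algebraMapInv (R := k) (mul (φ :: y) z) = 0 := by
  rw [cons_mul, map_add, algebraMapInv_mulHead, List.map_sumSplits, zero_add]
  simp only [map_smul, algebraMapInv_tens_mul, smul_zero, List.sumSplits_zero]

lemma algebraMapInv_tens_cons (φ : Σ n : ℤ, (hochschild X).V n) (y : (hochschild X).Word) :
    TensorAlgebra.algebraMapInv (R := k) (tens (φ :: y)) = 0 := by
  rw [tens_cons, algebraMapInv_tens_mul]

lemma ιInv_tens_cons_cons (φ φ' : Σ n : ℤ, (hochschild X).V n) (y : (hochschild X).Word) :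
    TensorAlgebra.ιInv (tens (φ :: φ' :: y)) = 0 := by
  rw [tens_cons, ιInv_tens_mul, algebraMapInv_tens_cons]
  exact zero_smul k _

/-- The coalgebra map `mul` has component `m`: whatever consists of two or more blocks projects to
zero in `sC`. -/
lemma ιInv_mul_words (y z : (hochschild X).Word) :
    TensorAlgebra.ιInv (mul y z) = TensorAlgebra.ιInv (tens [mulLetter y z]) := by
  cases y with
  | nil =>
    rw [nil_mul]
    match z with
    | [] => rw [mulLetter_nil_nil, map_zero]; exact ιInv_one
    | [ζ] => rw [mulLetter_nil_singleton]
    | ζ :: ζ' :: z => rw [mulLetter_nil_cons_cons, map_zero, ιInv_tens_cons_cons]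
  | cons φ y =>
    have hH : TensorAlgebra.ιInv (mulHead (φ :: y) z) = 0 := by
      cases z with
      | nil => exact map_zero _
      | cons ζ z =>
        rw [mulHead, map_smul, ιInv_tens_mul, algebraMapInv_cons_mul, zero_smul, smul_zero]
    rw [cons_mul, map_add, hH, zero_add, List.map_sumSplits]
    simp only [map_smul, ιInv_tens_mul]
    cases y with
    | nil =>
      rw [List.sumSplits_eq_last]
      · rw [nil_mul, tens_nil, map_one, one_smul, deg_nil, zero_mul, koszulSign.zero, one_smul]
      · intro p q _ hq
        obtain ⟨ζ, q, rfl⟩ := List.exists_cons_of_ne_nil hq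
        rw [nil_mul, algebraMapInv_tens_cons, zero_smul, smul_zero]
    | cons φ' y =>
      rw [mulLetter_cons_cons, map_zero]
      simp only [algebraMapInv_cons_mul, zero_smul, smul_zero, List.sumSplits_zero]

/-- For a single letter `φ` the two sides take the values `φ(y · (z · a))` and `φ((yz) · a)` on a
tensor `a`, which agree by `wordOp_wordOp`. For the empty word both are the component of the product
of `y` and `z`, and for longer words both vanish. -/
lemma m_assoc (x y z : (hochschild X).Word) (t : ℤ) :
    (hochschild X).m t (mul x y) (tens z) = (hochschild X).m t (tens x) (mul y z) := by
  match x with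
  | [] =>
    rw [nil_mul, tens_nil, m_one_left, ιInv_mul_words, ιInv_tens_singleton]
    by_cases h : t = deg y + deg z + 1
    · subst h
      exact (component_homogeneous_self (mulLetter y z)).symm
    · rw [m_deg y z t h]
      exact (component_homogeneous_of_ne (mulLetter y z) h).symm
  | [φ] =>
    rw [m_singleton, m_apply, algebraMapInv_cons_mul, ιInv_mul_words, ιInv_tens_singleton,
      zero_smul, add_zero]
    refine homogeneous_injective (n := t) fun A B x hx => ?_
    refine (value_brace _ _ _ x hx).trans ((Eq.trans ?_ (value_brace _ _ _ x hx).symm))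
    rw [← wordOp_wordOp, actLinear_tens]
    -- The result of the action of `z` is not a pure tensor, so `value_mulLetter` is first extended
    -- linearly.
    have h : value (homogeneous (mulLetter [φ] y)) ∘ₗ LinearMap.id =
        value (homogeneous φ) ∘ₗ wordOp y A B :=
      PathTensor.hom_ext fun x => value_mulLetter φ y x
    exact DFunLike.congr_fun h _
  | φ :: φ' :: x =>
    rw [m_cons_cons]
    refine m_eq_zero t ?_ (algebraMapInv_cons_mul _ _ _) _
    rw [ιInv_mul_words, mulLetter_cons_cons, map_zero]

variable (X) in
/-- The cochain given by the composition of `𝔞`, as a letter. -/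
noncomputable def muLetter : Σ n : ℤ, (hochschild X).V n := ⟨2, X.compCochain⟩

@[simp] lemma deg_muLetter : deg [muLetter X] = 1 := rfl

/-- On elements of degree `d` the map induced by `parity` is multiplication with `(-1)^d`. -/
lemma b_apply (t d : ℤ) {x : TensorCoalgebra (hochschild X).V}
    (hx : x ∈ degreePart (hochschild X) d) : (hochschild X).b t x =
      (hochschild X).m t (tens [muLetter X]) x -
        koszulSign k d • (hochschild X).m t x (tens [muLetter X]) := by
  have hμ : tens [muLetter X] = X.mu := by rw [tens_singleton]; rfl
  let f : ∀ n, (hochschild X).V n →ₗ[k] (hochschild X).V n := X.parity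
  have h : tensorMap f x = koszulSign k d • x :=
    tensorMap_of_mem_degreePart (fun n v => koszulSign.smul_eq (n - 1) v) hx
  have e : (hochschild X).b t x = (hochschild X).m t (tens [muLetter X]) x -
      (hochschild X).m t (tensorMap f x) (tens [muLetter X]) := by rw [hμ]; rfl
  rw [e, h, map_smul, LinearMap.smul_apply]

lemma d_mem_degreePart_of_eq {x : (hochschild X).Word} (h : d x = mul [muLetter X] x -
    koszulSign k (deg x) • mul x [muLetter X]) : d x ∈ degreePart (hochschild X) (deg x + 1) := by
  rw [h]
  refine sub_mem ?_ (Submodule.smul_mem _ _ ?_)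
  · rw [add_comm]; exact mul_mem_degreePart [muLetter X] x
  · exact mul_mem_degreePart x [muLetter X]

lemma tens_mk {n n' : ℤ} (h : n = n') (v : ∀ n, (hochschild X).V n) :
    tens [(⟨n, v n⟩ : Σ n, (hochschild X).V n)] = tens [⟨n', v n'⟩] := by
  rw [h]

lemma tens_bLetter (x : (hochschild X).Word) : tens [bLetter x] =
    tens [mulLetter [muLetter X] x] - koszulSign k (deg x) • tens [mulLetter x [muLetter X]] := by
  have h : ∀ t : ℤ, tens [(⟨t, (hochschild X).b t (tens x)⟩ : Σ n, (hochschild X).V n)] =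
      tens [⟨t, (hochschild X).m t (tens [muLetter X]) (tens x)⟩] -
        koszulSign k (deg x) • tens [⟨t, (hochschild X).m t (tens x) (tens [muLetter X])⟩] := by
    intro t
    simp only [tens_singleton, b_apply t (deg x) (tens_mem_degreePart x), single, map_sub, map_smul]
  rw [bLetter, h]
  refine congrArg₂ _ ?_ (congrArg _ ?_)
  · exact tens_mk (by rw [deg_muLetter]; ring) fun t =>
      (hochschild X).m t (tens [muLetter X]) (tens x)
  · exact tens_mk (by rw [deg_muLetter]; ring) fun t =>
      (hochschild X).m t (tens x) (tens [muLetter X])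

/-- The coderivation `d` is the graded commutator with `μ`. -/
lemma d_eq (x : (hochschild X).Word) : d x = mul [muLetter X] x -
    koszulSign k (deg x) • mul x [muLetter X] := by
  induction x with
  | nil =>
    rw [d_eq_sumSplits, nil_mul, mul_nil, List.sumSplits, List.sumSplits, tens_bLetter,
      mulLetter_nil_singleton, mulLetter_singleton_nil]
    simp
  | cons ξ x ih =>
    -- In the part of `b` with `μ` as second argument only initial segments with at most one letter
    -- contribute: the empty one gives `μ`, and `ξ` gives `ξ{μ}`.
    have h₁ : ((ξ :: x).sumSplits fun x₁ x₂ => tens [bLetter x₁] * tens x₂) =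
        ((ξ :: x).sumSplits fun x₁ x₂ => tens [mulLetter [muLetter X] x₁] * tens x₂) +
        (-1 : k) • (tens [muLetter X] * tens (ξ :: x) +
          koszulSign k (ξ.1 - 1) • (tens [mulLetter [ξ] [muLetter X]] * tens x)) := by
      simp only [tens_bLetter, sub_eq_add_neg, add_mul, List.sumSplits_add]
      refine congrArg _ ?_
      rw [List.sumSplits, mulLetter_nil_singleton, smul_add]
      refine congrArg₂ _ (by simp) ?_
      cases x with
      | nil => simp [List.sumSplits, deg_cons, sub_eq_add_neg]
      | cons ξ' x =>
        rw [List.sumSplits]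
        simp [List.sumSplits_zero, mulLetter_cons_cons, deg_cons, sub_eq_add_neg]
    have h₂ : mul [muLetter X] (ξ :: x) = koszulSign k (ξ.1 - 1) • (tens [ξ] * mul [muLetter X] x) +
        (ξ :: x).sumSplits fun x₁ x₂ => tens [mulLetter [muLetter X] x₁] * tens x₂ := by
      rw [cons_mul]
      simp only [mulHead, nil_mul, deg_nil, deg_muLetter, mul_one, zero_mul, koszulSign.zero,
        one_smul]
    have h₃ : mul (ξ :: x) [muLetter X] =
        koszulSign k (deg (ξ :: x)) • (tens [muLetter X] * tens (ξ :: x)) +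
        (tens [ξ] * mul x [muLetter X] +
          koszulSign k (deg x) • (tens [mulLetter [ξ] [muLetter X]] * tens x)) := by
      rw [cons_mul]
      simp only [mulHead, mul_nil, List.sumSplits, deg_nil, deg_muLetter, mul_zero, mul_one,
        koszulSign.zero, one_smul, mulLetter_singleton_nil]
      refine congrArg (fun c => c • _ + _) (koszulSign.congr 0 ?_)
      simp only [muLetter]; ring
    have s₁ : koszulSign k (deg (ξ :: x)) * koszulSign k (deg (ξ :: x)) = 1 :=
      (koszulSign.mul_congr (c := 0) (deg (ξ :: x)) (by ring)).trans koszulSign.zero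
    have s₂ : koszulSign k (deg (ξ :: x)) * koszulSign k (deg x) = koszulSign k (ξ.1 - 1) :=
      koszulSign.mul_congr (deg x) (by rw [deg_cons]; ring)
    have s₃ : koszulSign k (deg (ξ :: x)) = koszulSign k (ξ.1 - 1) * koszulSign k (deg x) := by
      rw [deg_cons, koszulSign.add]
    rw [d_cons, ih, h₁, h₂, h₃, mul_sub, mul_smul_comm]
    simp only [smul_add, smul_sub, smul_smul, s₁, s₂]
    rw [s₃]
    module

lemma b_one (t : ℤ) : (hochschild X).b t 1 = 0 := by
  rw [← tens_nil, b_apply t 0 (tens_mem_degreePart []), tens_nil, m_one_left, m_one_right,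
    koszulSign.zero, one_smul,
    sub_self]

lemma b_deg (x : (hochschild X).Word) (t : ℤ) (h : t ≠ deg x + 2) :
    (hochschild X).b t (tens x) = 0 := by
  have e : deg x + 2 = deg [muLetter X] + deg x + 1 := by rw [deg_muLetter]; ring
  have e' : deg x + 2 = deg x + deg [muLetter X] + 1 := by rw [deg_muLetter]; ring
  rw [b_apply t _ (tens_mem_degreePart x), m_deg _ _ _ (e ▸ h), m_deg _ _ _ (e' ▸ h), smul_zero,
    sub_zero]

lemma value_muLetter_of_ne {A B : X.Pt} (x : Path A B) (h : x.length ≠ 2) :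
    value (homogeneous (muLetter X)) x.val = 0 :=
  value_homogeneous_of_ne _ _ fun h' => h (by simp only [muLetter] at h'; omega)

lemma value_muLetter {A B C : X.Pt} (v : A.base ⟶ B.base) (b : X.hom v A.ob B.ob)
    (u : B.base ⟶ C.base) (a : X.hom u B.ob C.ob) :
    value (homogeneous (muLetter X)) ((Path.nil.cons v b).cons u a).val =
      TotalHom.comp (TotalHom.of u a) (TotalHom.of v b) := by
  rw [Path.val, value_of, eval_eq _ _ (n := 2) rfl,
    TotalHom.comp_of (w := ((Path.nil.cons v b).cons u a).str.total)
      (by simp [Path.str, Str.total])]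
  refine congrArg _ ?_
  refine (DFunLike.congr_fun (congrFun (component_homogeneous_self (muLetter X))
    (⟨A, C, ((Path.nil.cons v b).cons u a).str, rfl⟩ : X.Simplex 2)) _).trans ?_
  exact congrArg (X.comp _ a) (one_smul k b)

lemma value_muLetter_cons_cons {A B C : X.Pt} (b : TotalHom A B) (a : TotalHom B C) :
    value (homogeneous (muLetter X)) (cons a (cons b (PathTensor.nil A))) =
      TotalHom.comp a b := by
  suffices H : ((PathTensor.cons : TotalHom B C →ₗ[k] PathTensor A B →ₗ[k] PathTensor A C).compl₁₂
      LinearMap.id (PathTensor.cons.flip (PathTensor.nil A))).compr₂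
        (value (homogeneous (muLetter X))) = TotalHom.comp from
    DFunLike.congr_fun (DFunLike.congr_fun H a) b
  refine TotalHom.hom_ext fun u a => TotalHom.hom_ext fun v b => ?_
  rw [← value_muLetter, Path.val_cons, Path.val_cons]
  rfl

/-- The composition of `𝔞` is associative: `μ{μ} = 0`. -/
lemma m_mu_mu (t : ℤ) : (hochschild X).m t (tens [muLetter X]) (tens [muLetter X]) = 0 := by
  refine (m_singleton _ _ _).trans (homogeneous_injective fun A B x hx => ?_)
  refine (value_brace _ _ _ x hx).trans (Eq.trans ?_ (value_zero t x).symm)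
  rw [actLinear_tens]
  -- As `μ{μ}` has degree three, only tensors with three factors matter.
  by_cases h : x.length = 3
  · cases x with
    | nil => simp [Path.length] at h
    | cons x u a =>
    cases x with
    | nil => simp [Path.length] at h
    | cons x v b =>
    cases x with
    | nil => simp [Path.length] at h
    | cons x w c =>
    cases x with
    | cons => simp [Path.length] at h
    | nil =>
      have hv := fun {A B : X.Pt} (x : Path A B) => value_muLetter_of_ne x
      have hC : ∀ {A C : X.Pt} (x : Path A C),
          consOp (muLetter X) 0 (fun _ _ => LinearMap.id) A C x.val =
          x.sumCuts fun B l e => cons (value (homogeneous (muLetter X)) l.val) e.val := by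
        intro A C x
        rw [consOp_val]; simp
      -- The inner `μ` moves past the leftmost factor in one of the two terms; this sign makes the
      -- two bracketings cancel.
      have s : koszulSign k ((muLetter X).1 - 1 + 0) = -1 := by simp [muLetter, koszulSign]
      have h₀ := hC (Path.nil : Path A A)
      have h₁ := hC (Path.nil.cons w c)
      have h₂ := hC ((Path.nil.cons w c).cons v b)
      have h₃ := hC (((Path.nil.cons w c).cons v b).cons u a)
      simp only [Path.sumCuts, hv Path.nil (by simp [Path.length]),
        hv (Path.nil.cons _ _) (by simp [Path.length]),
        hv (((Path.nil.cons _ _).cons _ _).cons _ _) (by simp [Path.length]), value_muLetter,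
        map_zero, LinearMap.zero_apply, zero_add, add_zero] at h₀ h₁ h₂ h₃
      simp only [Path.val_cons, Path.val_nil] at h₀ h₁ h₂ h₃ ⊢
      simp only [wordOp, deg_nil, leftStep_cons, leftStep_nil, h₀, h₁, h₂, h₃, map_zero, smul_zero,
        zero_add, s, map_add, map_smul, value_muLetter_cons_cons, TotalHom.comp_assoc]
      module
  · refine value_eq_zero_of_mem_lengthPart _ (fun h' => h ?_) (wordOp_mem_lengthPart _ x)
    rw [deg_muLetter] at h'
    simp only [muLetter] at h'
    omega

/-- Besides `μ{μ}`, the product contains `μ ⊗ μ` twice, with opposite signs because `μ` is odd in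
`sC`. -/
lemma mul_mu_mu : mul [muLetter X] [muLetter X] = 0 := by
  rw [cons_mul]
  have h : tens [mulLetter [muLetter X] [muLetter X]] = 0 :=
    tens_singleton_eq_zero _ (m_mu_mu _)
  have s : koszulSign k ((muLetter X).1 - 1) = -1 := by simp [muLetter, koszulSign]
  simp only [mulHead, mul_nil, nil_mul, List.sumSplits, h, deg_nil, deg_muLetter, mul_one,
    mul_zero, koszulSign.zero, one_smul, zero_mul, mulLetter_singleton_nil, s, add_zero, neg_smul]
  exact neg_add_cancel _

lemma koszulSign_add_one (a : ℤ) : koszulSign k (a + 1) = -koszulSign k a := by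
  rw [koszulSign.add]; simp [koszulSign]

/-- The double commutator with `μ` consists of terms containing `μ μ = 0` and of two terms `μ x μ`
with opposite signs. -/
lemma b_d (x : (hochschild X).Word) (t : ℤ) : (hochschild X).b t (d x) = 0 := by
  have h₁ := m_assoc [muLetter X] [muLetter X] x t
  have h₂ := m_assoc [muLetter X] x [muLetter X] t
  have h₃ := m_assoc x [muLetter X] [muLetter X] t
  rw [mul_mu_mu, map_zero] at h₁ h₃
  rw [b_apply t _ (d_mem_degreePart_of_eq (d_eq x)), d_eq, koszulSign_add_one]
  simp only [map_sub, map_smul, LinearMap.sub_apply, LinearMap.smul_apply, ← h₁, h₂, h₃,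
    LinearMap.zero_apply]
  module

/-- A graded commutator is a derivation of an associative product: the two terms with `μ` between
`x` and `y` cancel. -/
lemma leibniz (x y : (hochschild X).Word) (t : ℤ) : (hochschild X).b t (mul x y) =
    (hochschild X).m t (d x) (tens y) +
      (deg x).negOnePow • (hochschild X).m t (tens x) (d y) := by
  have h₁ := m_assoc [muLetter X] x y t
  have h₂ := m_assoc x [muLetter X] y t
  have h₃ := m_assoc x y [muLetter X] t
  rw [koszulSign.smul_eq (k := k), b_apply t _ (mul_mem_degreePart x y), d_eq, d_eq, koszulSign.add]
  simp only [map_sub, map_smul, LinearMap.sub_apply, LinearMap.smul_apply, h₁, h₂, h₃]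
  module

/-- The Hochschild complex is a `B∞`-algebra. -/
theorem hochschild_isBInf (X : MapGr k) : (hochschild X).IsBInf where
  b_deg := b_deg
  m_deg := m_deg
  b_one := b_one
  one_m := m_one_left
  m_one := m_one_right
  assoc := m_assoc
  b_d := b_d
  leibniz := leibniz

end MapGr

/-! ### Gluing of cochains and the sheaf property. -/

namespace MapGr

variable {k : Type u} [CommRing k] {X Y : MapGr k}

lemma Fun.tens_bijective (F : X ⟶ Y) (hF : subcartesian k F) {A B : X.Pt} (p : X.Str A B) :
    Function.Bijective (Fun.tens F p) := by
  induction p with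
  | nil => exact Function.bijective_id
  | @cons B C p u ih =>
    exact (TensorProduct.congr (LinearEquiv.ofBijective _ (hF u B.ob C.ob))
      (LinearEquiv.ofBijective _ ih)).bijective

/-- The value of a restriction at `s` is the value at the image of `s`, composed on both sides with
isomorphisms. -/
lemma restr_apply_eq_iff (F : X ⟶ Y) (hF : subcartesian k F) {n : ℤ} (φ ψ : Y.cochain n)
    (s : X.Simplex n) :
    restr F hF n φ s = restr F hF n ψ s ↔ φ (s.map F) = ψ (s.map F) := by
  refine ⟨fun h => LinearMap.ext fun y => ?_, fun h => ?_⟩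
  · obtain ⟨x, rfl⟩ := (Fun.tens_bijective F hF s.str).2 y
    exact (tr (Fun.total_str F s.str)).injective
      ((map_restr F hF φ s x).symm.trans ((congrArg (fun g => Fun.map F _ _ _ (g x)) h).trans
        (map_restr F hF ψ s x)))
  · exact congrArg (fun g => Fun.inv F hF s.str.total ∘ₗ
      (tr (Fun.total_str F s.str)).toLinearMap ∘ₗ g ∘ₗ Fun.tens F s.str) h

open Classical in
-- Values at different simplices are independent: the transported value is placed at the image of
-- `s` and extended by zero.
lemma exists_restr_apply_eq (F : X ⟶ Y) (hF : subcartesian k F) {n : ℤ} (ψ : X.cochain n)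
    (s : X.Simplex n) : ∃ φ : Y.cochain n, restr F hF n φ s = ψ s := by
  let e := LinearEquiv.ofBijective _ (Fun.tens_bijective F hF s.str)
  let g : (s.map F).str.tens →ₗ[k] Y.hom (s.map F).str.total (s.map F).src.ob (s.map F).tgt.ob :=
    (tr (Fun.total_str F s.str)).symm.toLinearMap ∘ₗ Fun.map F _ _ _ ∘ₗ ψ s ∘ₗ e.symm.toLinearMap
  refine ⟨Pi.single (s.map F) g, LinearMap.ext fun x => (hF s.str.total s.src.ob s.tgt.ob).1 ?_⟩
  refine (map_restr F hF _ s x).trans ?_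
  have h : (Pi.single (s.map F) g : ∀ t : Y.Simplex n, t.str.tens →ₗ[k]
      Y.hom t.str.total t.src.ob t.tgt.ob) (s.map F) (Fun.tens F s.str x) =
        g (Fun.tens F s.str x) := by rw [Pi.single_eq_same]
  refine (congrArg (tr (Fun.total_str F s.str)) h).trans
    (((tr (Fun.total_str F s.str)).apply_symm_apply _).trans ?_)
  exact congrArg (fun y => Fun.map F _ _ _ (ψ s y)) (e.symm_apply_apply x)

section gluing

variable {X : MapSc k} {S : Presieve X} {n : ℤ}

/-- Every `n`-simplex lifts along some member of the presieve. -/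
def LiftsSimplices (S : Presieve X) (n : ℤ) : Prop :=
  ∀ s : X.obj.Simplex n, ∃ (Y : MapSc k) (f : Y ⟶ X), S f ∧ ∃ t : Y.obj.Simplex n, t.map f.hom = s

/-- In negative degrees there are no simplices, so the bound is needed only if `n` is a natural
number. -/
lemma IsCover.liftsSimplices {N : ℕ∞} (hS : IsCover N X S) (hn : ∀ m : ℕ, n = m → (m : ℕ∞) ≤ N) :
    LiftsSimplices S n := by
  rintro ⟨A, B, p, rfl⟩
  exact hS _ (hn _ rfl) _

lemma LiftsSimplices.cochain_ext (hS : LiftsSimplices S n) {φ ψ : X.obj.cochain n}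
    (h : ∀ (Y : MapSc k) (f : Y ⟶ X), S f →
      restr f.hom f.property n φ = restr f.hom f.property n ψ) : φ = ψ := by
  funext s
  obtain ⟨Y, f, hf, t, rfl⟩ := hS s
  exact (restr_apply_eq_iff _ f.property _ _ _).1 (congrFun (h Y f hf) t)

/-- Compatibility of a family of cochains indexed by a presieve. -/
def CompatibleCochains (x : ∀ ⦃Y : MapSc k⦄ (f : Y ⟶ X), S f → Y.obj.cochain n) : Prop :=
  ∀ ⦃Y₁ Y₂ Z : MapSc k⦄ (g₁ : Z ⟶ Y₁) (g₂ : Z ⟶ Y₂) ⦃f₁ : Y₁ ⟶ X⦄ ⦃f₂ : Y₂ ⟶ X⦄ (h₁ : S f₁)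
    (h₂ : S f₂), g₁ ≫ f₁ = g₂ ≫ f₂ →
      restr g₁.hom g₁.property n (x f₁ h₁) = restr g₂.hom g₂.property n (x f₂ h₂)

lemma restr_restr {Y Z : MapSc k} (g : Z ⟶ Y) (f : Y ⟶ X) (φ : X.obj.cochain n) :
    restr g.hom g.property n (restr f.hom f.property n φ) =
      restr (g ≫ f).hom (g ≫ f).property n φ :=
  (DFunLike.congr_fun (restr_comp g.hom f.hom g.property f.property n) φ).symm

lemma LiftsSimplices.exists_cochain (hS : LiftsSimplices S n)
    {x : ∀ ⦃Y : MapSc k⦄ (f : Y ⟶ X), S f → Y.obj.cochain n} (hx : CompatibleCochains x) :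
    ∃ φ : X.obj.cochain n, ∀ (Y : MapSc k) (f : Y ⟶ X) (hf : S f),
      restr f.hom f.property n φ = x f hf := by
  choose Y f hf t ht using hS
  -- Of the auxiliary cochain `φ s` only the value at `s` is used; the glued cochain is the diagonal
  -- `φ s s`.
  choose φ hφ using fun s => exists_restr_apply_eq (f s).hom (f s).property (x (f s) (hf s)) (t s)
  refine ⟨fun s => φ s s, fun Y' f' hf' => funext fun t' => ?_⟩
  have h₁ : restr f'.hom f'.property n (fun s => φ s s) t' =
      restr f'.hom f'.property n (φ (t'.map f'.hom)) t' :=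
    (restr_apply_eq_iff _ f'.property _ _ _).2 rfl
  refine h₁.trans ?_
  generalize hs : t'.map f'.hom = s
  -- The chosen lift `t s` and the given lift `t'` of `s` are the projections of a simplex `r` of
  -- the pullback. There compatibility of the family identifies the values prescribed by the two
  -- lifts.
  obtain ⟨r, hr₁, hr₂⟩ := exists_simplex f'.property (t s) t' ((ht s).trans hs.symm)
  let c := pbCone (f s) f'
  change r.map c.fst.hom = t s at hr₁
  change r.map c.snd.hom = t' at hr₂
  subst hr₂
  refine (restr_apply_eq_iff c.snd.hom c.snd.property _ _ r).1 ?_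
  rw [restr_restr, ← hx c.fst c.snd (hf s) hf' c.condition]
  have h₂ := restr_restr (n := n) c.fst (f s) (φ s)
  rw [show c.snd ≫ f' = c.fst ≫ f s from c.condition.symm, ← h₂]
  refine (restr_apply_eq_iff c.fst.hom c.fst.property _ _ r).2 ?_
  rw [hr₁, hφ]

/-- Compatible families of linear maps into the modules of cochains glue. -/
lemma LiftsSimplices.exists_linearMap (hS : LiftsSimplices S n) {M : Type u} [AddCommGroup M]
    [Module k M] {x : ∀ ⦃Y : MapSc k⦄ (f : Y ⟶ X), S f → (M →ₗ[k] Y.obj.cochain n)}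
    (hx : ∀ m, CompatibleCochains fun Y (f : Y ⟶ X) hf => x f hf m) :
    ∃ φ : M →ₗ[k] X.obj.cochain n, ∀ (Y : MapSc k) (f : Y ⟶ X) (hf : S f),
      restr f.hom f.property n ∘ₗ φ = x f hf := by
  choose φ hφ using fun m => hS.exists_cochain (hx m)
  refine ⟨⟨⟨φ, fun a b => hS.cochain_ext fun Y f hf => ?_⟩,
    fun c a => hS.cochain_ext fun Y f hf => ?_⟩, fun Y f hf => LinearMap.ext fun m => hφ m Y f hf⟩
  · exact (hφ (a + b) Y f hf).trans ((map_add _ a b).trans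
      ((congrArg₂ _ (hφ a Y f hf).symm (hφ b Y f hf).symm).trans (map_add _ _ _).symm))
  · exact (hφ (c • a) Y f hf).trans ((map_smul _ c a).trans
      ((congrArg _ (hφ a Y f hf).symm).trans (map_smul _ c _).symm))

end gluing

lemma isSheaf_cochainPresheaf (N : ℕ∞) (n : ℕ) (hn : (n : ℕ∞) ≤ N) :
    Presheaf.IsSheaf (nCoverPretopology k N).toGrothendieck (cochainPresheaf k n) := by
  -- A presheaf of modules is a sheaf if the maps from every fixed module `E` form a sheaf of sets,
  -- hence the gluing of linear maps instead of elements.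
  intro E
  rw [Presieve.isSheaf_pretopology]
  intro X S hS x hx
  have hS' : LiftsSimplices S (n : ℤ) :=
    IsCover.liftsSimplices (N := N) hS fun m hm => by rwa [← Int.natCast_inj.1 hm]
  obtain ⟨φ, hφ⟩ := hS'.exists_linearMap (M := E) (x := fun Y f hf => (x f hf).hom)
    fun m Y₁ Y₂ Z g₁ g₂ f₁ f₂ h₁ h₂ w =>
      congrArg (fun g : E ⟶ (cochainPresheaf k n).obj (Opposite.op Z) => g.hom m)
        (hx g₁ g₂ h₁ h₂ w)
  refine ⟨ModuleCat.ofHom φ, fun Y f hf => ModuleCat.hom_ext (hφ Y f hf), fun ψ hψ => ?_⟩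
  refine ModuleCat.hom_ext (LinearMap.ext fun m => hS'.cochain_ext fun Y f hf => ?_)
  refine Eq.trans ?_ (DFunLike.congr_fun (hφ Y f hf) m).symm
  exact congrArg (fun g : E ⟶ (cochainPresheaf k n).obj (Opposite.op Y) => g.hom m) (hψ f hf)

/-- The components of a morphism of `B∞`-algebras are glued degree by degree. That the result
commutes with the operations is an equality of cochains, so it may be tested on the cover, where it
holds because restrictions and the given maps are morphisms. -/
lemma isSheaf_hochschildPresheaf :
    Presheaf.IsSheaf (nCoverPretopology k ⊤).toGrothendieck
      (ObjectProperty.lift (fun E : BInfData k => E.IsBInf) (hochschildPresheaf k)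
        fun X => hochschild_isBInf X.unop.obj : (MapSc k)ᵒᵖ ⥤ BInf k) := by
  intro E
  rw [Presieve.isSheaf_pretopology]
  intro X S hS x hx
  have hS' : ∀ n : ℤ, LiftsSimplices S n := fun n =>
    IsCover.liftsSimplices (N := ⊤) hS fun _ _ => le_top
  choose φ hφ using fun n => (hS' n).exists_linearMap (M := E.obj.V n)
    (x := fun Y f hf => (x f hf).hom.f n) fun m Y₁ Y₂ Z g₁ g₂ f₁ f₂ h₁ h₂ w =>
      congrArg (fun g : E ⟶ ⟨hochschild Z.obj, hochschild_isBInf Z.obj⟩ => g.hom.f n m)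
        (hx g₁ g₂ h₁ h₂ w)
  -- The operations take arguments in tensor coalgebras, so the gluing property is needed for the
  -- induced maps of these as well.
  have ht : ∀ (Y : MapSc k) (f : Y ⟶ X) (hf : S f) (t : TensorCoalgebra E.obj.V),
      tensorMap (restr f.hom f.property) (tensorMap φ t) = tensorMap (x f hf).hom.f t :=
    fun Y f hf t => (BInfData.tensorMap_comp φ (restr f.hom f.property) t).symm.trans
      (congrArg (fun g : ∀ n, E.obj.V n →ₗ[k] Y.obj.cochain n => tensorMap g t)
        (funext fun n => hφ n Y f hf))
  let Φ : BInfData.Hom E.obj (hochschild X.obj) :=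
    { f := φ
      map_b := fun n t => (hS' n).cochain_ext fun Y f hf => by
        refine (DFunLike.congr_fun (hφ n Y f hf) _).trans (((x f hf).hom.map_b n t).trans ?_)
        refine Eq.trans ?_ ((hochschildMap f.hom f.property).map_b n _).symm
        exact congrArg ((hochschild Y.obj).b n) (ht Y f hf t).symm
      map_m := fun n s t => (hS' n).cochain_ext fun Y f hf => by
        refine (DFunLike.congr_fun (hφ n Y f hf) _).trans (((x f hf).hom.map_m n s t).trans ?_)
        refine Eq.trans ?_ ((hochschildMap f.hom f.property).map_m n _ _).symm
        exact congrArg₂ (fun a b => (hochschild Y.obj).m n a b) (ht Y f hf s).symm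
          (ht Y f hf t).symm }
  refine ⟨⟨Φ⟩, fun Y f hf => ?_, fun ψ hψ => ?_⟩
  · exact ObjectProperty.hom_ext _ (BInfData.Hom.ext (funext fun n => hφ n Y f hf))
  · refine ObjectProperty.hom_ext _ (BInfData.Hom.ext (funext fun n => LinearMap.ext fun m =>
      (hS' n).cochain_ext fun Y f hf => ?_))
    refine Eq.trans ?_ (DFunLike.congr_fun (hφ n Y f hf) m).symm
    exact congrArg (fun g : E ⟶ ⟨hochschild Y.obj, hochschild_isBInf Y.obj⟩ => g.hom.f n m)
      (hψ f hf)

end MapGr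

theorem mainTheorem1 (k : Type u) [CommRing k] :
    (∀ (N : ℕ∞) (n : ℕ), (n : ℕ∞) ≤ N →
      Presheaf.IsSheaf (MapGr.nCoverPretopology k N).toGrothendieck (MapGr.cochainPresheaf k n)) ∧
    ∃ h : ∀ X : (MapGr.MapSc k)ᵒᵖ, ((MapGr.hochschildPresheaf k).obj X).IsBInf,
      Presheaf.IsSheaf (MapGr.nCoverPretopology k ⊤).toGrothendieck
        (ObjectProperty.lift (fun E : BInfData k => E.IsBInf) (MapGr.hochschildPresheaf k) h :
          (MapGr.MapSc k)ᵒᵖ ⥤ BInf k) :=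
  ⟨MapGr.isSheaf_cochainPresheaf, fun X => MapGr.hochschild_isBInf X.unop.obj,
    MapGr.isSheaf_hochschildPresheaf⟩
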